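/- Let $M^4$ be an oriented smooth $4$-dimensional manifold, possibly with boundary, with a smooth Riemannian metric $g$, and let $f$ be a smooth function on $M$ that vanishes on $\partial M$ and satisfies the Miao--Tam equation $$-(\Delta f)\,g+\mathrm{Hess}\,f-f\,\mathrm{Ric}=g .$$ Let $R$ be the scalar curvature, $W$ the Weyl tensor, and $W^+$ the tensor with components $W^+_{pqrs}=\tfrac12\,(W_{pqrs}+W_{pq\bar r\bar s})$ in positively oriented orthonormal frames, where $(r,s,\bar r,\bar s)$ is an even permutation of $(1,2,3,4)$. Suppose that $\operatorname{div}W^+=0$, where $(\operatorname{div}S)_{jkl}=\nabla_iS_{ijkl}$. For a real number $c$ let $\Sigma_c$ be the hypersurface of all regular points of $f$ (points with $\nabla f\neq0$) at which $f=c$ (so $\Sigma_c=f^{-1}(c)$ if $c$ is a regular value). At a point of $\Sigma_c$ let $\{e_1,e_2,e_3,e_4\}$ be any orthonormal frame with $e_4=\nabla f/|\nabla f|$, so that $e_1,e_2,e_3$ are tangent to $\Sigma_c$; write $R_{ij}=\mathrm{Ric}(e_i,e_j)$. Let $h_{ij}=g(\nabla_{e_i}e_4,e_j)$ $(1\le i,j\le3)$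 be the second fundamental form of $\Sigma_c$ with respect to the normal field $e_4=\nabla f/|\nabla f|$, and $H=\sum_{i=1}^3h_{ii}$ its mean curvature. Then the following hold. 1. At every regular point of $f$, $\nabla f$ is an eigenvector of $\mathrm{Ric}$. 2. $R_{4i}=0$ for $i\in\{1,2,3\}$, and $e_4$ is an eigenvector of the Ricci operator (with eigenvalue $R_{44}$). 3. $|\nabla f|^2$ is constant on each connected component of $\Sigma_c$. 4. The second fundamental form and the mean curvature of $\Sigma_c$ are $$h_{ij}=\frac{(1+\Delta f)g_{ij}+fR_{ij}}{|\nabla f|},\qquad H=\frac{3(1+\Delta f)+f(R-R_{44})}{|\nabla f|}.$$ 5. At every regular point of $f$, $$3|\mathrm{Ric}|^2\ \ge\ 3R_{44}^2+(R-R_{44})^2 .$$ Equality at a regular point $p$ implies that the level surface through $p$ is umbilical at $p$, and the converse holds if $f(p)\neq0$; on every open set of regular points, equality holds at all points if and only if at all points the level surface through the point is umbilical there. If every point of a connected component of $\Sigma_c$ is umbilical, then $H$ is constant on this component and $W_{4ijk}=0$ there for $i,j,k\in\{1,2,3\}$. -/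

import Mathlib

open scoped Manifold ContDiff

noncomputable section

namespace MiaoTam

/-- The coordinate space of a four-dimensional manifold (with or without boundary). -/
abbrev E4 : Type := EuclideanSpace ℝ (Fin 4)

/-! ### Riemannian geometry in one coordinate system

`G x` is the matrix of the metric and `F` a function, both read in coordinates `x`. The coordinates
fill a relatively open subset of the closed half space `{x | 0 ≤ x 0}`, the range of `𝓡∂ 4`, so
partial derivatives are taken within that half space. Tangent vectors are given by their components
`X : Fin 4 → ℝ`. -/

/-- The partial derivative `∂ᵢ u` at `x`. -/
def pd (i : Fin 4) (u : E4 → ℝ) (x : E4) : ℝ :=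
  fderivWithin ℝ u (Set.range (𝓡∂ 4)) x (EuclideanSpace.single i 1)

/-- The components `g^{ij}` of the inverse metric. -/
def ginv (G : E4 → Matrix (Fin 4) (Fin 4) ℝ) (x : E4) (i j : Fin 4) : ℝ := (G x)⁻¹ i j

/-- The Christoffel symbols `Γ^k_{ij}` of the Levi-Civita connection. -/
def christoffel (G : E4 → Matrix (Fin 4) (Fin 4) ℝ) (k i j : Fin 4) (x : E4) : ℝ :=
  (1 / 2) * ∑ l, ginv G x k l *
    (pd i (fun y => G y j l) x + pd j (fun y => G y i l) x - pd l (fun y => G y i j) x)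

/-- The component `R^m_{lij}` of the curvature: the `m`-th component of `R(∂ᵢ, ∂ⱼ) ∂ₗ`, where
`R(X, Y) = ∇_X ∇_Y - ∇_Y ∇_X - ∇_[X, Y]`. -/
def riemUp (G : E4 → Matrix (Fin 4) (Fin 4) ℝ) (m l i j : Fin 4) (x : E4) : ℝ :=
  pd i (christoffel G m j l) x - pd j (christoffel G m i l) x
    + ∑ p, (christoffel G m i p x * christoffel G p j l x
      - christoffel G m j p x * christoffel G p i l x)

/-- The curvature tensor `R_{ijkl} = g(R(∂ᵢ, ∂ⱼ) ∂ₗ, ∂ₖ)`; `R_{ijij}` is positive on round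
spheres. -/
def riem (G : E4 → Matrix (Fin 4) (Fin 4) ℝ) (i j k l : Fin 4) (x : E4) : ℝ :=
  ∑ m, G x k m * riemUp G m l i j x

/-- The Ricci tensor `R_{ik} = g^{jl} R_{ijkl}`. -/
def ric (G : E4 → Matrix (Fin 4) (Fin 4) ℝ) (i k : Fin 4) (x : E4) : ℝ :=
  ∑ j, ∑ l, ginv G x j l * riem G i j k l x

/-- The scalar curvature `R`. -/
def scal (G : E4 → Matrix (Fin 4) (Fin 4) ℝ) (x : E4) : ℝ :=
  ∑ i, ∑ j, ginv G x i j * ric G i j x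

/-- The squared norm `|Ric|²` of the Ricci tensor. -/
def ricNormSq (G : E4 → Matrix (Fin 4) (Fin 4) ℝ) (x : E4) : ℝ :=
  ∑ i, ∑ j, ∑ k, ∑ l, ginv G x i k * ginv G x j l * ric G i j x * ric G k l x

/-- The Weyl tensor in dimension four. -/
def weyl (G : E4 → Matrix (Fin 4) (Fin 4) ℝ) (i j k l : Fin 4) (x : E4) : ℝ :=
  riem G i j k l x
    - (1 / 2) * (ric G i k x * G x j l + ric G j l x * G x i k
      - ric G i l x * G x j k - ric G j k x * G x i l)
    + (scal G x / 6) * (G x j l * G x i k - G x i l * G x j k)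

/-- The Levi-Civita symbol: the sign of the permutation `(i, j, k, l)` of the four indices, and `0`
if two of them agree. -/
def levi (i j k l : Fin 4) : ℤ :=
  Matrix.det (Matrix.of fun a b : Fin 4 => if ![i, j, k, l] a = b then (1 : ℤ) else 0)

/-- The Riemannian volume form in positively oriented coordinates. -/
def volForm (G : E4 → Matrix (Fin 4) (Fin 4) ℝ) (i j k l : Fin 4) (x : E4) : ℝ :=
  Real.sqrt (G x).det * (levi i j k l : ℝ)

/-- The Weyl tensor with the Hodge star applied to its second pair of indices. In a positively
oriented orthonormal frame its components are those of `W` with `(k, l)` replaced by the dual pair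
`(k', l')`, for which `(k, l, k', l')` is an even permutation. -/
def weylStar (G : E4 → Matrix (Fin 4) (Fin 4) ℝ) (i j k l : Fin 4) (x : E4) : ℝ :=
  (1 / 2) * ∑ a, ∑ b, ∑ c, ∑ d,
    volForm G k l a b x * ginv G x a c * ginv G x b d * weyl G i j c d x

/-- The part `W⁺` of the Weyl tensor. -/
def weylPlus (G : E4 → Matrix (Fin 4) (Fin 4) ℝ) (i j k l : Fin 4) (x : E4) : ℝ :=
  (1 / 2) * (weyl G i j k l x + weylStar G i j k l x)

/-- The covariant derivative `∇ₘ S_{ijkl}` of a covariant four-tensor. -/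
def covDeriv4 (G : E4 → Matrix (Fin 4) (Fin 4) ℝ) (S : Fin 4 → Fin 4 → Fin 4 → Fin 4 → E4 → ℝ)
    (m i j k l : Fin 4) (x : E4) : ℝ :=
  pd m (S i j k l) x
    - ∑ p, (christoffel G p m i x * S p j k l x + christoffel G p m j x * S i p k l x
      + christoffel G p m k x * S i j p l x + christoffel G p m l x * S i j k p x)

/-- The divergence `(div S)_{jkl} = g^{mi} ∇ₘ S_{ijkl}` of a covariant four-tensor. -/
def div4 (G : E4 → Matrix (Fin 4) (Fin 4) ℝ) (S : Fin 4 → Fin 4 → Fin 4 → Fin 4 → E4 → ℝ)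
    (j k l : Fin 4) (x : E4) : ℝ :=
  ∑ m, ∑ i, ginv G x m i * covDeriv4 G S m i j k l x

/-- The Hessian `∇ᵢ ∇ⱼ F`. -/
def hess (G : E4 → Matrix (Fin 4) (Fin 4) ℝ) (F : E4 → ℝ) (i j : Fin 4) (x : E4) : ℝ :=
  pd i (pd j F) x - ∑ k, christoffel G k i j x * pd k F x

/-- The Laplacian `Δ F`, the trace of the Hessian. -/
def lap (G : E4 → Matrix (Fin 4) (Fin 4) ℝ) (F : E4 → ℝ) (x : E4) : ℝ :=
  ∑ i, ∑ j, ginv G x i j * hess G F i j x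

/-- The components of the gradient `∇F`. -/
def grad (G : E4 → Matrix (Fin 4) (Fin 4) ℝ) (F : E4 → ℝ) (x : E4) (k : Fin 4) : ℝ :=
  ∑ l, ginv G x k l * pd l F x

/-- `g(X, Y)` at `x`. -/
def gAt (G : E4 → Matrix (Fin 4) (Fin 4) ℝ) (x : E4) (X Y : Fin 4 → ℝ) : ℝ :=
  ∑ i, ∑ j, G x i j * X i * Y j

/-- `Ric(X, Y)` at `x`. -/
def ricAt (G : E4 → Matrix (Fin 4) (Fin 4) ℝ) (x : E4) (X Y : Fin 4 → ℝ) : ℝ :=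
  ∑ i, ∑ j, ric G i j x * X i * Y j

/-- `W(X, Y, Z, V)` at `x`. -/
def weylAt (G : E4 → Matrix (Fin 4) (Fin 4) ℝ) (x : E4) (X Y Z V : Fin 4 → ℝ) : ℝ :=
  ∑ i, ∑ j, ∑ k, ∑ l, weyl G i j k l x * X i * Y j * Z k * V l

/-- The norm `|∇F|`. -/
def gradNorm (G : E4 → Matrix (Fin 4) (Fin 4) ℝ) (F : E4 → ℝ) (x : E4) : ℝ :=
  Real.sqrt (gAt G x (grad G F x) (grad G F x))

/-- The components of the unit normal `∇F / |∇F|` of the level sets of `F`. -/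
def normal (G : E4 → Matrix (Fin 4) (Fin 4) ℝ) (F : E4 → ℝ) (x : E4) (k : Fin 4) : ℝ :=
  grad G F x k / gradNorm G F x

/-- The `k`-th component of `∇_{∂ᵢ} N`, where `N = ∇F / |∇F|`. -/
def covNormal (G : E4 → Matrix (Fin 4) (Fin 4) ℝ) (F : E4 → ℝ) (i k : Fin 4) (x : E4) : ℝ :=
  pd i (fun y => normal G F y k) x + ∑ l, christoffel G k i l x * normal G F x l

/-- The bilinear form `g(∇_X N, Y)`, where `N = ∇F / |∇F|`; on vectors tangent to the level set of
`F` through `x` this is the second fundamental form `h(X, Y)` of the level set. -/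
def secondFF (G : E4 → Matrix (Fin 4) (Fin 4) ℝ) (F : E4 → ℝ) (x : E4) (X Y : Fin 4 → ℝ) : ℝ :=
  ∑ i, ∑ j, ∑ k, G x j k * covNormal G F i k x * X i * Y j

/-- `X` is tangent to the level set of `F` through `x`, that is, `dF(X) = 0`. -/
def IsTangentToLevel (F : E4 → ℝ) (x : E4) (X : Fin 4 → ℝ) : Prop :=
  ∑ i, pd i F x * X i = 0

/-- The level set of `F` through `x` is umbilical at `x`: its second fundamental form is a multiple
of its metric. -/
def IsUmbilicIn (G : E4 → Matrix (Fin 4) (Fin 4) ℝ) (F : E4 → ℝ) (x : E4) : Prop :=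
  ∃ κ : ℝ, ∀ X Y : Fin 4 → ℝ, IsTangentToLevel F x X → IsTangentToLevel F x Y →
    secondFF G F x X Y = κ * gAt G x X Y

/-- An orthonormal basis `e` of the tangent space at `x` whose last member is `∇F / |∇F|`; its first
three members are then tangent to the level set of `F`. -/
structure IsAdaptedFrame (G : E4 → Matrix (Fin 4) (Fin 4) ℝ) (F : E4 → ℝ) (x : E4)
    (e : Fin 4 → Fin 4 → ℝ) : Prop where
  orthonormal : ∀ a b, gAt G x (e a) (e b) = if a = b then 1 else 0
  last_eq : e 3 = normal G F x

/-- The mean curvature at `x` of the level set of `F` through `x`: the trace of its second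
fundamental form (the sum of the three principal curvatures). The inverse of the induced metric has
the components `g^{ij} - N^i N^j`, where `N = ∇F / |∇F|`. -/
def meanCurv (G : E4 → Matrix (Fin 4) (Fin 4) ℝ) (F : E4 → ℝ) (x : E4) : ℝ :=
  ∑ i, ∑ j, (ginv G x i j - normal G F x i * normal G F x j) *
    secondFF G F x (Pi.single i 1) (Pi.single j 1)

/-! ### Passage from a manifold to coordinates -/

section Manifold

variable {M : Type*} [TopologicalSpace M] [ChartedSpace (EuclideanHalfSpace 4) M]

/-- The `i`-th coordinate vector field of the chart `e`, at the point with coordinates `x`. -/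
def coordVec (e : OpenPartialHomeomorph M (EuclideanHalfSpace 4)) (i : Fin 4) (x : E4) :
    TangentSpace (𝓡∂ 4) ((e.extend (𝓡∂ 4)).symm x) :=
  mfderivWithin 𝓘(ℝ, E4) (𝓡∂ 4) (e.extend (𝓡∂ 4)).symm (Set.range (𝓡∂ 4)) x
    (EuclideanSpace.single i (1 : ℝ) : E4)

/-- The function `f` in the chart `e`. -/
def inChart (f : M → ℝ) (e : OpenPartialHomeomorph M (EuclideanHalfSpace 4)) (x : E4) : ℝ :=
  f ((e.extend (𝓡∂ 4)).symm x)

/-- The charts of the atlas of `M` have transition maps with positive Jacobian determinant, so that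
they orient `M`. -/
def IsOrientedAtlas (M : Type*) [TopologicalSpace M] [ChartedSpace (EuclideanHalfSpace 4) M] :
    Prop :=
  ∀ e ∈ atlas (EuclideanHalfSpace 4) M, ∀ e' ∈ atlas (EuclideanHalfSpace 4) M,
    ∀ p ∈ e.source ∩ e'.source,
      0 < (fderivWithin ℝ (fun x => e'.extend (𝓡∂ 4) ((e.extend (𝓡∂ 4)).symm x))
        (Set.range (𝓡∂ 4)) (e.extend (𝓡∂ 4) p)).det

/-- `p` is a regular point of `f`. -/
def IsRegularPoint (f : M → ℝ) (p : M) : Prop := mfderiv (𝓡∂ 4) 𝓘(ℝ, ℝ) f p ≠ 0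

/-- The connected component of `p` in the level surface of `f` through `p`, where the level surface
consists of the regular points `x` with `f x = f p` (of all points of the level set, if `f p` is a
regular value). -/
def levelComponent (f : M → ℝ) (p : M) : Set M :=
  connectedComponentIn {x | f x = f p ∧ IsRegularPoint f x} p

variable [IsManifold (𝓡∂ 4) ∞ M]

/-- The matrix of the metric `g` in the chart `e`. -/
def metricInChart
    (g : Bundle.ContMDiffRiemannianMetric (𝓡∂ 4) ∞ E4 (fun p : M => TangentSpace (𝓡∂ 4) p))
    (e : OpenPartialHomeomorph M (EuclideanHalfSpace 4)) (x : E4) : Matrix (Fin 4) (Fin 4) ℝ :=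
  Matrix.of fun i j => g.inner ((e.extend (𝓡∂ 4)).symm x) (coordVec e i x) (coordVec e j x)

/-- The equation `-(Δf) g + Hess f - f Ric = g` on `M`. -/
def SatisfiesMiaoTamEq
    (g : Bundle.ContMDiffRiemannianMetric (𝓡∂ 4) ∞ E4 (fun p : M => TangentSpace (𝓡∂ 4) p))
    (f : M → ℝ) : Prop :=
  ∀ e ∈ atlas (EuclideanHalfSpace 4) M, ∀ x ∈ (e.extend (𝓡∂ 4)).target, ∀ i j : Fin 4,
    -(lap (metricInChart g e) (inChart f e) x) * metricInChart g e x i j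
      + hess (metricInChart g e) (inChart f e) i j x
      - inChart f e x * ric (metricInChart g e) i j x = metricInChart g e x i j

/-- `div W⁺ = 0` on `M`, for the orientation given by the atlas. -/
def HasHarmonicWeylPlus
    (g : Bundle.ContMDiffRiemannianMetric (𝓡∂ 4) ∞ E4 (fun p : M => TangentSpace (𝓡∂ 4) p)) :
    Prop :=
  ∀ e ∈ atlas (EuclideanHalfSpace 4) M, ∀ x ∈ (e.extend (𝓡∂ 4)).target, ∀ j k l : Fin 4,
    div4 (metricInChart g e) (weylPlus (metricInChart g e)) j k l x = 0

/-- The level set of `f` through `p` is umbilical at `p`. -/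
def IsUmbilicAt
    (g : Bundle.ContMDiffRiemannianMetric (𝓡∂ 4) ∞ E4 (fun p : M => TangentSpace (𝓡∂ 4) p))
    (f : M → ℝ) (p : M) : Prop :=
  ∀ e ∈ atlas (EuclideanHalfSpace 4) M, p ∈ e.source →
    IsUmbilicIn (metricInChart g e) (inChart f e) (e.extend (𝓡∂ 4) p)

/-- The equality `3|Ric|² = 3 R₄₄² + (R - R₄₄)²` at `p`, where `R₄₄ = Ric(N, N)` and
`N = ∇f / |∇f|`. -/
def RicciEqualityAt
    (g : Bundle.ContMDiffRiemannianMetric (𝓡∂ 4) ∞ E4 (fun p : M => TangentSpace (𝓡∂ 4) p))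
    (f : M → ℝ) (p : M) : Prop :=
  ∀ e ∈ atlas (EuclideanHalfSpace 4) M, p ∈ e.source →
    let G := metricInChart g e
    let x := e.extend (𝓡∂ 4) p
    let N := normal G (inChart f e) x
    3 * ricNormSq G x = 3 * ricAt G x N N ^ 2 + (scal G x - ricAt G x N N) ^ 2

end Manifold

end MiaoTam

end

/-!
The proof works in the charts of `M`, where tensors are given by components. The identities of
Riemannian geometry that it needs are algebra: they hold over any commutative ring with four
commuting derivations, a metric and its Christoffel symbols (`LeviCivita`), and are applied to the
ring of smooth functions of a coordinate domain (`geom`).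

Write `q = |∇f|²`. Commuting derivatives in the Miao–Tam equation expresses `f` times the Cotton
tensor by the curvature in the direction of `∇f` (`LeviCivita.cotton_eq`). Its trace is `f dR = 0`
(`LeviCivita.mul_d_scal`). As `f` cannot vanish on an open set, where the equation would read
`0 = g`, the scalar curvature is constant (`IsMiaoTamChart.pd_scal`). Hence `div W` is half the
Cotton tensor, and as the Hodge star is parallel, `div W⁺ = 0` says that the Cotton tensor is
anti-self-dual in its skew pair of indices (`LeviCivita.cotton_asd`). Contracting it with `∇f` kills
the curvature term and shows that the two-form `df ∧ Ric(∇f, ·)` is anti-self-dual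
(`LeviCivita.cotton_grad`). The star of a decomposable two-form is annihilated by its factors, so
the form itself is annihilated by `∇f`, which makes `∇f` an eigenvector of the Ricci tensor
(`LeviCivita.ricGrad_eigen`).

The remaining pointwise assertions follow. The second fundamental form of a level set is
`Hess f / |∇f|` (`secondFF_eq`), into which the equation is substituted. `dq = 2 Hess f (∇f, ·)` is
a multiple of `df`, so `q` is stationary along the level sets (`IsMiaoTamChart.pd_pairIn_tangent`).
The difference of the two sides of the inequality for `|Ric|²` is a sum of squares
(`IsMiaoTamChart.ricci_defect`) that vanishes exactly if `Ric` is a multiple of the metric on the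
level set. This implies umbilicity, and is implied by it where `f ≠ 0`; on open sets the points with
`f = 0` are reached by continuity, as `f ≠ 0` on a dense set
(`IsMiaoTamChart.ricciEquality_of_eventually`).

On a component of a level surface that consists of umbilical points, the Codazzi equation
`f (∇_X Ric (Z, Y) - ∇_Y Ric (Z, X)) = -R(X, Y, ∇f, Z)` (`IsMiaoTamChart.codazzi`) decides
everything. If `f = 0` it says that the mixed curvature `R(X, Y, ∇f, Z)` vanishes. If `f ≠ 0`, the
Ricci tensor is an explicit combination of `g` and `df ⊗ df` along the component;
differentiating this along the component expresses both sides of the Codazzi equation by the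
derivative of `Ric(∇f, ∇f)`, and its trace over the tangent directions, where `∇f` is an
eigenvector, shows that this derivative and with it the mixed curvature vanish
(`IsMiaoTamChart.umbilic_derivative`). Because `∇f` is an eigenvector of `Ric`, the mixed components
of the Weyl tensor agree with those of the curvature. The mean curvature is
`(-1 - f Ric(∇f, ∇f) / q) / √q` (`IsMiaoTamChart.meanCurv_eq_grad`), hence locally constant.

Stationary functions are locally constant on the level surfaces since these are locally connected by
differentiable curves: at interior points by the inverse function theorem (`exists_level_param`),
and at boundary points because the level surface is the boundary there, as `f` vanishes on it
(`IsCoordDomain.eventually_eq_of_boundary`). To pass between charts it is enough to know that the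
pairing `⟨∇u, ∇w⟩` of gradients does not depend on the chart (`pairIn_eq_pairIn`): `q` is such a
pairing, and the principal curvature at an umbilical point can be written in terms of such pairings,
since `Hess f` on gradients can (`LeviCivita.hess_polar`, `umbilic_pair`).
-/

noncomputable section

namespace MiaoTam

open Matrix Topology

/-! ### Tensor calculus over a ring with commuting derivations -/

/-- A metric with its Levi-Civita connection over a commutative ring `A` with four commuting
derivations `∂ᵢ`, in the role of the ring of smooth functions of a coordinate system. The connection
is characterized by metric compatibility and vanishing torsion, which are all that the curvature
identities need. -/
structure LeviCivita (A : Type*) [CommRing A] [Algebra ℝ A] where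
  /-- The coordinate derivations. -/
  d : Fin 4 → Derivation ℝ A A
  d_comm : ∀ i j a, d i (d j a) = d j (d i a)
  /-- The metric. -/
  G : Matrix (Fin 4) (Fin 4) A
  /-- The inverse metric. -/
  gi : Matrix (Fin 4) (Fin 4) A
  G_symm : ∀ i j, G i j = G j i
  gi_symm : ∀ i j, gi i j = gi j i
  gi_mul : gi * G = 1
  /-- The Christoffel symbols. -/
  Γ : Fin 4 → Fin 4 → Fin 4 → A
  Γ_symm : ∀ k i j, Γ k i j = Γ k j i
  compat : ∀ m i j, d m (G i j) = ∑ p, (Γ p m i * G p j + Γ p m j * G i p)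

namespace LeviCivita

variable {A : Type*} [CommRing A] [Algebra ℝ A] (D : LeviCivita A)

/-- The matrix of the connection form in the direction `∂ₘ`. -/
def conn (m : Fin 4) : Matrix (Fin 4) (Fin 4) A := Matrix.of fun k l => D.Γ k m l

/-- The entrywise derivative of a matrix. -/
def dM (m : Fin 4) (S : Matrix (Fin 4) (Fin 4) A) : Matrix (Fin 4) (Fin 4) A := S.map (D.d m)

lemma dM_mul (m : Fin 4) (S T : Matrix (Fin 4) (Fin 4) A) :
    D.dM m (S * T) = D.dM m S * T + S * D.dM m T := by
  ext i j
  simp only [dM, map_apply, mul_apply, Matrix.add_apply, map_sum, Derivation.leibniz, smul_eq_mul,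
    ← Finset.sum_add_distrib]
  exact Finset.sum_congr rfl fun p _ => by ring

lemma dM_add (m : Fin 4) (S T : Matrix (Fin 4) (Fin 4) A) :
    D.dM m (S + T) = D.dM m S + D.dM m T := by
  ext i j; simp [dM]

lemma dM_sub (m : Fin 4) (S T : Matrix (Fin 4) (Fin 4) A) :
    D.dM m (S - T) = D.dM m S - D.dM m T := by
  ext i j; simp [dM]

lemma dM_transpose (m : Fin 4) (S : Matrix (Fin 4) (Fin 4) A) :
    D.dM m Sᵀ = (D.dM m S)ᵀ := by
  ext i j; simp [dM]

lemma dM_comm (i j : Fin 4) (S : Matrix (Fin 4) (Fin 4) A) :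
    D.dM i (D.dM j S) = D.dM j (D.dM i S) := by
  ext k l; simp [dM, D.d_comm i j]

lemma dM_G (m : Fin 4) : D.dM m D.G = (D.conn m)ᵀ * D.G + D.G * D.conn m := by
  ext i j
  simp only [dM, map_apply, D.compat, conn, Matrix.add_apply, mul_apply, transpose_apply, of_apply,
    Finset.sum_add_distrib]
  congr 1
  exact Finset.sum_congr rfl fun p _ => by ring

lemma mul_gi : D.G * D.gi = 1 := mul_eq_one_comm.mp D.gi_mul

lemma dM_gi (m : Fin 4) : D.dM m D.gi = -(D.conn m * D.gi + D.gi * (D.conn m)ᵀ) := by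
  have h0 : D.dM m (1 : Matrix (Fin 4) (Fin 4) A) = 0 := by
    ext i j
    by_cases h : i = j <;> simp [dM, h]
  have h1 : D.dM m D.gi * D.G = - (D.gi * ((D.conn m)ᵀ * D.G + D.G * D.conn m)) := by
    have := D.dM_mul m D.gi D.G
    rw [D.gi_mul, h0, dM_G] at this
    exact eq_neg_of_add_eq_zero_left this.symm
  calc D.dM m D.gi = D.dM m D.gi * D.G * D.gi := by rw [mul_assoc, mul_gi, mul_one]
    _ = -(D.gi * (D.conn m)ᵀ * (D.G * D.gi) + D.gi * D.G * D.conn m * D.gi) := by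
        rw [h1]; noncomm_ring
    _ = _ := by rw [mul_gi, gi_mul]; noncomm_ring

lemma d_gi (m i j : Fin 4) :
    D.d m (D.gi i j) = -∑ p, (D.Γ i m p * D.gi p j + D.Γ j m p * D.gi i p) := by
  have := congrFun (congrFun (D.dM_gi m) i) j
  simp only [dM, map_apply, Matrix.neg_apply, Matrix.add_apply, mul_apply, conn, transpose_apply, of_apply]
    at this
  rw [this, Finset.sum_add_distrib]
  congr 2
  exact Finset.sum_congr rfl fun p _ => by ring

/-- The covariant derivative of a covariant two-tensor. -/
def cov2 (S : Fin 4 → Fin 4 → A) (m i j : Fin 4) : A :=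
  D.d m (S i j) - ∑ p, (D.Γ p m i * S p j + D.Γ p m j * S i p)

/-- The covariant derivative of a covariant four-tensor. -/
def cov4 (S : Fin 4 → Fin 4 → Fin 4 → Fin 4 → A) (m i j k l : Fin 4) : A :=
  D.d m (S i j k l) - ∑ p, (D.Γ p m i * S p j k l + D.Γ p m j * S i p k l
    + D.Γ p m k * S i j p l + D.Γ p m l * S i j k p)

/-- The metric trace of a two-tensor. -/
def tr (S : Fin 4 → Fin 4 → A) : A := ∑ i, ∑ j, D.gi i j * S i j

lemma sum_swap13 {ι A : Type*} [Fintype ι] [AddCommMonoid A] (u : ι → ι → ι → A) :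
    ∑ i, ∑ j, ∑ p, u i j p = ∑ i, ∑ j, ∑ p, u p j i := by
  rw [Finset.sum_congr rfl fun i _ => Finset.sum_comm, Finset.sum_comm]
  exact Finset.sum_congr rfl fun i _ => Finset.sum_comm

/-- The metric trace is parallel. -/
lemma d_tr (m : Fin 4) (S : Fin 4 → Fin 4 → A) :
    D.d m (D.tr S) = D.tr (D.cov2 S m) := by
  have e : ∀ i j, D.d m (D.gi i j * S i j) = D.gi i j * D.d m (S i j)
      - ∑ p, (D.Γ i m p * D.gi p j * S i j + D.Γ j m p * D.gi i p * S i j) := by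
    intro i j
    rw [Derivation.leibniz, d_gi, smul_eq_mul, smul_eq_mul, mul_neg, Finset.mul_sum, sub_eq_add_neg]
    congr 2
    exact Finset.sum_congr rfl fun p _ => by ring
  simp only [tr, cov2, map_sum, e, mul_sub, Finset.sum_sub_distrib, Finset.mul_sum, mul_add,
    Finset.sum_add_distrib]
  congr 2
  · rw [sum_swap13]
    exact Finset.sum_congr rfl fun i _ => Finset.sum_congr rfl fun j _ =>
      Finset.sum_congr rfl fun p _ => by ring
  · refine Finset.sum_congr rfl fun i _ => ?_
    rw [Finset.sum_comm]
    exact Finset.sum_congr rfl fun p _ => Finset.sum_congr rfl fun j _ => by ring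

/-- The component `R^m_{lij}` of the curvature. -/
def rup (m l i j : Fin 4) : A :=
  D.d i (D.Γ m j l) - D.d j (D.Γ m i l) + ∑ p, (D.Γ m i p * D.Γ p j l - D.Γ m j p * D.Γ p i l)

/-- The curvature tensor `R_{ijkl}`. -/
def riem (i j k l : Fin 4) : A := ∑ m, D.G k m * D.rup m l i j

/-- The Ricci tensor. -/
def ric (i k : Fin 4) : A := D.tr fun j l => D.riem i j k l

/-- The scalar curvature. -/
def scal : A := D.tr D.ric

/-- The curvature form `dA + A ∧ A` as a matrix. -/
def curv (i j : Fin 4) : Matrix (Fin 4) (Fin 4) A :=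
  D.dM i (D.conn j) - D.dM j (D.conn i) + (D.conn i * D.conn j - D.conn j * D.conn i)

lemma curv_apply (i j m l : Fin 4) : D.curv i j m l = D.rup m l i j := by
  simp [curv, rup, conn, dM, mul_apply, Finset.sum_sub_distrib]

lemma riem_eq (i j k l : Fin 4) : D.riem i j k l = (D.G * D.curv i j) k l := by
  simp [riem, mul_apply, curv_apply]

lemma rup_swap (m l i j : Fin 4) : D.rup m l i j = - D.rup m l j i := by
  simp only [rup, Finset.sum_sub_distrib]; ring

lemma riem_swap12 (i j k l : Fin 4) : D.riem i j k l = - D.riem j i k l := by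
  simp only [riem, D.rup_swap _ _ i j, mul_neg, Finset.sum_neg_distrib]

/-- The curvature form is skew for the metric, as second derivatives of the metric commute. -/
lemma curv_skew (i j : Fin 4) : (D.curv i j)ᵀ * D.G + D.G * D.curv i j = 0 := by
  have h := D.dM_comm i j D.G
  simp only [dM_G, dM_add, dM_mul, dM_transpose] at h
  have h' := sub_eq_zero.mpr h
  rw [← h']
  simp only [curv, transpose_add, transpose_sub, transpose_mul]
  noncomm_ring

lemma riem_swap34 (i j k l : Fin 4) : D.riem i j k l = - D.riem i j l k := by
  have h := congrFun (congrFun (D.curv_skew i j) k) l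
  rw [Matrix.add_apply, ← riem_eq, Matrix.zero_apply] at h
  have e : ((D.curv i j)ᵀ * D.G) k l = (D.G * D.curv i j) l k := by
    simp only [mul_apply, transpose_apply]
    exact Finset.sum_congr rfl fun p _ => by rw [D.G_symm p l, mul_comm]
  rw [e, ← riem_eq] at h
  exact eq_neg_of_add_eq_zero_right h

lemma rup_bianchi (m l i j : Fin 4) : D.rup m l i j + D.rup m i j l + D.rup m j l i = 0 := by
  simp only [rup, Finset.sum_sub_distrib]
  simp only [D.Γ_symm _ l i, D.Γ_symm _ l j, D.Γ_symm _ j i]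
  ring

/-- The first Bianchi identity. -/
lemma riem_bianchi (i j k l : Fin 4) : D.riem i j k l + D.riem j l k i + D.riem l i k j = 0 := by
  simp only [riem, ← Finset.sum_add_distrib, ← mul_add, rup_bianchi, mul_zero,
    Finset.sum_const_zero]

end LeviCivita

namespace LeviCivita

variable {A : Type*} [CommRing A] [Algebra ℝ A] (D : LeviCivita A)

/-! ### Contractions and the Bianchi identities -/

lemma tr_add (S T : Fin 4 → Fin 4 → A) :
    D.tr (fun i j => S i j + T i j) = D.tr S + D.tr T := by
  simp [tr, mul_add, Finset.sum_add_distrib]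

lemma tr_sub (S T : Fin 4 → Fin 4 → A) :
    D.tr (fun i j => S i j - T i j) = D.tr S - D.tr T := by
  simp [tr, mul_sub, Finset.sum_sub_distrib]

lemma tr_neg (S : Fin 4 → Fin 4 → A) : D.tr (fun i j => - S i j) = - D.tr S := by
  simp [tr]

lemma tr_mul_left (a : A) (S : Fin 4 → Fin 4 → A) :
    D.tr (fun i j => a * S i j) = a * D.tr S := by
  simp only [tr, Finset.mul_sum]
  exact Finset.sum_congr rfl fun i _ => Finset.sum_congr rfl fun j _ => by ring

lemma tr_mul_right (a : A) (S : Fin 4 → Fin 4 → A) :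
    D.tr (fun i j => S i j * a) = D.tr S * a := by
  simp only [mul_comm _ a, tr_mul_left]

lemma tr_sum {ι : Type*} (s : Finset ι) (S : ι → Fin 4 → Fin 4 → A) :
    D.tr (fun i j => ∑ p ∈ s, S p i j) = ∑ p ∈ s, D.tr (S p) := by
  simp only [tr, Finset.mul_sum]
  rw [Finset.sum_congr rfl fun i _ => Finset.sum_comm, Finset.sum_comm]

lemma tr_swap (S : Fin 4 → Fin 4 → A) : D.tr (fun i j => S j i) = D.tr S := by
  simp only [tr]
  rw [Finset.sum_comm]
  exact Finset.sum_congr rfl fun i _ => Finset.sum_congr rfl fun j _ => by rw [D.gi_symm]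

lemma tr_comm (S : Fin 4 → Fin 4 → Fin 4 → Fin 4 → A) :
    D.tr (fun i j => D.tr fun k l => S i j k l) = D.tr (fun k l => D.tr fun i j => S i j k l) := by
  conv_lhs => simp only [tr]
  rw [show (∑ i, ∑ j, D.gi i j * ∑ k, ∑ l, D.gi k l * S i j k l)
    = ∑ i, ∑ j, ∑ k, ∑ l, D.gi i j * D.gi k l * S i j k l by
      simp only [Finset.mul_sum, mul_assoc]]
  conv_rhs => simp only [tr]
  rw [show (∑ k, ∑ l, D.gi k l * ∑ i, ∑ j, D.gi i j * S i j k l)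
    = ∑ k, ∑ l, ∑ i, ∑ j, D.gi i j * D.gi k l * S i j k l by
      simp only [Finset.mul_sum]
      exact Finset.sum_congr rfl fun i _ => Finset.sum_congr rfl fun j _ =>
        Finset.sum_congr rfl fun k _ => Finset.sum_congr rfl fun l _ => by ring]
  have h := Finset.sum_comm (s := (Finset.univ : Finset (Fin 4 × Fin 4)))
    (t := (Finset.univ : Finset (Fin 4 × Fin 4)))
    (f := fun a b => D.gi a.1 a.2 * D.gi b.1 b.2 * S a.1 a.2 b.1 b.2)
  simpa only [Fintype.sum_prod_type] using h

lemma sum_gi_G (i k : Fin 4) : ∑ j, D.gi i j * D.G j k = if i = k then 1 else 0 := by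
  have := congrFun (congrFun D.gi_mul i) k
  simpa [mul_apply, one_apply] using this

/-- Contraction with the metric. -/
lemma tr_G (v : Fin 4 → A) (k : Fin 4) : D.tr (fun i j => G D i k * v j) = v k := by
  rw [← tr_swap]
  simp only [tr]
  rw [Finset.sum_congr rfl fun i _ => show (∑ j, D.gi i j * (D.G j k * v i)) =
    (∑ j, D.gi i j * D.G j k) * v i by rw [Finset.sum_mul]; simp only [mul_assoc]]
  simp [sum_gi_G]

lemma tr_G_self : D.tr D.G = 4 := by
  have : ∀ i, ∑ j, D.gi i j * D.G i j = 1 := fun i => by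
    rw [Finset.sum_congr rfl fun j _ => by rw [D.G_symm i j], sum_gi_G, if_pos rfl]
  simp [tr, this]

lemma two_cancel {a b : A} (h : 2 * a = 2 * b) : a = b := by
  have := congrArg (fun c => (1 / 2 : ℝ) • c) h
  simpa only [two_mul, smul_add, ← add_smul, show (1 / 2 + 1 / 2 : ℝ) = 1 by norm_num,
    one_smul] using this

/-- Pair symmetry of the curvature tensor. -/
lemma riem_pair (i j k l : Fin 4) : D.riem i j k l = D.riem k l i j := by
  apply two_cancel
  linear_combination D.riem_bianchi i j k l - D.riem_bianchi i j l k - D.riem_bianchi j k i l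
    + D.riem_bianchi i k j l + D.riem_swap34 i j k l - D.riem_swap34 k l i j
    - D.riem_swap34 l i k j + D.riem_swap34 j k l i - D.riem_swap12 i k j l
    + D.riem_swap34 k i j l - D.riem_swap12 j l k i + D.riem_swap34 l j k i

lemma ric_symm (i k : Fin 4) : D.ric i k = D.ric k i := by
  rw [ric, ← tr_swap]
  simp only [ric]
  congr 1
  ext j l
  exact D.riem_pair _ _ _ _

lemma cov2_symm {S : Fin 4 → Fin 4 → A} (h : ∀ i j, S i j = S j i) (m i j : Fin 4) :
    D.cov2 S m i j = D.cov2 S m j i := by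
  simp only [cov2, Finset.sum_add_distrib]
  simp only [fun p => h p j, fun p => h i p]
  ring

lemma cov2_G (m i j : Fin 4) : D.cov2 D.G m i j = 0 := by
  simp [cov2, D.compat]

lemma cov4_swap12 {S : Fin 4 → Fin 4 → Fin 4 → Fin 4 → A}
    (h : ∀ i j k l, S i j k l = - S j i k l) (m i j k l : Fin 4) :
    D.cov4 S m i j k l = - D.cov4 S m j i k l := by
  simp only [cov4, Finset.sum_add_distrib]
  simp only [fun p => h p j k l, fun p => h i p k l, fun p => h i j p l, fun p => h i j k p,
    map_neg, mul_neg, Finset.sum_neg_distrib]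
  ring

lemma cov4_pair {S : Fin 4 → Fin 4 → Fin 4 → Fin 4 → A}
    (h : ∀ i j k l, S i j k l = S k l i j) (m i j k l : Fin 4) :
    D.cov4 S m i j k l = D.cov4 S m k l i j := by
  simp only [cov4, Finset.sum_add_distrib]
  simp only [fun p => h p j k l, fun p => h i p k l, fun p => h i j p l, fun p => h i j k p]
  ring

/-- `G` times the covariant exterior derivative of the curvature form, without the terms coming
from the form indices. -/
lemma cov4_riem (m i j k l : Fin 4) : D.cov4 D.riem m i j k l =
    (D.G * (D.dM m (D.curv i j) + (D.conn m * D.curv i j - D.curv i j * D.conn m))) k l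
      - ∑ p, (D.Γ p m i * D.riem p j k l + D.Γ p m j * D.riem i p k l) := by
  have e1 : D.d m (D.riem i j k l) = (D.dM m (D.G * D.curv i j)) k l := by
    rw [riem_eq]; rfl
  have e2 : ∑ p, D.Γ p m k * D.riem i j p l = ((D.conn m)ᵀ * (D.G * D.curv i j)) k l := by
    simp only [riem_eq]; simp only [mul_apply, transpose_apply, conn, of_apply]
  have e3 : ∑ p, D.Γ p m l * D.riem i j k p = ((D.G * D.curv i j) * D.conn m) k l := by
    simp only [riem_eq, mul_apply (M := D.G * D.curv i j), conn, of_apply, mul_comm]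
  have e4 : D.G * (D.dM m (D.curv i j) + (D.conn m * D.curv i j - D.curv i j * D.conn m))
      = D.dM m (D.G * D.curv i j) - (D.conn m)ᵀ * (D.G * D.curv i j)
        - (D.G * D.curv i j) * D.conn m := by
    rw [dM_mul, dM_G]; noncomm_ring
  rw [e4, Matrix.sub_apply, Matrix.sub_apply, ← e1, ← e2, ← e3, cov4]
  simp only [Finset.sum_add_distrib]
  ring

/-- The second Bianchi identity for the curvature form. -/
lemma curv_bianchi (m i j : Fin 4) :
    (D.dM m (D.curv i j) + (D.conn m * D.curv i j - D.curv i j * D.conn m))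
    + (D.dM i (D.curv j m) + (D.conn i * D.curv j m - D.curv j m * D.conn i))
    + (D.dM j (D.curv m i) + (D.conn j * D.curv m i - D.curv m i * D.conn j)) = 0 := by
  simp only [curv, dM_add, dM_sub, dM_mul]
  rw [D.dM_comm i m, D.dM_comm j i, D.dM_comm j m]
  noncomm_ring

/-- The second Bianchi identity. -/
lemma riem_bianchi2 (m i j k l : Fin 4) :
    D.cov4 D.riem m i j k l + D.cov4 D.riem i j m k l + D.cov4 D.riem j m i k l = 0 := by
  have h := congrArg (fun C : Matrix (Fin 4) (Fin 4) A => (D.G * C) k l) (D.curv_bianchi m i j)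
  beta_reduce at h
  rw [Matrix.mul_add, Matrix.mul_add, Matrix.mul_zero, Matrix.zero_apply] at h
  simp only [cov4_riem]
  simp only [Matrix.add_apply] at h
  simp only [Finset.sum_add_distrib]
  simp only [fun p => D.Γ_symm p i m, fun p => D.Γ_symm p j m, fun p => D.Γ_symm p j i,
    fun p => D.riem_swap12 j p k l, fun p => D.riem_swap12 m p k l, fun p => D.riem_swap12 i p k l,
    mul_neg, Finset.sum_neg_distrib]
  linear_combination h

lemma cov2_ric (m i k : Fin 4) :
    D.cov2 D.ric m i k = D.tr fun j l => D.cov4 D.riem m i j k l := by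
  have e : ∀ j l, D.cov4 D.riem m i j k l = D.cov2 (fun j l => D.riem i j k l) m j l
      - ∑ p, D.Γ p m i * D.riem p j k l - ∑ p, D.Γ p m k * D.riem i j p l := by
    intro j l
    simp only [cov4, cov2, Finset.sum_add_distrib]; ring
  simp only [e, tr_sub, tr_sum, tr_mul_left]
  rw [show D.tr (fun i_1 j => D.cov2 (fun j l => D.riem i j k l) m i_1 j)
    = D.d m (D.ric i k) from (D.d_tr m _).symm]
  simp only [cov2, Finset.sum_add_distrib, ric]
  ring

lemma d_scal (m : Fin 4) : D.d m D.scal = D.tr (D.cov2 D.ric m) := D.d_tr m _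

/-- The divergence `g^{mi} ∇ₘ S_{ijkl}`. -/
def div (S : Fin 4 → Fin 4 → Fin 4 → Fin 4 → A) (j k l : Fin 4) : A :=
  D.tr fun m i => D.cov4 S m i j k l

/-- The contracted second Bianchi identity. -/
lemma div_riem (j k l : Fin 4) :
    D.div D.riem j k l = D.cov2 D.ric k l j - D.cov2 D.ric l k j := by
  rw [div, cov2_ric, cov2_ric, ← tr_sub]
  congr 1
  ext m i
  have h := D.riem_bianchi2 m k l i j
  rw [D.cov4_pair D.riem_pair m i j k l]
  have e1 : D.cov4 D.riem k l m i j = - D.cov4 D.riem k l m j i := by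
    rw [D.cov4_pair D.riem_pair, D.cov4_swap12 D.riem_swap12, D.cov4_pair D.riem_pair]
  have e2 : D.cov4 D.riem l m k i j = D.cov4 D.riem l k m j i := by
    rw [D.cov4_swap12 D.riem_swap12, D.cov4_pair D.riem_pair, D.cov4_swap12 D.riem_swap12,
      neg_neg, D.cov4_pair D.riem_pair]
  linear_combination h - e1 - e2

/-- The divergence of the Ricci tensor is half the differential of the scalar curvature. -/
lemma two_div_ric (k : Fin 4) : 2 * D.tr (fun m i => D.cov2 D.ric m i k) = D.d k D.scal := by
  have h : D.tr (fun j l => D.div D.riem j k l) =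
      D.tr (fun j l => D.cov2 D.ric k l j - D.cov2 D.ric l k j) := by
    simp only [div_riem]
  rw [tr_sub, D.tr_swap (D.cov2 D.ric k), ← d_scal] at h
  simp only [div] at h
  rw [tr_comm] at h
  simp only [← cov2_ric] at h
  rw [D.tr_swap (fun l j => D.cov2 D.ric l k j)] at h
  have e : D.tr (fun i j => D.cov2 D.ric i k j) = D.tr (fun m i => D.cov2 D.ric m i k) := by
    congr 1; ext i j; exact D.cov2_symm D.ric_symm _ _ _
  rw [e] at h
  linear_combination h

end LeviCivita

namespace LeviCivita

variable {A : Type*} [CommRing A] [Algebra ℝ A] (D : LeviCivita A)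

/-! ### The volume form -/

/-- The ring homomorphism `a ↦ a + ε ∂a` into the dual numbers. -/
def toDual (δ : Derivation ℝ A A) : A →+* DualNumber A where
  toFun a := TrivSqZeroExt.inl a + TrivSqZeroExt.inr (δ a)
  map_one' := by ext <;> simp
  map_mul' a b := by ext <;> simp [mul_comm]
  map_zero' := by ext <;> simp
  map_add' a b := by ext <;> simp

/-- The derivative of the determinant of the metric. Over the dual numbers metric compatibility reads
`G + ε ∂G = (1 + ε Γᵀ) G (1 + ε Γ)`, and `det (1 + ε Γ) = 1 + ε tr Γ`. -/
lemma d_det (m : Fin 4) : D.d m D.G.det = 2 * (∑ p, D.Γ p m p) * D.G.det := by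
  let φ := toDual (D.d m)
  let ι : A →+* DualNumber A := TrivSqZeroExt.inlHom A A
  have hε : (DualNumber.eps : DualNumber A) ^ 2 = 0 := by rw [sq, DualNumber.eps_mul_eps]
  have hφ : ∀ S : Matrix (Fin 4) (Fin 4) A,
      S.map φ = S.map ι + (DualNumber.eps : DualNumber A) • (D.dM m S).map ι := by
    intro S
    ext i j <;> simp [φ, ι, toDual, dM]
  have h1 : D.G.map φ = (1 + (DualNumber.eps : DualNumber A) • ((D.conn m)ᵀ).map ι) * D.G.map ι
      * (1 + (DualNumber.eps : DualNumber A) • (D.conn m).map ι) := by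
    rw [hφ, dM_G]
    have e : ((D.conn m)ᵀ * D.G + D.G * D.conn m).map ι =
        ((D.conn m)ᵀ).map ι * D.G.map ι + D.G.map ι * (D.conn m).map ι := by
      rw [← Matrix.map_mul, ← Matrix.map_mul, ← Matrix.map_add _ (map_add ι)]
    have e2 : ∀ X Y Z : Matrix (Fin 4) (Fin 4) (DualNumber A),
        (1 + (DualNumber.eps : DualNumber A) • X) * Y * (1 + (DualNumber.eps : DualNumber A) • Z)
        = Y + (DualNumber.eps : DualNumber A) • (X * Y + Y * Z)
          + (DualNumber.eps : DualNumber A) ^ 2 • (X * Y * Z) := by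
      intro X Y Z
      simp only [add_mul, mul_add, one_mul, mul_one, smul_mul_assoc, mul_smul_comm, smul_smul, sq,
        smul_add]
      abel
    rw [e, e2, hε, zero_smul, add_zero]
  have h2 := congrArg Matrix.det h1
  have hd : ∀ X : Matrix (Fin 4) (Fin 4) (DualNumber A),
      (1 + (DualNumber.eps : DualNumber A) • X).det = 1 + X.trace * DualNumber.eps := by
    intro X
    rw [det_one_add_smul, hε, mul_zero, add_zero]
  rw [det_mul, det_mul, hd, hd] at h2
  have h3 : (D.G.map φ).det = φ D.G.det := (RingHom.map_det φ D.G).symm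
  have h4 : (D.G.map ι).det = ι D.G.det := (RingHom.map_det ι D.G).symm
  have h5 : ((D.conn m).map ι).trace = ι (∑ p, D.Γ p m p) := by
    simp [Matrix.trace, conn]
  have h6 : (((D.conn m)ᵀ).map ι).trace = ι (∑ p, D.Γ p m p) := by
    simp [Matrix.trace, conn]
  rw [h3, h4, h5, h6] at h2
  generalize (∑ p, D.Γ p m p) = t at h2 ⊢
  have h7 := congrArg TrivSqZeroExt.snd h2
  simp [φ, ι, toDual] at h7
  linear_combination h7

/-- The matrix with rows the unit vectors numbered by `v`. -/
def unitRows (R : Type*) [CommRing R] (v : Fin 4 → Fin 4) : Matrix (Fin 4) (Fin 4) R :=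
  Matrix.of fun a b => if v a = b then 1 else 0

lemma levi_cast (R : Type*) [CommRing R] (i j k l : Fin 4) :
    (levi i j k l : R) = (unitRows R ![i, j, k, l]).det := by
  rw [levi, Int.cast_det]
  congr 1
  ext a b
  simp [unitRows]

lemma levi_swap13 (k l a b : Fin 4) : levi a l k b = - levi k l a b := by
  have h := Matrix.det_permute (Equiv.swap (0 : Fin 4) 2) (unitRows ℤ ![k, l, a, b])
  have e : (unitRows ℤ ![k, l, a, b]).submatrix (Equiv.swap (0 : Fin 4) 2) id
      = unitRows ℤ ![a, l, k, b] := by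
    ext i j
    fin_cases i <;> rfl
  rw [e, Equiv.Perm.sign_swap (by decide), ← levi_cast, ← levi_cast] at h
  simpa using h

/-- The trace is the derivative of the determinant: replacing the four slots of the Levi-Civita
symbol in turn by their images under `N` multiplies it by the trace of `N`. -/
lemma levi_contract (R : Type*) [CommRing R] (N : Fin 4 → Fin 4 → R) (k l a b : Fin 4) :
    ∑ p, (N p k * (levi p l a b : R) + N p l * (levi k p a b : R)
      + N p a * (levi k l p b : R) + N p b * (levi k l a p : R))
      = (∑ p, N p p) * (levi k l a b : R) := by
  set v := ![k, l, a, b]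
  let M := unitRows R v
  have hadj : ∀ p s, M.adjugate p s = (unitRows R (Function.update v s p)).det := by
    intro p s
    rw [adjugate_apply]
    congr 1
    ext i j
    by_cases h : i = s
    · subst h; simp [unitRows, Pi.single_apply, eq_comm]
    · simp [unitRows, M, h]
  have hrow : ∀ s p, (M * (Matrix.of N)ᵀ) s p = N p (v s) := by
    intro s p
    simp [M, unitRows, mul_apply]
  have h : (M * (Matrix.of N)ᵀ * M.adjugate).trace = (∑ p, N p p) * M.det := by
    rw [trace_mul_comm, ← mul_assoc, adjugate_mul, smul_mul_assoc, one_mul, trace_smul,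
      trace_transpose, smul_eq_mul, mul_comm]
    rfl
  rw [levi_cast, ← h]
  simp only [Matrix.trace, diag_apply, mul_apply (M := M * _), hrow, hadj, levi_cast]
  rw [Finset.sum_comm]
  refine Finset.sum_congr rfl fun p _ => ?_
  rw [Fin.sum_univ_four]
  have e : ∀ s : Fin 4, Function.update v s p = ![![p, l, a, b], ![k, p, a, b], ![k, l, p, b],
      ![k, l, a, p]] s := by
    intro s
    ext i
    fin_cases s <;> fin_cases i <;> rfl
  simp only [e]
  rfl

/-- The Riemannian volume form, for a square root `s` of the determinant of the metric. -/
def vol (s : A) (k l a b : Fin 4) : A := s * (levi k l a b : A)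

lemma d_sqrt_det {s : A} (hs : s * s = D.G.det) (m : Fin 4) :
    D.d m s = (∑ p, D.Γ p m p) * s := by
  have hu : D.gi.det * (s * s) = 1 := by rw [hs, ← det_mul, gi_mul, det_one]
  apply two_cancel
  have h := D.d_det m
  rw [← hs, Derivation.leibniz, smul_eq_mul] at h
  linear_combination (D.gi.det * s) * h
    - (2 * D.d m s - 2 * (∑ p, D.Γ p m p) * s) * hu

/-- The volume form is parallel. -/
lemma d_vol {s : A} (hs : s * s = D.G.det) (m k l a b : Fin 4) :
    D.d m (vol s k l a b) = ∑ p, (D.Γ p m k * vol s p l a b + D.Γ p m l * vol s k p a b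
      + D.Γ p m a * vol s k l p b + D.Γ p m b * vol s k l a p) := by
  have h3 : D.d m ((levi k l a b : ℤ) : A) = 0 := Derivation.map_intCast _ _
  have h := levi_contract A (fun p i => D.Γ p m i) k l a b
  simp only [vol]
  rw [Derivation.leibniz, h3, d_sqrt_det D hs, smul_zero, zero_add, smul_eq_mul, mul_left_comm,
    ← mul_assoc, ← h, Finset.sum_mul]
  exact Finset.sum_congr rfl fun p _ => by ring

end LeviCivita

namespace LeviCivita

variable {A : Type*} [CommRing A] [Algebra ℝ A] (D : LeviCivita A)

/-! ### The divergence of the Weyl tensor and of its self-dual part -/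

lemma d_smul (m : Fin 4) (r : ℝ) (a : A) : D.d m (r • a) = r • D.d m a :=
  (D.d m).map_smul r a

lemma cov4_add (S T : Fin 4 → Fin 4 → Fin 4 → Fin 4 → A) (m i j k l : Fin 4) :
    D.cov4 (fun i j k l => S i j k l + T i j k l) m i j k l
      = D.cov4 S m i j k l + D.cov4 T m i j k l := by
  simp only [cov4, map_add, mul_add, Finset.sum_add_distrib]; ring

lemma cov4_sub (S T : Fin 4 → Fin 4 → Fin 4 → Fin 4 → A) (m i j k l : Fin 4) :
    D.cov4 (fun i j k l => S i j k l - T i j k l) m i j k l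
      = D.cov4 S m i j k l - D.cov4 T m i j k l := by
  simp only [cov4, map_sub, mul_sub, Finset.sum_add_distrib, Finset.sum_sub_distrib]; ring

lemma cov4_smul (r : ℝ) (S : Fin 4 → Fin 4 → Fin 4 → Fin 4 → A) (m i j k l : Fin 4) :
    D.cov4 (fun i j k l => r • S i j k l) m i j k l = r • D.cov4 S m i j k l := by
  simp only [cov4, d_smul, smul_sub, mul_smul_comm, ← smul_add, ← Finset.smul_sum]

lemma cov4_mul (a : A) (S : Fin 4 → Fin 4 → Fin 4 → Fin 4 → A) (m i j k l : Fin 4) :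
    D.cov4 (fun i j k l => a * S i j k l) m i j k l
      = D.d m a * S i j k l + a * D.cov4 S m i j k l := by
  simp only [cov4, Derivation.leibniz, smul_eq_mul, mul_sub, Finset.mul_sum,
    Finset.sum_add_distrib, mul_add, mul_left_comm a]; ring

lemma cov4_prod13 (S T : Fin 4 → Fin 4 → A) (m i j k l : Fin 4) :
    D.cov4 (fun i j k l => S i k * T j l) m i j k l
      = D.cov2 S m i k * T j l + S i k * D.cov2 T m j l := by
  simp only [cov4, cov2, Derivation.leibniz, smul_eq_mul, Finset.sum_add_distrib, sub_mul, mul_sub,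
    add_mul, mul_add, Finset.sum_mul, Finset.mul_sum, mul_left_comm (S i k), ← mul_assoc]
  ring

lemma cov4_prod14 (S T : Fin 4 → Fin 4 → A) (m i j k l : Fin 4) :
    D.cov4 (fun i j k l => S i l * T j k) m i j k l
      = D.cov2 S m i l * T j k + S i l * D.cov2 T m j k := by
  simp only [cov4, cov2, Derivation.leibniz, smul_eq_mul, Finset.sum_add_distrib, sub_mul, mul_sub,
    add_mul, mul_add, Finset.sum_mul, Finset.mul_sum, mul_left_comm (S i l), ← mul_assoc]
  ring

/-- The Weyl tensor. -/
def weylT (i j k l : Fin 4) : A :=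
  D.riem i j k l
    - (1 / 2 : ℝ) • (D.ric i k * D.G j l + D.G i k * D.ric j l
      - D.ric i l * D.G j k - D.G i l * D.ric j k)
    + (1 / 6 : ℝ) • (D.scal * (D.G i k * D.G j l - D.G i l * D.G j k))

lemma tr_smul (r : ℝ) (S : Fin 4 → Fin 4 → A) :
    D.tr (fun i j => r • S i j) = r • D.tr S := by
  simp [tr, Finset.smul_sum]

lemma cov4_weyl (hR : ∀ m, D.d m D.scal = 0) (m i j k l : Fin 4) :
    D.cov4 D.weylT m i j k l = D.cov4 D.riem m i j k l
      - (1 / 2 : ℝ) • (D.cov2 D.ric m i k * D.G j l + D.G i k * D.cov2 D.ric m j l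
        - D.cov2 D.ric m i l * D.G j k - D.G i l * D.cov2 D.ric m j k) := by
  have e : D.weylT = fun i j k l => (D.riem i j k l
      - (1 / 2 : ℝ) • (D.ric i k * D.G j l + D.G i k * D.ric j l
      - D.ric i l * D.G j k - D.G i l * D.ric j k))
      + (1 / 6 : ℝ) • (D.scal * (D.G i k * D.G j l - D.G i l * D.G j k)) := rfl
  rw [e, cov4_add, cov4_sub, cov4_smul, cov4_smul, cov4_mul, cov4_sub, cov4_sub, cov4_sub, cov4_add,
    D.cov4_prod13 D.ric D.G, D.cov4_prod13 D.G D.ric, D.cov4_prod13 D.G D.G,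
    D.cov4_prod14 D.ric D.G, D.cov4_prod14 D.G D.ric, D.cov4_prod14 D.G D.G]
  simp only [cov2_G, hR, mul_zero, zero_mul, add_zero, zero_add, sub_zero, smul_zero]

/-- The Cotton tensor `∇_k R_{jl} - ∇_l R_{jk}` (for constant scalar curvature). -/
def cotton (j k l : Fin 4) : A := D.cov2 D.ric k j l - D.cov2 D.ric l j k

lemma div_weyl (hR : ∀ m, D.d m D.scal = 0) (j k l : Fin 4) :
    D.div D.weylT j k l = (1 / 2 : ℝ) • D.cotton j k l := by
  have hdiv : ∀ k, D.tr (fun m i => D.cov2 D.ric m i k) = 0 := fun k => by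
    apply two_cancel; rw [two_div_ric, hR, mul_zero]
  have hG : ∀ j k l, D.tr (fun m i => D.G i k * D.cov2 D.ric m j l) = D.cov2 D.ric k j l := by
    intro j k l
    rw [← D.tr_swap]
    exact D.tr_G (fun m => D.cov2 D.ric m j l) k
  simp only [div, cov4_weyl D hR, tr_sub, tr_smul, tr_add, tr_mul_right, hdiv, hG, zero_mul]
  rw [show D.tr (D.cov4 D.riem · · j k l) = D.div D.riem j k l from rfl, div_riem, cotton,
    D.cov2_symm D.ric_symm k l j, D.cov2_symm D.ric_symm l k j]
  module

/-- A double metric trace is parallel. -/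
lemma d_tr_tr (m : Fin 4) (X : Fin 4 → Fin 4 → Fin 4 → Fin 4 → A) :
    D.d m (D.tr fun a c => D.tr fun b d => X a b c d)
      = D.tr fun a c => D.tr fun b d => D.cov4 X m a b c d := by
  rw [d_tr]
  congr 1
  ext a c
  simp only [cov2, d_tr, ← tr_mul_left, ← tr_add, ← tr_sum, ← tr_sub]
  congr 1
  ext b d
  simp only [cov4, Finset.sum_add_distrib]
  ring

/-- The Hodge star on the last two indices. -/
def star (s : A) (W : Fin 4 → Fin 4 → Fin 4 → Fin 4 → A) (i j k l : Fin 4) : A :=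
  (1 / 2 : ℝ) • D.tr fun a c => D.tr fun b d => vol s k l a b * W i j c d

/-- The Hodge star is parallel. -/
lemma cov4_star {s : A} (hs : s * s = D.G.det) (W : Fin 4 → Fin 4 → Fin 4 → Fin 4 → A)
    (m i j k l : Fin 4) :
    D.cov4 (D.star s W) m i j k l =
      (1 / 2 : ℝ) • D.tr fun a c => D.tr fun b d => vol s k l a b * D.cov4 W m i j c d := by
  have e : D.star s W = fun i j k l =>
    (1 / 2 : ℝ) • D.tr fun a c => D.tr fun b d => vol s k l a b * W i j c d := rfl
  rw [e, cov4_smul]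
  congr 1
  rw [cov4]
  rw [D.d_tr_tr m (fun a b c d => vol s k l a b * W i j c d)]
  simp only [← tr_mul_left, ← tr_add, ← tr_sum, ← tr_sub]
  congr 1
  ext a c
  congr 1
  ext b d
  simp only [cov4, Derivation.leibniz, smul_eq_mul, d_vol D hs, Finset.sum_add_distrib, mul_sub,
    mul_add, Finset.mul_sum, mul_left_comm (vol s k l a b), mul_left_comm (W i j c d)]
  simp only [mul_comm (W i j c d)]
  ring

/-- The part `W⁺` of the Weyl tensor. -/
def weylPlusT (s : A) (i j k l : Fin 4) : A :=
  (1 / 2 : ℝ) • (D.weylT i j k l + D.star s D.weylT i j k l)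

/-- If `div W⁺ = 0`, the Cotton tensor is anti-self-dual in its skew pair of indices. -/
lemma cotton_asd {s : A} (hs : s * s = D.G.det) (hR : ∀ m, D.d m D.scal = 0)
    (hW : ∀ j k l, D.div (D.weylPlusT s) j k l = 0) (j k l : Fin 4) :
    D.cotton j k l + (1 / 2 : ℝ) • D.tr (fun a c => D.tr fun b d => vol s k l a b * D.cotton j c d)
      = 0 := by
  have h := hW j k l
  have e2 : D.div (D.star s D.weylT) j k l =
      (1 / 2 : ℝ) • D.tr fun a c => D.tr fun b d => vol s k l a b * D.div D.weylT j c d := by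
    simp only [div, cov4_star D hs, tr_smul]
    rw [tr_comm]
    congr 2
    ext a c
    rw [tr_comm]
    simp only [tr_mul_left]
  have e3 : D.div (D.weylPlusT s) j k l
      = (1 / 2 : ℝ) • (D.div D.weylT j k l + D.div (D.star s D.weylT) j k l) := by
    have e : ∀ m i, D.cov4 (D.weylPlusT s) m i j k l = (1 / 2 : ℝ) • (D.cov4 D.weylT m i j k l
        + D.cov4 (D.star s D.weylT) m i j k l) := fun m i => by
      rw [← cov4_add, ← cov4_smul]; rfl
    simp only [div, e, tr_smul, tr_add]
  rw [e3, e2] at h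
  simp only [div_weyl D hR, mul_smul_comm, tr_smul] at h
  generalize D.tr (fun a c => D.tr fun b d => vol s k l a b * D.cotton j c d) = t at h ⊢
  have h2 := congrArg (fun a => (4 : ℝ) • a) h
  simp only [smul_zero] at h2
  rw [← h2]
  module

end LeviCivita

namespace LeviCivita

variable {A : Type*} [CommRing A] [Algebra ℝ A] (D : LeviCivita A)

/-! ### Gradients, Hessians and the Miao–Tam equation -/

/-- The components of the gradient. -/
def gradT (f : A) (k : Fin 4) : A := ∑ l, D.gi k l * D.d l f

/-- The Hessian. -/
def hessT (f : A) (i j : Fin 4) : A := D.d i (D.d j f) - ∑ k, D.Γ k i j * D.d k f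

/-- The pairing `⟨∇f, ∇u⟩`. -/
def pair (f u : A) : A := D.tr fun k l => D.d k f * D.d l u

lemma hessT_symm (f : A) (i j : Fin 4) : D.hessT f i j = D.hessT f j i := by
  simp only [hessT, D.d_comm i j]
  congr 1
  exact Finset.sum_congr rfl fun k _ => by rw [D.Γ_symm]

lemma tr_mul_d (v : Fin 4 → A) (f : A) :
    D.tr (fun a c => v a * D.d c f) = ∑ a, D.gradT f a * v a := by
  simp only [tr, gradT, Finset.sum_mul]
  exact Finset.sum_congr rfl fun i _ => Finset.sum_congr rfl fun j _ => by ring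

lemma tr_d_mul (v : Fin 4 → A) (f : A) :
    D.tr (fun a c => D.d a f * v c) = ∑ a, D.gradT f a * v a := by
  rw [← tr_mul_d, ← tr_swap]
  simp only [mul_comm]

lemma pair_eq (f u : A) : D.pair f u = ∑ k, D.gradT f k * D.d k u := D.tr_d_mul _ _

lemma sum_G_gradT (f : A) (j : Fin 4) : ∑ k, D.G j k * D.gradT f k = D.d j f := by
  have h : ∀ l, ∑ k, D.G j k * D.gi k l = if j = l then 1 else 0 := fun l => by
    have := congrFun (congrFun D.mul_gi j) l
    simpa [mul_apply, one_apply] using this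
  simp only [gradT, Finset.mul_sum, ← mul_assoc]
  rw [Finset.sum_comm]
  simp only [← Finset.sum_mul, h]
  simp

/-- The derivative of `⟨∇f, ∇u⟩`. -/
lemma d_pair (f u : A) (m : Fin 4) :
    D.d m (D.pair f u) = ∑ k, D.gradT u k * D.hessT f m k + ∑ k, D.gradT f k * D.hessT u m k := by
  rw [pair, d_tr, ← tr_mul_d, ← tr_d_mul, ← tr_add]
  congr 1
  ext k l
  simp only [cov2, hessT, Derivation.leibniz, smul_eq_mul, Finset.sum_add_distrib, sub_mul, mul_sub,
    Finset.sum_mul, Finset.mul_sum, mul_left_comm (D.d k f), ← mul_assoc]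
  ring

/-- The Hessian on gradients is determined by the pairing of gradients. -/
lemma hess_polar (f u : A) :
    2 * (∑ i, ∑ j, D.hessT f i j * D.gradT u i * D.gradT u j)
      = 2 * D.pair u (D.pair f u) - D.pair f (D.pair u u) := by
  have e1 : ∀ f u v : A, ∑ m, D.gradT u m * ∑ k, D.gradT v k * D.hessT f m k
      = ∑ i, ∑ j, D.hessT f i j * D.gradT u i * D.gradT v j := fun f u v => by
    simp only [Finset.mul_sum]
    exact Finset.sum_congr rfl fun i _ => Finset.sum_congr rfl fun j _ => by ring
  have e2 : ∑ i, ∑ j, D.hessT u i j * D.gradT f i * D.gradT u j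
      = ∑ i, ∑ j, D.hessT u i j * D.gradT u i * D.gradT f j := by
    rw [Finset.sum_comm]
    exact Finset.sum_congr rfl fun i _ => Finset.sum_congr rfl fun j _ => by
      rw [D.hessT_symm u i j]; ring
  simp only [D.pair_eq u (D.pair f u), D.pair_eq f (D.pair u u), d_pair, mul_add,
    Finset.sum_add_distrib, e1, e2]
  ring

/-- The Hessian is the covariant derivative of the gradient. -/
lemma cov_gradT (f : A) (i j : Fin 4) :
    ∑ k, D.G j k * (D.d i (D.gradT f k) + ∑ l, D.Γ k i l * D.gradT f l) = D.hessT f i j := by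
  have h : D.d i (D.d j f) = ∑ k, (D.G j k * D.d i (D.gradT f k) + D.gradT f k * D.d i (D.G j k)) := by
    rw [← D.sum_G_gradT f j, map_sum]
    exact Finset.sum_congr rfl fun k _ => by rw [Derivation.leibniz, smul_eq_mul, smul_eq_mul]
  rw [hessT, h]
  simp only [← D.sum_G_gradT f, D.compat, mul_add, Finset.sum_add_distrib, Finset.mul_sum]
  rw [add_sub_assoc]
  congr 1
  rw [add_comm, add_sub_assoc, Finset.sum_comm]
  rw [show ∑ x, ∑ i_1, D.gradT f x * (D.Γ i_1 i j * D.G i_1 x)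
    = ∑ k, ∑ l, D.Γ k i j * (D.G k l * D.gradT f l) by
      rw [Finset.sum_comm]
      exact Finset.sum_congr rfl fun i _ => Finset.sum_congr rfl fun j _ => by ring]
  rw [sub_self, add_zero]
  exact Finset.sum_congr rfl fun i _ => Finset.sum_congr rfl fun j _ => by ring

/-- The Ricci identity for the differential of a function. -/
lemma ricci_identity (f : A) (i j k : Fin 4) :
    D.cov2 (D.hessT f) i j k - D.cov2 (D.hessT f) j i k
      = - ∑ n, D.riem i j n k * D.gradT f n := by
  have e : ∑ n, D.riem i j n k * D.gradT f n = ∑ m, D.rup m k i j * D.d m f := by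
    simp only [riem, Finset.sum_mul, ← D.sum_G_gradT f, Finset.mul_sum]
    rw [Finset.sum_comm]
    exact Finset.sum_congr rfl fun i _ => Finset.sum_congr rfl fun j _ => by
      rw [D.G_symm i j]; ring
  rw [e]
  have e2 : ∀ i j, ∑ p, D.Γ p i k * D.hessT f j p =
      ∑ p, D.Γ p i k * D.d j (D.d p f) - ∑ m, (∑ p, D.Γ m j p * D.Γ p i k) * D.d m f := by
    intro i j
    simp only [hessT, mul_sub, Finset.sum_sub_distrib, Finset.mul_sum, Finset.sum_mul]
    rw [Finset.sum_comm]
    congr 1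
    exact Finset.sum_congr rfl fun i _ => Finset.sum_congr rfl fun j _ => by ring
  simp only [cov2, Finset.sum_add_distrib, e2]
  simp only [hessT, map_sub, map_sum, Derivation.leibniz, smul_eq_mul, rup, add_mul, sub_mul,
    Finset.sum_add_distrib, Finset.sum_sub_distrib]
  simp only [fun p => D.Γ_symm p i j, D.d_comm i j (D.d k f), mul_comm (D.d _ f)]
  ring

/-- The Miao–Tam equation `-(Δf) g + Hess f - f Ric = g`. -/
def MiaoTamEq (f : A) : Prop :=
  ∀ i j, -(D.tr (D.hessT f)) * D.G i j + D.hessT f i j - f * D.ric i j = D.G i j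

variable {D}

lemma tr_mul_G (a : A) : D.tr (fun i j => a * D.G i j) = a * 4 :=
  (D.tr_mul_left a D.G).trans (by rw [tr_G_self])

lemma hessT_eq {f : A} (h : D.MiaoTamEq f) (i j : Fin 4) :
    D.hessT f i j = f * D.ric i j + (1 + D.tr (D.hessT f)) * D.G i j := by
  linear_combination h i j

/-- The trace of the Miao–Tam equation. -/
lemma three_lap {f : A} (h : D.MiaoTamEq f) :
    3 * D.tr (D.hessT f) = -(f * D.scal + 4) := by
  have e : D.tr (D.hessT f) = f * D.scal + (1 + D.tr (D.hessT f)) * 4 := by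
    conv_lhs => rw [show D.hessT f = fun i j => f * D.ric i j + (1 + D.tr (D.hessT f)) * D.G i j
      from funext₂ (hessT_eq h)]
    rw [tr_add, tr_mul_left, tr_mul_G, scal]
  linear_combination -e

lemma three_d_lap {f : A} (h : D.MiaoTamEq f) (i : Fin 4) :
    3 * D.d i (D.tr (D.hessT f)) = -(f * D.d i D.scal + D.scal * D.d i f) := by
  have := congrArg (D.d i) (three_lap h)
  have h3 : D.d i (3 : A) = 0 := by
    simpa using (D.d i).map_natCast 3
  have h4 : D.d i (4 : A) = 0 := by
    simpa using (D.d i).map_natCast 4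
  simpa [Derivation.leibniz, h3, h4] using this

/-- The Miao–Tam equation expresses the Cotton tensor by the curvature in the direction of the
gradient. -/
lemma cotton_eq {f : A} (h : D.MiaoTamEq f) (i j k : Fin 4) :
    f * D.cotton k i j + D.d i f * D.ric j k - D.d j f * D.ric i k
      + D.d i (D.tr (D.hessT f)) * D.G j k - D.d j (D.tr (D.hessT f)) * D.G i k
      = - ∑ n, D.riem i j n k * D.gradT f n := by
  have e : ∀ m i j, D.cov2 (D.hessT f) m i j = D.d m f * D.ric i j + f * D.cov2 D.ric m i j
      + D.d m (D.tr (D.hessT f)) * D.G i j := by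
    intro m i j
    generalize hL : D.tr (D.hessT f) = L
    have e1 : D.hessT f = fun i j => f * D.ric i j + (1 + L) * D.G i j :=
      funext₂ fun i j => by rw [hessT_eq h, hL]
    simp only [e1, cov2, map_add, Derivation.leibniz, smul_eq_mul, Derivation.map_one_eq_zero,
      D.compat, Finset.sum_add_distrib, mul_add, mul_sub, Finset.mul_sum,
      mul_left_comm _ (1 + L), mul_left_comm _ f]
    ring
  rw [← ricci_identity, e, e, cotton, D.cov2_symm D.ric_symm i k j, D.cov2_symm D.ric_symm j k i]
  ring

/-- A solution of the Miao–Tam equation satisfies `f dR = 0`. -/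
lemma mul_d_scal {f : A} (h : D.MiaoTamEq f) (i : Fin 4) : f * D.d i D.scal = 0 := by
  have hc : 2 * D.tr (fun j k => D.cotton k i j) = D.d i D.scal := by
    simp only [cotton]
    have e : D.tr (fun j k => D.cov2 D.ric j k i) = D.tr (fun m i' => D.cov2 D.ric m i' i) := rfl
    rw [tr_sub, D.tr_swap (D.cov2 D.ric i), ← d_scal, e, mul_sub, two_div_ric]
    ring
  have hr : D.tr (fun j k => ∑ n, D.riem i j n k * D.gradT f n) = ∑ n, D.gradT f n * D.ric i n := by
    rw [tr_sum]
    exact Finset.sum_congr rfl fun n _ => by rw [tr_mul_right, ric, mul_comm]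
  have hd : D.tr (fun j k => D.d j f * D.ric i k) = ∑ n, D.gradT f n * D.ric i n := D.tr_d_mul _ _
  have hL : D.tr (fun j k => D.d j (D.tr (D.hessT f)) * D.G i k) = D.d i (D.tr (D.hessT f)) := by
    rw [← D.tr_swap]
    simp only [D.G_symm i, mul_comm (D.d _ _)]
    rw [← D.tr_swap]
    rw [← D.tr_swap]
    exact D.tr_G (fun j => D.d j (D.tr (D.hessT f))) i
  have ht : D.tr (fun j k => f * D.cotton k i j + D.d i f * D.ric j k - D.d j f * D.ric i k
      + D.d i (D.tr (D.hessT f)) * D.G j k - D.d j (D.tr (D.hessT f)) * D.G i k)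
      = D.tr (fun j k => - ∑ n, D.riem i j n k * D.gradT f n) := by
    simp only [cotton_eq h]
  rw [tr_sub, tr_add, tr_sub, tr_add, tr_mul_left, tr_mul_left, tr_mul_G, tr_neg, hr, hd, hL,
    show D.tr (fun j k => D.ric j k) = D.scal from rfl] at ht
  linear_combination -2 * ht + f * hc + 2 * three_d_lap h i

lemma sum_antisymm {v : Fin 4 → A} {u : Fin 4 → Fin 4 → A} (hu : ∀ i a, u i a = - u a i) :
    ∑ i, ∑ a, v i * v a * u i a = 0 := by
  apply two_cancel
  have : ∑ i, ∑ a, v i * v a * u i a = - ∑ i, ∑ a, v i * v a * u i a := by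
    conv_lhs => rw [Finset.sum_comm]
    simp only [← Finset.sum_neg_distrib]
    exact Finset.sum_congr rfl fun i _ => Finset.sum_congr rfl fun j _ => by rw [hu j i]; ring
  linear_combination this

/-- The one-form `Ric(∇f, ·)`. -/
def ricGrad (D : LeviCivita A) (f : A) (i : Fin 4) : A := ∑ k, D.gradT f k * D.ric i k

/-- Contraction of the Cotton tensor with the gradient: the curvature term drops out by skew
symmetry. -/
lemma cotton_grad {f : A} (h : D.MiaoTamEq f) (hR : ∀ m, D.d m D.scal = 0) (i j : Fin 4) :
    f * ∑ k, D.gradT f k * D.cotton k i j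
      = D.d j f * D.ricGrad f i - D.d i f * D.ricGrad f j := by
  have hs : ∑ k, D.gradT f k * ∑ n, D.riem i j n k * D.gradT f n = 0 := by
    rw [← sum_antisymm (v := D.gradT f) (fun k n => D.riem_swap34 i j n k)]
    exact Finset.sum_congr rfl fun k _ => by
      rw [Finset.mul_sum]; exact Finset.sum_congr rfl fun n _ => by ring
  have hG : ∀ i, ∑ k, D.gradT f k * D.G i k = D.d i f := fun i => by
    simp only [← D.sum_G_gradT f i, mul_comm]
  have h1 : ∑ k, D.gradT f k * (f * D.cotton k i j + D.d i f * D.ric j k - D.d j f * D.ric i k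
      + D.d i (D.tr (D.hessT f)) * D.G j k - D.d j (D.tr (D.hessT f)) * D.G i k) = 0 := by
    simp only [cotton_eq h, mul_neg, Finset.sum_neg_distrib, hs, neg_zero]
  have h2 : ∑ k, D.gradT f k * (f * D.cotton k i j + D.d i f * D.ric j k - D.d j f * D.ric i k
      + D.d i (D.tr (D.hessT f)) * D.G j k - D.d j (D.tr (D.hessT f)) * D.G i k) =
      f * ∑ k, D.gradT f k * D.cotton k i j + D.d i f * D.ricGrad f j - D.d j f * D.ricGrad f i
      + D.d i (D.tr (D.hessT f)) * D.d j f - D.d j (D.tr (D.hessT f)) * D.d i f := by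
    simp only [← hG, ricGrad, mul_add, mul_sub, Finset.sum_add_distrib, Finset.sum_sub_distrib]
    simp only [← mul_assoc, Finset.mul_sum, mul_comm (D.gradT f _)]
  have e := fun i => three_d_lap h i
  simp only [hR, mul_zero, zero_add] at e
  have h3 : 3 * (D.d i (D.tr (D.hessT f)) * D.d j f - D.d j (D.tr (D.hessT f)) * D.d i f) = 0 := by
    linear_combination D.d j f * e i - D.d i f * e j
  have h4 : D.d i (D.tr (D.hessT f)) * D.d j f - D.d j (D.tr (D.hessT f)) * D.d i f = 0 := by
    have := congrArg (fun a => (1 / 3 : ℝ) • a) h3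
    rw [← map_ofNat (algebraMap ℝ A) 3, ← Algebra.smul_def] at this
    simpa [smul_smul] using this
  linear_combination h1 - h2 - h4

lemma levi_swap14 (k l a b : Fin 4) : levi b l a k = - levi k l a b := by
  have h := Matrix.det_permute (Equiv.swap (0 : Fin 4) 3) (unitRows ℤ ![k, l, a, b])
  have e : (unitRows ℤ ![k, l, a, b]).submatrix (Equiv.swap (0 : Fin 4) 3) id
      = unitRows ℤ ![b, l, a, k] := by
    ext i j
    fin_cases i <;> rfl
  rw [e, Equiv.Perm.sign_swap (by decide), ← levi_cast, ← levi_cast] at h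
  simpa using h

/-- The gradient of a solution of the Miao–Tam equation is an eigenvector of the Ricci tensor if
`div W⁺ = 0`: the two-form `df ∧ Ric(∇f, ·)` is anti-self-dual, and the star of a decomposable form
is annihilated by its factors. -/
lemma ricGrad_eigen {f s : A} (h : D.MiaoTamEq f) (hR : ∀ m, D.d m D.scal = 0)
    (hs : s * s = D.G.det) (hW : ∀ j k l, D.div (D.weylPlusT s) j k l = 0) (j : Fin 4) :
    D.pair f f * D.ricGrad f j = (∑ i, D.gradT f i * D.ricGrad f i) * D.d j f := by
  have h1 : ∀ i j, D.d j f * D.ricGrad f i - D.d i f * D.ricGrad f j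
      + (1 / 2 : ℝ) • D.tr (fun a c => D.tr fun b d => vol s i j a b *
        (D.d d f * D.ricGrad f c - D.d c f * D.ricGrad f d)) = 0 := by
    intro i j
    simp only [← cotton_grad h hR]
    have e : f * ∑ k, D.gradT f k * (D.cotton k i j + (1 / 2 : ℝ) •
        D.tr (fun a c => D.tr fun b d => vol s i j a b * D.cotton k c d)) = 0 := by
      simp only [D.cotton_asd hs hR hW, mul_zero, Finset.sum_const_zero]
    rw [← e]
    simp only [mul_add, Finset.sum_add_distrib, mul_smul_comm, ← Finset.smul_sum]
    congr 2
    simp only [← tr_mul_left, ← tr_sum]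
    congr 1; ext a c; congr 1; ext b d
    simp only [Finset.mul_sum]
    exact Finset.sum_congr rfl fun k _ => by ring
  have h2 : ∑ i, D.gradT f i * (D.tr (fun a c => D.tr fun b d => vol s i j a b *
        (D.d d f * D.ricGrad f c - D.d c f * D.ricGrad f d))) = 0 := by
    have e : ∀ i, D.tr (fun a c => D.tr fun b d => vol s i j a b *
        (D.d d f * D.ricGrad f c - D.d c f * D.ricGrad f d))
        = ∑ b, D.gradT f b * D.tr (fun a c => vol s i j a b * D.ricGrad f c)
          - ∑ a, D.gradT f a * D.tr (fun b d => vol s i j a b * D.ricGrad f d) := by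
      intro i
      rw [← tr_mul_d, ← tr_mul_d]
      rw [show D.tr (fun a c => D.tr (fun a_1 c => vol s i j a_1 a * D.ricGrad f c) * D.d c f)
        = D.tr (fun a c => D.tr (fun b d => vol s i j a b * D.ricGrad f c * D.d d f)) by
          rw [tr_comm]; simp only [← tr_mul_right]]
      rw [← tr_sub]
      congr 1; ext a c
      rw [← tr_mul_right, ← tr_sub]
      congr 1; ext b d
      ring
    rw [Finset.sum_congr rfl fun i _ => by rw [e i]]
    simp only [mul_sub, Finset.sum_sub_distrib, Finset.mul_sum, ← mul_assoc]
    rw [sum_antisymm, sum_antisymm, sub_zero]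
    · intro i a
      rw [← tr_neg]
      congr 1; ext b d
      rw [vol, vol, levi_swap13 i j a b]; push_cast; ring
    · intro i b
      rw [← tr_neg]
      congr 1; ext a c
      rw [vol, vol, levi_swap14 i j a b]; push_cast; ring
  have h3 : ∑ i, D.gradT f i * (D.d j f * D.ricGrad f i - D.d i f * D.ricGrad f j) = 0 := by
    have : ∑ i, D.gradT f i * (D.d j f * D.ricGrad f i - D.d i f * D.ricGrad f j
      + (1 / 2 : ℝ) • D.tr (fun a c => D.tr fun b d => vol s i j a b *
        (D.d d f * D.ricGrad f c - D.d c f * D.ricGrad f d))) = 0 := by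
      simp only [h1, mul_zero, Finset.sum_const_zero]
    simpa only [mul_add, Finset.sum_add_distrib, mul_smul_comm, ← Finset.smul_sum, h2, smul_zero,
      add_zero] using this
  rw [pair_eq]
  simp only [mul_sub, Finset.sum_sub_distrib, ← mul_assoc] at h3
  rw [← Finset.sum_mul] at h3
  rw [← sub_eq_zero, ← neg_eq_zero, ← h3, Finset.sum_mul]
  simp only [mul_right_comm _ (D.d j f), Finset.sum_mul]
  ring

end LeviCivita

/-! ### The ring of smooth functions on a coordinate domain -/

/-- `T` is relatively open in the closed half space. -/
structure IsCoordDomain (T : Set E4) : Prop where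
  subset : T ⊆ Set.range (𝓡∂ 4)
  mem_nhdsWithin : ∀ x ∈ T, T ∈ 𝓝[Set.range (𝓡∂ 4)] x

lemma pd_congr {u v : E4 → ℝ} {T : Set E4} (hT : IsCoordDomain T) (h : ∀ y ∈ T, u y = v y)
    (i : Fin 4) {x : E4} (hx : x ∈ T) : pd i u x = pd i v x := by
  unfold pd
  rw [Filter.EventuallyEq.fderivWithin_eq
    (Filter.eventually_of_mem (hT.mem_nhdsWithin x hx) h) (h x hx)]

lemma IsCoordDomain.uniqueDiffOn {T : Set E4} (hT : IsCoordDomain T) : UniqueDiffOn ℝ T :=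
  fun x hx => ((𝓡∂ 4).uniqueDiffOn x (hT.subset hx)).mono_nhds
    (nhdsWithin_le_iff.mpr (hT.mem_nhdsWithin x hx))

lemma IsCoordDomain.contDiffWithinAt {T : Set E4} (hT : IsCoordDomain T) {u : E4 → ℝ}
    (hu : ContDiffOn ℝ ∞ u T) {x : E4} (hx : x ∈ T) :
    ContDiffWithinAt ℝ ∞ u (Set.range (𝓡∂ 4)) x :=
  (hu x hx).mono_of_mem_nhdsWithin (hT.mem_nhdsWithin x hx)

lemma IsCoordDomain.differentiableWithinAt {T : Set E4} (hT : IsCoordDomain T) {u : E4 → ℝ}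
    (hu : ContDiffOn ℝ ∞ u T) {x : E4} (hx : x ∈ T) :
    DifferentiableWithinAt ℝ u (Set.range (𝓡∂ 4)) x :=
  (hT.contDiffWithinAt hu hx).differentiableWithinAt (by simp)

lemma contDiffOn_fderivWithin {T : Set E4} (hT : IsCoordDomain T) {u : E4 → ℝ}
    (hu : ContDiffOn ℝ ∞ u T) :
    ContDiffOn ℝ ∞ (fun x => fderivWithin ℝ u (Set.range (𝓡∂ 4)) x) T := by
  refine (hu.fderivWithin (m := ∞) hT.uniqueDiffOn (by simp)).congr fun x hx => ?_
  exact fderivWithin_of_mem_nhdsWithin (hT.mem_nhdsWithin x hx)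
    ((𝓡∂ 4).uniqueDiffOn x (hT.subset hx)) ((hu x hx).differentiableWithinAt (by simp))

lemma contDiffOn_pd {T : Set E4} (hT : IsCoordDomain T) {u : E4 → ℝ}
    (hu : ContDiffOn ℝ ∞ u T) (i : Fin 4) : ContDiffOn ℝ ∞ (pd i u) T :=
  (contDiffOn_fderivWithin hT hu).clm_apply contDiffOn_const

lemma pd_pd_comm {T : Set E4} (hT : IsCoordDomain T) {u : E4 → ℝ} (hu : ContDiffOn ℝ ∞ u T)
    (i j : Fin 4) {x : E4} (hx : x ∈ T) : pd i (pd j u) x = pd j (pd i u) x := by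
  have hsymm := (hT.contDiffWithinAt hu hx).isSymmSndFDerivWithinAt
    (by simpa using WithTop.coe_le_coe.mpr (le_top : (2 : ℕ∞) ≤ ⊤))
    (𝓡∂ 4).uniqueDiffOn ((𝓡∂ 4).range_subset_closure_interior (hT.subset hx)) (hT.subset hx)
  have hd : DifferentiableWithinAt ℝ (fderivWithin ℝ u (Set.range (𝓡∂ 4)))
      (Set.range (𝓡∂ 4)) x :=
    (((contDiffOn_fderivWithin hT hu) x hx).mono_of_mem_nhdsWithin
      (hT.mem_nhdsWithin x hx)).differentiableWithinAt (by simp)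
  have e : ∀ i j, pd i (pd j u) x = fderivWithin ℝ (fderivWithin ℝ u (Set.range (𝓡∂ 4)))
      (Set.range (𝓡∂ 4)) x (EuclideanSpace.single i 1) (EuclideanSpace.single j 1) := by
    intro i j
    have := (hd.hasFDerivWithinAt.clm_apply (hasFDerivWithinAt_const
      (EuclideanSpace.single j (1 : ℝ)) x (Set.range (𝓡∂ 4)))).fderivWithin
      ((𝓡∂ 4).uniqueDiffOn x (hT.subset hx))
    unfold pd
    rw [this]
    simp
  rw [e, e, hsymm.eq]

section PartialDerivatives

variable {T : Set E4} {u v : E4 → ℝ} {x : E4} (i : Fin 4)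

lemma pd_add (hT : IsCoordDomain T) (hx : x ∈ T) (hu : ContDiffOn ℝ ∞ u T)
    (hv : ContDiffOn ℝ ∞ v T) : pd i (fun y => u y + v y) x = pd i u x + pd i v x := by
  unfold pd
  rw [fderivWithin_fun_add ((𝓡∂ 4).uniqueDiffOn x (hT.subset hx))
    (hT.differentiableWithinAt hu hx) (hT.differentiableWithinAt hv hx)]
  rfl

lemma pd_mul (hT : IsCoordDomain T) (hx : x ∈ T) (hu : ContDiffOn ℝ ∞ u T)
    (hv : ContDiffOn ℝ ∞ v T) :
    pd i (fun y => u y * v y) x = u x * pd i v x + v x * pd i u x := by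
  unfold pd
  rw [fderivWithin_fun_mul ((𝓡∂ 4).uniqueDiffOn x (hT.subset hx))
    (hT.differentiableWithinAt hu hx) (hT.differentiableWithinAt hv hx)]
  simp

end PartialDerivatives

/-- The extension by zero of a function on `T`. -/
def extendZero {T : Set E4} (u : T → ℝ) (x : E4) : ℝ :=
  open Classical in if h : x ∈ T then u ⟨x, h⟩ else 0

lemma extendZero_of_mem {T : Set E4} (u : T → ℝ) {x : E4} (hx : x ∈ T) :
    extendZero u x = u ⟨x, hx⟩ := by
  simp [extendZero, hx]

/-- The ring of smooth functions on `T`. -/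
def smoothRing (T : Set E4) : Subalgebra ℝ (T → ℝ) where
  carrier := {u | ContDiffOn ℝ ∞ (extendZero u) T}
  mul_mem' {u v} hu hv := (ContDiffOn.mul hu hv).congr fun x hx => by
    simp [extendZero_of_mem _ hx]
  add_mem' {u v} hu hv := (ContDiffOn.add hu hv).congr fun x hx => by
    simp [extendZero_of_mem _ hx]
  algebraMap_mem' r := (contDiffOn_const (c := r)).congr fun x hx => by
    simp [extendZero_of_mem _ hx]

/-- The restriction to `T` of a function that is smooth on `T`. -/
def toSmooth {T : Set E4} (u : E4 → ℝ) (hu : ContDiffOn ℝ ∞ u T) : smoothRing T :=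
  ⟨fun x => u x, hu.congr fun x hx => by simp [extendZero_of_mem _ hx]⟩

/-- The function `a` on `T` is the restriction of `u`. -/
def Rep {T : Set E4} (a : smoothRing T) (u : E4 → ℝ) : Prop := ∀ x : T, a.1 x = u x

lemma Rep.contDiffOn {T : Set E4} {a : smoothRing T} {u : E4 → ℝ} (h : Rep a u) :
    ContDiffOn ℝ ∞ u T :=
  a.2.congr fun x hx => by rw [extendZero_of_mem _ hx, h]

lemma rep_toSmooth {T : Set E4} (u : E4 → ℝ) (hu : ContDiffOn ℝ ∞ u T) :
    Rep (toSmooth u hu) u := fun _ => rfl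

/-- The partial derivative as a derivation of the ring of smooth functions. -/
def partialDeriv {T : Set E4} (hT : IsCoordDomain T) (i : Fin 4) :
    Derivation ℝ (smoothRing T) (smoothRing T) :=
  Derivation.mk'
    { toFun := fun a => toSmooth (pd i (extendZero a.1)) (contDiffOn_pd hT a.2 i)
      map_add' := fun a b => by
        ext x
        change pd i (extendZero (a.1 + b.1)) x = pd i (extendZero a.1) x + pd i (extendZero b.1) x
        rw [← pd_add i hT x.2 a.2 b.2]
        exact pd_congr hT (fun y hy => by simp [extendZero_of_mem _ hy]) i x.2
      map_smul' := fun r a => by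
        ext x
        change pd i (extendZero (r • a.1)) x = r * pd i (extendZero a.1) x
        have := pd_mul i hT x.2 (contDiffOn_const (c := r)) a.2
        rw [show pd i (fun _ => r) x = 0 by simp [pd], mul_zero, add_zero] at this
        rw [← this]
        exact pd_congr hT (fun y hy => by simp [extendZero_of_mem _ hy]) i x.2 }
    fun a b => by
      ext x
      change pd i (extendZero (a.1 * b.1)) x
        = a.1 x * pd i (extendZero b.1) x + b.1 x * pd i (extendZero a.1) x
      have := pd_mul i hT x.2 a.2 b.2
      rw [extendZero_of_mem _ x.2, extendZero_of_mem _ x.2] at this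
      rw [← this]
      exact pd_congr hT (fun y hy => by simp [extendZero_of_mem _ hy]) i x.2

lemma Rep.pd {T : Set E4} (hT : IsCoordDomain T) {a : smoothRing T} {u : E4 → ℝ} (h : Rep a u)
    (i : Fin 4) : Rep (partialDeriv hT i a) (pd i u) := fun x =>
  pd_congr hT (fun y hy => by rw [extendZero_of_mem _ hy, h]) i x.2

/-! ### The Levi-Civita connection in coordinates -/

/-- `G` is a smooth Riemannian metric on the coordinate domain `T`. -/
structure IsMetricOn (T : Set E4) (G : E4 → Matrix (Fin 4) (Fin 4) ℝ) : Prop where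
  contDiffOn : ∀ i j, ContDiffOn ℝ ∞ (fun x => G x i j) T
  posDef : ∀ x ∈ T, (G x).PosDef

section
variable {T : Set E4} {G : E4 → Matrix (Fin 4) (Fin 4) ℝ}

lemma IsMetricOn.symm (hG : IsMetricOn T G) {x : E4} (hx : x ∈ T) (i j : Fin 4) :
    G x i j = G x j i := by
  have := congrFun (congrFun (hG.posDef x hx).1 i) j
  simpa using this.symm

lemma contDiffOn_det {S : E4 → Matrix (Fin 4) (Fin 4) ℝ}
    (hS : ∀ i j, ContDiffOn ℝ ∞ (fun x => S x i j) T) : ContDiffOn ℝ ∞ (fun x => (S x).det) T := by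
  simp only [det_apply]
  exact ContDiffOn.sum fun σ _ => (contDiffOn_prod fun i _ => hS _ _).const_smul _

lemma IsMetricOn.contDiffOn_ginv (hG : IsMetricOn T G) (i j : Fin 4) :
    ContDiffOn ℝ ∞ (fun x => ginv G x i j) T := by
  have e : ∀ x, ginv G x i j = (G x).det⁻¹ * ((G x).updateRow j (Pi.single i 1)).det := by
    intro x
    rw [ginv, inv_def, Ring.inverse_eq_inv', Matrix.smul_apply, adjugate_apply, smul_eq_mul]
  simp only [e]
  refine ((contDiffOn_det hG.contDiffOn).inv fun x hx => (hG.posDef x hx).det_pos.ne').mul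
    (contDiffOn_det fun k l => ?_)
  by_cases h : k = j
  · subst h; simpa using contDiffOn_const
  · simpa [h] using hG.contDiffOn k l

lemma IsMetricOn.contDiffOn_sqrt_det (hG : IsMetricOn T G) :
    ContDiffOn ℝ ∞ (fun x => Real.sqrt (G x).det) T :=
  (contDiffOn_det hG.contDiffOn).sqrt fun x hx => (hG.posDef x hx).det_pos.ne'

lemma IsMetricOn.contDiffOn_christoffel (hT : IsCoordDomain T) (hG : IsMetricOn T G)
    (k i j : Fin 4) : ContDiffOn ℝ ∞ (christoffel G k i j) T :=
  contDiffOn_const.mul <| ContDiffOn.sum fun l _ => (hG.contDiffOn_ginv k l).mul <|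
    ((contDiffOn_pd hT (hG.contDiffOn j l) i).add (contDiffOn_pd hT (hG.contDiffOn i l) j)).sub
      (contDiffOn_pd hT (hG.contDiffOn i j) l)

lemma IsMetricOn.ginv_mul (hG : IsMetricOn T G) {x : E4} (hx : x ∈ T) (i k : Fin 4) :
    ∑ j, ginv G x i j * G x j k = if i = k then 1 else 0 := by
  have := nonsing_inv_mul (G x) (hG.posDef x hx).det_pos.ne'.isUnit
  have := congrFun (congrFun this i) k
  simpa only [mul_apply, one_apply, ginv] using this

lemma IsMetricOn.mul_ginv (hG : IsMetricOn T G) {x : E4} (hx : x ∈ T) (i k : Fin 4) :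
    ∑ j, G x i j * ginv G x j k = if i = k then 1 else 0 := by
  have := mul_nonsing_inv (G x) (hG.posDef x hx).det_pos.ne'.isUnit
  have := congrFun (congrFun this i) k
  simpa only [mul_apply, one_apply, ginv] using this

lemma IsMetricOn.ginv_symm (hG : IsMetricOn T G) {x : E4} (hx : x ∈ T) (i j : Fin 4) :
    ginv G x i j = ginv G x j i := by
  have h : (G x)ᵀ = G x := by ext i j; exact hG.symm hx j i
  have := congrFun (congrFun (transpose_nonsing_inv (G x)) j) i
  rw [h] at this
  exact this

/-- The Koszul formula. -/
lemma IsMetricOn.lower_christoffel (hG : IsMetricOn T G)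
    {x : E4} (hx : x ∈ T) (m i j : Fin 4) : ∑ p, christoffel G p m i x * G x p j
      = (1 / 2) * (pd m (fun y => G y i j) x + pd i (fun y => G y m j) x
        - pd j (fun y => G y m i) x) := by
  have : ∀ p, christoffel G p m i x * G x p j = ∑ l, (1 / 2) * (G x j p * ginv G x p l *
      (pd m (fun y => G y i l) x + pd i (fun y => G y m l) x - pd l (fun y => G y m i) x)) := by
    intro p
    rw [christoffel, mul_right_comm, mul_assoc, Finset.mul_sum, Finset.mul_sum]
    exact Finset.sum_congr rfl fun l _ => by rw [hG.symm hx p j]; ring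
  simp only [this]
  rw [Finset.sum_comm]
  simp only [← Finset.mul_sum, ← Finset.sum_mul, hG.mul_ginv hx]
  simp

/-- The Levi-Civita connection of a metric on a coordinate domain, over the ring of smooth
functions. -/
def geom (hT : IsCoordDomain T) (hG : IsMetricOn T G) : LeviCivita (smoothRing T) where
  d := partialDeriv hT
  d_comm i j a := by
    ext x
    have h1 := ((show Rep a (extendZero a.1) from fun x => by
      rw [extendZero_of_mem _ x.2]).pd hT j).pd hT i x
    have h2 := ((show Rep a (extendZero a.1) from fun x => by
      rw [extendZero_of_mem _ x.2]).pd hT i).pd hT j x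
    exact h1.trans ((pd_pd_comm hT a.2 i j x.2).trans h2.symm)
  G := Matrix.of fun i j => toSmooth (fun x => G x i j) (hG.contDiffOn i j)
  gi := Matrix.of fun i j => toSmooth (fun x => ginv G x i j) (hG.contDiffOn_ginv i j)
  G_symm i j := by ext x; exact hG.symm x.2 i j
  gi_symm i j := by ext x; exact hG.ginv_symm x.2 i j
  gi_mul := by
    ext i j x
    have h := hG.ginv_mul x.2 i j
    simp only [mul_apply, of_apply, one_apply]
    rw [AddSubmonoidClass.coe_finsetSum, Finset.sum_apply]
    refine h.trans ?_
    split_ifs <;> rfl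
  Γ k i j := toSmooth (christoffel G k i j) (hG.contDiffOn_christoffel hT k i j)
  Γ_symm k i j := by
    ext x
    change christoffel G k i j x = christoffel G k j i x
    have e : ∀ l, pd l (fun y => G y i j) x = pd l (fun y => G y j i) x := fun l =>
      pd_congr hT (fun y hy => hG.symm hy i j) l x.2
    simp only [christoffel, e]
    congr 1
    exact Finset.sum_congr rfl fun l _ => by ring
  compat m i j := by
    ext x
    have h1 := (rep_toSmooth (fun x => G x i j) (hG.contDiffOn i j)).pd hT m x
    have e : ∀ (l i j : Fin 4), pd l (fun y => G y i j) x = pd l (fun y => G y j i) x :=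
      fun l i j => pd_congr hT (fun y hy => hG.symm hy i j) l x.2
    rw [AddSubmonoidClass.coe_finsetSum, Finset.sum_apply]
    refine h1.trans ?_
    change _ = ∑ p, (christoffel G p m i x * G x p j + christoffel G p m j x * G x i p)
    rw [Finset.sum_add_distrib, hG.lower_christoffel x.2]
    simp only [hG.symm x.2 i]
    rw [hG.lower_christoffel x.2, e m j i]
    ring

/-- Evaluation at a point of `T`. -/
def evalAt (x : T) : smoothRing T →+* ℝ := (Pi.evalRingHom _ x).comp (smoothRing T).subtype

lemma evalAt_smul (x : T) (r : ℝ) (a : smoothRing T) : evalAt x (r • a) = r * evalAt x a := rfl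

lemma rep_iff {a : smoothRing T} {u : E4 → ℝ} : Rep a u ↔ ∀ x : T, evalAt x a = u x := Iff.rfl

section Bridge

variable (hT : IsCoordDomain T) (hG : IsMetricOn T G)

lemma rep_Γ (k i j : Fin 4) : Rep ((geom hT hG).Γ k i j) (christoffel G k i j) := fun _ => rfl
lemma rep_d {a : smoothRing T} {u : E4 → ℝ} (h : Rep a u) (i : Fin 4) :
    Rep ((geom hT hG).d i a) (pd i u) := h.pd hT i

lemma eval_G (x : T) (i j : Fin 4) : evalAt x ((geom hT hG).G i j) = G x i j := rfl
lemma eval_gi (x : T) (i j : Fin 4) : evalAt x ((geom hT hG).gi i j) = ginv G x i j := rfl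
lemma eval_Γ (x : T) (k i j : Fin 4) :
    evalAt x ((geom hT hG).Γ k i j) = christoffel G k i j x := rfl

lemma eval_tr (x : T) (S : Fin 4 → Fin 4 → smoothRing T) :
    evalAt x ((geom hT hG).tr S) = ∑ i, ∑ j, ginv G x i j * evalAt x (S i j) := by
  simp only [LeviCivita.tr, map_sum, map_mul, eval_gi]

lemma rep_rup (m l i j : Fin 4) : Rep ((geom hT hG).rup m l i j) (riemUp G m l i j) := by
  refine rep_iff.2 fun x => ?_
  simp only [LeviCivita.rup, map_add, map_sub, map_sum, map_mul, eval_Γ, riemUp]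
  rw [rep_iff.1 (rep_d hT hG (rep_Γ hT hG m j l) i), rep_iff.1 (rep_d hT hG (rep_Γ hT hG m i l) j)]

lemma rep_riem (i j k l : Fin 4) : Rep ((geom hT hG).riem i j k l) (riem G i j k l) := by
  refine rep_iff.2 fun x => ?_
  simp only [LeviCivita.riem, map_sum, map_mul, eval_G, riem, rep_iff.1 (rep_rup hT hG _ _ _ _)]

lemma rep_ric (i k : Fin 4) : Rep ((geom hT hG).ric i k) (ric G i k) := by
  refine rep_iff.2 fun x => ?_
  simp only [LeviCivita.ric, eval_tr, ric, rep_iff.1 (rep_riem hT hG _ _ _ _)]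

lemma rep_scal : Rep (geom hT hG).scal (scal G) := by
  refine rep_iff.2 fun x => ?_
  simp only [LeviCivita.scal, eval_tr, scal, rep_iff.1 (rep_ric hT hG _ _)]

lemma rep_weyl (i j k l : Fin 4) : Rep ((geom hT hG).weylT i j k l) (weyl G i j k l) := by
  refine rep_iff.2 fun x => ?_
  simp only [LeviCivita.weylT, map_add, map_sub, map_mul, evalAt_smul, eval_G, weyl,
    rep_iff.1 (rep_riem hT hG _ _ _ _), rep_iff.1 (rep_ric hT hG _ _), rep_iff.1 (rep_scal hT hG)]
  ring

/-- The square root of the determinant of the metric. -/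
def sqrtDet (hG : IsMetricOn T G) : smoothRing T := toSmooth _ hG.contDiffOn_sqrt_det

lemma sqrtDet_mul_self : sqrtDet hG * sqrtDet hG = (geom hT hG).G.det := by
  ext x
  have h : evalAt x (geom hT hG).G.det = (G x).det := by
    rw [RingHom.map_det]; rfl
  exact (Real.mul_self_sqrt (hG.posDef x x.2).det_pos.le).trans h.symm

lemma rep_weylPlus (i j k l : Fin 4) :
    Rep ((geom hT hG).weylPlusT (sqrtDet hG) i j k l) (weylPlus G i j k l) := by
  refine rep_iff.2 fun x => ?_
  have hs : evalAt x (sqrtDet hG) = Real.sqrt (G x).det := rfl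
  simp only [LeviCivita.weylPlusT, LeviCivita.star, LeviCivita.vol, evalAt_smul, map_add, map_mul,
    eval_tr, rep_iff.1 (rep_weyl hT hG _ _ _ _), map_intCast, hs, weylPlus, weylStar, volForm]
  congr 3
  refine Finset.sum_congr rfl fun a _ => ?_
  simp only [Finset.mul_sum]
  rw [Finset.sum_comm]
  exact Finset.sum_congr rfl fun b _ => Finset.sum_congr rfl fun c _ =>
    Finset.sum_congr rfl fun d _ => by ring

lemma rep_div {S : Fin 4 → Fin 4 → Fin 4 → Fin 4 → smoothRing T}
    {U : Fin 4 → Fin 4 → Fin 4 → Fin 4 → E4 → ℝ} (h : ∀ i j k l, Rep (S i j k l) (U i j k l))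
    (j k l : Fin 4) : Rep ((geom hT hG).div S j k l) (div4 G U j k l) := by
  refine rep_iff.2 fun x => ?_
  simp only [LeviCivita.div, LeviCivita.cov4, eval_tr, map_sub, map_sum, map_add, map_mul, eval_Γ,
    fun i j k l => rep_iff.1 (h i j k l), fun m i j k l =>
      rep_iff.1 (rep_d hT hG (h i j k l) m), div4, covDeriv4]

variable {a b : smoothRing T} {F U : E4 → ℝ}

lemma rep_grad (h : Rep a F) (k : Fin 4) :
    Rep ((geom hT hG).gradT a k) (fun x => grad G F x k) := by
  refine rep_iff.2 fun x => ?_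
  simp only [LeviCivita.gradT, map_sum, map_mul, eval_gi, rep_iff.1 (rep_d hT hG h _), grad]

lemma rep_hess (h : Rep a F) (i j : Fin 4) : Rep ((geom hT hG).hessT a i j) (hess G F i j) := by
  refine rep_iff.2 fun x => ?_
  simp only [LeviCivita.hessT, map_sub, map_sum, map_mul, eval_Γ, rep_iff.1 (rep_d hT hG h _),
    rep_iff.1 (rep_d hT hG (rep_d hT hG h j) i), hess]

lemma rep_lap (h : Rep a F) : Rep ((geom hT hG).tr ((geom hT hG).hessT a)) (lap G F) := by
  refine rep_iff.2 fun x => ?_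
  simp only [eval_tr, rep_iff.1 (rep_hess hT hG h _ _), lap]

/-- The pairing `⟨∇F, ∇U⟩` in coordinates. -/
def pairIn (G : E4 → Matrix (Fin 4) (Fin 4) ℝ) (F U : E4 → ℝ) (x : E4) : ℝ :=
  ∑ k, ∑ l, ginv G x k l * (pd k F x * pd l U x)

lemma rep_pair (h : Rep a F) (h' : Rep b U) : Rep ((geom hT hG).pair a b) (pairIn G F U) := by
  refine rep_iff.2 fun x => ?_
  simp only [LeviCivita.pair, eval_tr, map_mul, rep_iff.1 (rep_d hT hG h _),
    rep_iff.1 (rep_d hT hG h' _), pairIn]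

end Bridge
end

/-! ### Bilinear forms in orthonormal frames -/

/-- The bilinear form with the components `S`. -/
def bil (S : Fin 4 → Fin 4 → ℝ) (X Y : Fin 4 → ℝ) : ℝ := ∑ i, ∑ j, S i j * X i * Y j

lemma bil_eq (S : Fin 4 → Fin 4 → ℝ) (X Y : Fin 4 → ℝ) :
    bil S X Y = X ⬝ᵥ (Matrix.of S) *ᵥ Y := by
  simp only [bil, dotProduct, mulVec, of_apply, Finset.mul_sum]
  exact Finset.sum_congr rfl fun i _ => Finset.sum_congr rfl fun j _ => by ring

lemma gAt_eq_bil (G : E4 → Matrix (Fin 4) (Fin 4) ℝ) (x : E4) : gAt G x = bil (G x) := rfl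

lemma bil_symm {S : Fin 4 → Fin 4 → ℝ} (h : ∀ i j, S i j = S j i) (X Y : Fin 4 → ℝ) :
    bil S X Y = bil S Y X := by
  simp only [bil]
  rw [Finset.sum_comm]
  exact Finset.sum_congr rfl fun i _ => Finset.sum_congr rfl fun j _ => by rw [h]; ring

lemma bil_sum_left {ι : Type*} (s : Finset ι) (S : Fin 4 → Fin 4 → ℝ) (X : ι → Fin 4 → ℝ)
    (Y : Fin 4 → ℝ) : bil S (∑ a ∈ s, X a) Y = ∑ a ∈ s, bil S (X a) Y := by
  simp only [bil_eq, sum_dotProduct]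

lemma bil_sum_right {ι : Type*} (s : Finset ι) (S : Fin 4 → Fin 4 → ℝ) (X : Fin 4 → ℝ)
    (Y : ι → Fin 4 → ℝ) : bil S X (∑ a ∈ s, Y a) = ∑ a ∈ s, bil S X (Y a) := by
  simp only [bil_eq, mulVec_sum, dotProduct_sum]

lemma bil_smul_left (S : Fin 4 → Fin 4 → ℝ) (r : ℝ) (X Y : Fin 4 → ℝ) :
    bil S (r • X) Y = r * bil S X Y := by
  simp only [bil_eq, smul_dotProduct, smul_eq_mul]

lemma bil_smul_right (S : Fin 4 → Fin 4 → ℝ) (r : ℝ) (X Y : Fin 4 → ℝ) :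
    bil S X (r • Y) = r * bil S X Y := by
  simp only [bil_eq, mulVec_smul, dotProduct_smul, smul_eq_mul]

lemma bil_single (S : Fin 4 → Fin 4 → ℝ) (i j : Fin 4) :
    bil S (Pi.single i 1) (Pi.single j 1) = S i j := by
  simp [bil_eq]

/-- The frame `e` is orthonormal for `g`. -/
def Orthonormal4 (g : Matrix (Fin 4) (Fin 4) ℝ) (e : Fin 4 → Fin 4 → ℝ) : Prop :=
  ∀ a b, bil g (e a) (e b) = if a = b then 1 else 0

section Frame

variable {g : Matrix (Fin 4) (Fin 4) ℝ} {e : Fin 4 → Fin 4 → ℝ}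

lemma Orthonormal4.inv_eq (he : Orthonormal4 g e) : g⁻¹ = (Matrix.of e)ᵀ * Matrix.of e := by
  have h1 : Matrix.of e * (g * (Matrix.of e)ᵀ) = 1 := by
    ext a b
    exact (bil_eq g (e a) (e b)).symm.trans ((he a b).trans (one_apply).symm)
  rw [← mul_assoc, mul_eq_one_comm, ← mul_assoc] at h1
  exact inv_eq_left_inv h1

lemma Orthonormal4.inv_apply (he : Orthonormal4 g e) (i j : Fin 4) :
    g⁻¹ i j = ∑ a, e a i * e a j := by
  rw [he.inv_eq]; rfl

lemma Orthonormal4.trace (he : Orthonormal4 g e) (S : Fin 4 → Fin 4 → ℝ) :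
    ∑ i, ∑ j, g⁻¹ i j * S i j = ∑ a, bil S (e a) (e a) := by
  simp only [he.inv_apply, bil, Finset.sum_mul]
  rw [Finset.sum_congr rfl fun i _ => Finset.sum_comm, Finset.sum_comm]
  exact Finset.sum_congr rfl fun a _ => Finset.sum_congr rfl fun i _ =>
    Finset.sum_congr rfl fun j _ => by ring

lemma Orthonormal4.normSq (he : Orthonormal4 g e) (S : Fin 4 → Fin 4 → ℝ) :
    ∑ i, ∑ j, ∑ k, ∑ l, g⁻¹ i k * g⁻¹ j l * S i j * S k l = ∑ a, ∑ b, bil S (e a) (e b) ^ 2 := by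
  have h1 : ∀ i k, ∑ j, ∑ l, g⁻¹ j l * (S i j * S k l)
      = ∑ b, (∑ j, S i j * e b j) * ∑ l, S k l * e b l := by
    intro i k
    rw [he.trace]
    refine Finset.sum_congr rfl fun b _ => ?_
    rw [Finset.sum_mul_sum, bil]
    exact Finset.sum_congr rfl fun j _ => Finset.sum_congr rfl fun l _ => by ring
  have h2 : ∑ i, ∑ j, ∑ k, ∑ l, g⁻¹ i k * g⁻¹ j l * S i j * S k l
      = ∑ i, ∑ k, g⁻¹ i k * ∑ j, ∑ l, g⁻¹ j l * (S i j * S k l) := by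
    refine Finset.sum_congr rfl fun i _ => ?_
    rw [Finset.sum_comm]
    simp only [Finset.mul_sum]
    exact Finset.sum_congr rfl fun k _ => Finset.sum_congr rfl fun j _ =>
      Finset.sum_congr rfl fun l _ => by ring
  rw [h2, he.trace]
  refine Finset.sum_congr rfl fun a _ => ?_
  simp only [h1, bil, Finset.sum_mul]
  rw [Finset.sum_congr rfl fun i _ => Finset.sum_comm, Finset.sum_comm]
  refine Finset.sum_congr rfl fun b _ => ?_
  rw [sq, Finset.sum_mul_sum]
  refine Finset.sum_congr rfl fun i _ => Finset.sum_congr rfl fun k _ => ?_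
  have e1 : ∀ i, ∑ j, S i j * e a i * e b j = e a i * ∑ j, S i j * e b j := fun i => by
    rw [Finset.mul_sum]; exact Finset.sum_congr rfl fun j _ => by ring
  rw [e1, e1]
  simp only [← Finset.sum_mul]
  ring

lemma Orthonormal4.expand (he : Orthonormal4 g e) (X : Fin 4 → ℝ) :
    X = ∑ a, bil g (e a) X • e a := by
  have h1 : Matrix.of e * (g * (Matrix.of e)ᵀ) = 1 := by
    ext a b
    exact (bil_eq g (e a) (e b)).symm.trans ((he a b).trans (one_apply).symm)
  rw [← mul_assoc, mul_eq_one_comm] at h1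
  have h2 : X = (Matrix.of e)ᵀ *ᵥ ((Matrix.of e * g) *ᵥ X) := by
    rw [mulVec_mulVec, h1, one_mulVec]
  conv_lhs => rw [h2]
  ext i
  simp only [mulVec, dotProduct, transpose_apply, of_apply, Finset.sum_apply, Pi.smul_apply,
    smul_eq_mul]
  refine Finset.sum_congr rfl fun a _ => ?_
  rw [mul_comm]
  congr 1
  exact ((dotProduct_mulVec _ _ _).symm.trans (bil_eq g (e a) X).symm :
    e a ᵥ* g ⬝ᵥ X = bil g (e a) X)

lemma Orthonormal4.bil_expand (he : Orthonormal4 g e)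
    (S : Fin 4 → Fin 4 → ℝ) (X Y : Fin 4 → ℝ) :
    bil S X Y = ∑ a, ∑ b, bil g (e a) X * bil g (e b) Y * bil S (e a) (e b) := by
  conv_lhs => rw [he.expand X, he.expand Y]
  simp only [bil_sum_left, bil_sum_right, bil_smul_left, bil_smul_right, mul_assoc, Finset.mul_sum]
  rw [Finset.sum_comm]
  exact Finset.sum_congr rfl fun a _ => Finset.sum_congr rfl fun b _ => by ring

lemma exists_orthonormal_of_finrank {V : Type*} [NormedAddCommGroup V] [InnerProductSpace ℝ V]
    (hV : Module.finrank ℝ V = 4) {v : V} (hv : inner ℝ v v = 1) :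
    ∃ e : Fin 4 → V, (∀ a b, inner ℝ (e a) (e b) = if a = b then 1 else 0) ∧ e 3 = v := by
  have h : Orthonormal ℝ (({3} : Set (Fin 4)).domRestrict fun _ => v) := by
    rw [orthonormal_iff_ite]
    rintro ⟨i, hi⟩ ⟨j, hj⟩
    have hij : (⟨i, hi⟩ : ({3} : Set (Fin 4))) = ⟨j, hj⟩ := Subtype.ext (hi.trans hj.symm)
    rw [if_pos hij]
    exact hv
  have : FiniteDimensional ℝ V := Module.finite_of_finrank_eq_succ hV
  obtain ⟨b, hb⟩ := h.exists_orthonormalBasis_extension_of_card_eq (by simp [hV])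
  exact ⟨b, fun i j => orthonormal_iff_ite.mp b.orthonormal i j, hb 3 rfl⟩

/-- A unit vector is the last member of an orthonormal frame. -/
lemma exists_orthonormal4 (hg : g.PosDef) {N : Fin 4 → ℝ} (hN : bil g N N = 1) :
    ∃ e, Orthonormal4 g e ∧ e 3 = N := by
  have hin : ∀ X Y : Fin 4 → ℝ, (g *ᵥ Y) ⬝ᵥ star X = bil g X Y := fun X Y => by
    rw [dotProduct_comm]; exact (bil_eq g X Y).symm
  obtain ⟨e, he, h3⟩ := @exists_orthonormal_of_finrank (Fin 4 → ℝ) (g.toNormedAddCommGroup hg)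
    (g.toInnerProductSpace hg.posSemidef) (by simp) N ((hin N N).trans hN)
  exact ⟨e, fun a b => (hin _ _).symm.trans (he a b), h3⟩

end Frame

/-! ### Level sets in coordinates -/

section
variable {T : Set E4} {G : E4 → Matrix (Fin 4) (Fin 4) ℝ} {F : E4 → ℝ} {x : E4}

lemma IsMetricOn.gAt_grad (hG : IsMetricOn T G) (hx : x ∈ T) (X : Fin 4 → ℝ) :
    gAt G x (grad G F x) X = ∑ i, pd i F x * X i := by
  simp only [gAt, grad]
  rw [Finset.sum_comm]
  refine Finset.sum_congr rfl fun j _ => ?_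
  have : ∀ i, G x i j * (∑ l, ginv G x i l * pd l F x) * X j
      = ∑ l, (G x j i * ginv G x i l) * pd l F x * X j := fun i => by
    rw [Finset.mul_sum, Finset.sum_mul]
    exact Finset.sum_congr rfl fun l _ => by rw [hG.symm hx i j]; ring
  simp only [this]
  rw [Finset.sum_comm]
  simp only [← Finset.sum_mul, hG.mul_ginv hx]
  simp

lemma IsMetricOn.gAt_grad_grad (hG : IsMetricOn T G) (hx : x ∈ T) :
    gAt G x (grad G F x) (grad G F x) = pairIn G F F x := by
  rw [hG.gAt_grad hx]
  simp only [grad, pairIn, Finset.mul_sum]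
  exact Finset.sum_congr rfl fun i _ => Finset.sum_congr rfl fun j _ => by ring

lemma IsMetricOn.gAt_pos (hG : IsMetricOn T G) (hx : x ∈ T) {X : Fin 4 → ℝ} (hX : X ≠ 0) :
    0 < gAt G x X X := by
  have := (hG.posDef x hx).dotProduct_mulVec_pos hX
  have e : gAt G x X X = star X ⬝ᵥ (G x *ᵥ X) := bil_eq (G x) X X
  rwa [e]

lemma IsMetricOn.pairIn_pos (hG : IsMetricOn T G) (hx : x ∈ T) (h : ∃ i, pd i F x ≠ 0) :
    0 < pairIn G F F x := by
  rw [← hG.gAt_grad_grad hx]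
  refine hG.gAt_pos hx fun h0 => ?_
  obtain ⟨i, hi⟩ := h
  refine hi ?_
  have := hG.gAt_grad (F := F) hx (Pi.single i 1)
  rw [h0] at this
  simpa [gAt, Pi.single_apply] using this.symm

lemma IsMetricOn.gradNorm_sq (hG : IsMetricOn T G) (hx : x ∈ T) :
    gradNorm G F x ^ 2 = pairIn G F F x := by
  rw [gradNorm, hG.gAt_grad_grad hx, Real.sq_sqrt]
  by_cases h : ∃ i, pd i F x ≠ 0
  · exact (hG.pairIn_pos hx h).le
  · push Not at h
    simp [pairIn, h]

lemma IsMetricOn.gradNorm_pos (hG : IsMetricOn T G) (hx : x ∈ T) (h : ∃ i, pd i F x ≠ 0) :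
    0 < gradNorm G F x := by
  rw [gradNorm, hG.gAt_grad_grad hx]
  exact Real.sqrt_pos.mpr (hG.pairIn_pos hx h)

lemma IsMetricOn.contDiffOn_pairIn (hT : IsCoordDomain T) (hG : IsMetricOn T G) {U : E4 → ℝ}
    (hF : ContDiffOn ℝ ∞ F T) (hU : ContDiffOn ℝ ∞ U T) : ContDiffOn ℝ ∞ (pairIn G F U) T :=
  (rep_pair hT hG (rep_toSmooth F hF) (rep_toSmooth U hU)).contDiffOn

lemma IsCoordDomain.inter_ne (hT : IsCoordDomain T) {u : E4 → ℝ} (hu : ContinuousOn u T) :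
    IsCoordDomain (T ∩ {y | u y ≠ 0}) where
  subset := fun _ hy => hT.subset hy.1
  mem_nhdsWithin y hy := by
    have h1 := hT.mem_nhdsWithin y hy.1
    refine Filter.inter_mem h1 ?_
    have h2 : ∀ᶠ z in 𝓝[T] y, u z ≠ 0 := (hu y hy.1).eventually_ne hy.2
    exact nhdsWithin_le_iff.mpr h1 h2

lemma IsMetricOn.mono {T' : Set E4} (hG : IsMetricOn T G) (h : T' ⊆ T) : IsMetricOn T' G :=
  ⟨fun i j => (hG.contDiffOn i j).mono h, fun x hx => hG.posDef x (h hx)⟩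

/-- The second fundamental form of the level sets is the Hessian divided by the norm of the
gradient. -/
lemma secondFF_eq (hT : IsCoordDomain T) (hG : IsMetricOn T G) (hF : ContDiffOn ℝ ∞ F T)
    (hx : x ∈ T) (hreg : ∃ i, pd i F x ≠ 0) (X : Fin 4 → ℝ) {Y : Fin 4 → ℝ}
    (hY : IsTangentToLevel F x Y) :
    secondFF G F x X Y = bil (fun i j => hess G F i j x) X Y / gradNorm G F x := by
  -- the norm of the gradient is smooth only where it does not vanish
  set q := pairIn G F F with hq
  have hqs : ContDiffOn ℝ ∞ q T := hG.contDiffOn_pairIn hT hF hF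
  set T' := T ∩ {y | q y ≠ 0} with hT'
  have hT0 : IsCoordDomain T' := hT.inter_ne hqs.continuousOn
  have hsub : T' ⊆ T := Set.inter_subset_left
  have hG' := hG.mono hsub
  have hF' := hF.mono hsub
  have hx' : x ∈ T' := ⟨hx, (hG.pairIn_pos hx hreg).ne'⟩
  set κ : E4 → ℝ := fun y => (Real.sqrt (q y))⁻¹ with hκ
  have hκs : ContDiffOn ℝ ∞ κ T' := by
    refine ((hqs.mono hsub).sqrt fun y hy => hy.2).inv fun y hy => ?_
    have h0 : 0 ≤ q y := by rw [hq, ← hG.gradNorm_sq hy.1]; positivity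
    exact (Real.sqrt_pos.mpr (lt_of_le_of_ne h0 (Ne.symm hy.2))).ne'
  have hn : ∀ y ∈ T', ∀ k, normal G F y k = grad G F y k * κ y := by
    intro y hy k
    rw [normal, gradNorm, hG.gAt_grad_grad hy.1, div_eq_mul_inv]
  have hgrad : ∀ k, ContDiffOn ℝ ∞ (fun y => grad G F y k) T' := fun k =>
    (rep_grad hT0 hG' (rep_toSmooth F hF') k).contDiffOn
  have hcov : ∀ i k, covNormal G F i k x = grad G F x k * pd i κ x
      + κ x * (pd i (fun y => grad G F y k) x + ∑ l, christoffel G k i l x * grad G F x l) := by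
    intro i k
    rw [covNormal, pd_congr hT0 (fun y hy => hn y hy k) i hx', pd_mul i hT0 hx' (hgrad k) hκs,
      mul_add, add_assoc, Finset.mul_sum]
    congr 2
    exact Finset.sum_congr rfl fun l _ => by rw [hn x hx']; ring
  have hc2 : ∀ i j, ∑ k, G x j k * (pd i (fun y => grad G F y k) x
      + ∑ l, christoffel G k i l x * grad G F x l) = hess G F i j x := by
    intro i j
    have h := congrArg (evalAt ⟨x, hx'⟩) ((geom hT0 hG').cov_gradT (toSmooth F hF') i j)
    simpa only [map_sum, map_mul, map_add, eval_G, eval_Γ,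
      rep_iff.1 (rep_grad hT0 hG' (rep_toSmooth F hF') _),
      rep_iff.1 (rep_hess hT0 hG' (rep_toSmooth F hF') _ _),
      rep_iff.1 (rep_d hT0 hG' (rep_grad hT0 hG' (rep_toSmooth F hF') _) _)] using h
  have hc3 : ∀ j, ∑ k, G x j k * grad G F x k = pd j F x := by
    intro j
    have h := hG.gAt_grad (F := F) hx (Pi.single j 1)
    simp only [Pi.single_apply, mul_ite, mul_one, mul_zero, Finset.sum_ite_eq', Finset.mem_univ,
      if_true, gAt] at h
    rw [← h]
    exact Finset.sum_congr rfl fun k _ => by rw [hG.symm hx]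
  have hB : ∀ i j, ∑ k, G x j k * covNormal G F i k x
      = pd j F x * pd i κ x + κ x * hess G F i j x := by
    intro i j
    rw [← hc3, ← hc2, Finset.sum_mul, Finset.mul_sum, ← Finset.sum_add_distrib]
    exact Finset.sum_congr rfl fun k _ => by rw [hcov]; ring
  have h1 : secondFF G F x X Y
      = ∑ i, ∑ j, (pd j F x * pd i κ x + κ x * hess G F i j x) * X i * Y j := by
    simp only [← hB, secondFF, Finset.sum_mul]
  have h2 : ∑ i, ∑ j, pd j F x * pd i κ x * X i * Y j = 0 := by
    have : ∀ i, ∑ j, pd j F x * pd i κ x * X i * Y j = 0 := fun i => by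
      have h : ∑ j, pd j F x * Y j = 0 := hY
      rw [← mul_zero (pd i κ x * X i), ← h, Finset.mul_sum]
      exact Finset.sum_congr rfl fun j _ => by ring
    simp [this]
  have hκn : κ x = (gradNorm G F x)⁻¹ := by rw [hκ, gradNorm, hG.gAt_grad_grad hx]
  rw [h1]
  simp only [add_mul, Finset.sum_add_distrib, h2, zero_add]
  rw [div_eq_mul_inv, ← hκn, bil, Finset.sum_mul]
  refine Finset.sum_congr rfl fun i _ => ?_
  rw [Finset.sum_mul]
  exact Finset.sum_congr rfl fun j _ => by ring

lemma secondFF_eq_bil (X Y : Fin 4 → ℝ) : secondFF G F x X Y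
    = bil (fun i j => secondFF G F x (Pi.single i 1) (Pi.single j 1)) X Y := by
  have e : secondFF G F x = bil fun i j => ∑ k, G x j k * covNormal G F i k x := by
    ext X Y
    simp only [secondFF, bil, Finset.sum_mul]
  rw [e]
  simp only [bil_single]

lemma IsAdaptedFrame.orthonormal4 {e : Fin 4 → Fin 4 → ℝ} (he : IsAdaptedFrame G F x e) :
    Orthonormal4 (G x) e := he.orthonormal

lemma IsMetricOn.gAt_normal (hG : IsMetricOn T G) (hx : x ∈ T) (X : Fin 4 → ℝ) :
    gAt G x (normal G F x) X = (∑ i, pd i F x * X i) / gradNorm G F x := by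
  have e : normal G F x = (gradNorm G F x)⁻¹ • grad G F x := by
    ext k; simp [normal, div_eq_inv_mul]
  rw [e]
  exact (bil_smul_left _ _ _ _).trans (by rw [← gAt_eq_bil, hG.gAt_grad hx, div_eq_inv_mul])

lemma IsMetricOn.gAt_normal_eq_zero_iff (hG : IsMetricOn T G) (hx : x ∈ T)
    (hreg : ∃ i, pd i F x ≠ 0) (X : Fin 4 → ℝ) :
    gAt G x (normal G F x) X = 0 ↔ IsTangentToLevel F x X := by
  rw [hG.gAt_normal hx, div_eq_zero_iff, or_iff_left (hG.gradNorm_pos hx hreg).ne',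
    IsTangentToLevel]

lemma IsAdaptedFrame.tangent {e : Fin 4 → Fin 4 → ℝ} (he : IsAdaptedFrame G F x e)
    (hG : IsMetricOn T G) (hx : x ∈ T) (hreg : ∃ i, pd i F x ≠ 0) (a : Fin 3) :
    IsTangentToLevel F x (e a.castSucc) := by
  rw [← hG.gAt_normal_eq_zero_iff hx hreg, ← he.last_eq, he.orthonormal, if_neg]
  fin_cases a <;> decide

lemma IsMetricOn.gAt_normal_normal (hG : IsMetricOn T G) (hx : x ∈ T)
    (hreg : ∃ i, pd i F x ≠ 0) : gAt G x (normal G F x) (normal G F x) = 1 := by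
  have h0 := hG.gradNorm_pos hx hreg
  rw [hG.gAt_normal hx]
  simp only [normal, ← mul_div_assoc, ← Finset.sum_div]
  rw [← hG.gAt_grad hx, hG.gAt_grad_grad hx, ← hG.gradNorm_sq hx]
  field_simp

lemma IsMetricOn.exists_adaptedFrame (hG : IsMetricOn T G) (hx : x ∈ T)
    (hreg : ∃ i, pd i F x ≠ 0) : ∃ e, IsAdaptedFrame G F x e := by
  obtain ⟨e, he, h3⟩ := exists_orthonormal4 (hG.posDef x hx) (hG.gAt_normal_normal hx hreg)
  exact ⟨e, he, h3⟩

/-- The mean curvature is the sum of the diagonal entries of the second fundamental form. -/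
lemma IsAdaptedFrame.meanCurv_eq {e : Fin 4 → Fin 4 → ℝ} (he : IsAdaptedFrame G F x e) :
    meanCurv G F x = ∑ a : Fin 3, secondFF G F x (e a.castSucc) (e a.castSucc) := by
  have h : ∀ i j, ginv G x i j - normal G F x i * normal G F x j
      = ∑ a : Fin 3, e a.castSucc i * e a.castSucc j := by
    intro i j
    rw [ginv, he.orthonormal4.inv_apply, Fin.sum_univ_castSucc (n := 3),
      show Fin.last 3 = 3 from rfl, he.last_eq]
    ring
  rw [meanCurv]
  simp only [h, Finset.sum_mul]
  rw [Finset.sum_congr rfl fun i _ => Finset.sum_comm, Finset.sum_comm]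
  refine Finset.sum_congr rfl fun a _ => ?_
  rw [secondFF_eq_bil, bil]
  exact Finset.sum_congr rfl fun i _ => Finset.sum_congr rfl fun j _ => by ring

/-- Vectors tangent to the level set are combinations of the first three frame vectors. -/
lemma IsAdaptedFrame.bil_tangent {e : Fin 4 → Fin 4 → ℝ} (he : IsAdaptedFrame G F x e)
    (hG : IsMetricOn T G) (hx : x ∈ T) (hreg : ∃ i, pd i F x ≠ 0) (S : Fin 4 → Fin 4 → ℝ)
    {X Y : Fin 4 → ℝ} (hX : IsTangentToLevel F x X) (hY : IsTangentToLevel F x Y) :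
    bil S X Y = ∑ a : Fin 3, ∑ b : Fin 3, gAt G x (e a.castSucc) X * gAt G x (e b.castSucc) Y
      * bil S (e a.castSucc) (e b.castSucc) := by
  rw [he.orthonormal4.bil_expand S X Y, Fin.sum_univ_castSucc (n := 3)]
  simp only [Fin.sum_univ_castSucc (n := 3), show Fin.last 3 = 3 from rfl, he.last_eq,
    ← gAt_eq_bil, (hG.gAt_normal_eq_zero_iff hx hreg _).mpr hX,
    (hG.gAt_normal_eq_zero_iff hx hreg _).mpr hY, zero_mul, mul_zero, add_zero,
    Finset.sum_const_zero]

end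

/-! ### The Miao–Tam equation in coordinates -/

lemma ext_evalAt {T : Set E4} {a b : smoothRing T} (h : ∀ x, evalAt x a = evalAt x b) : a = b :=
  Subtype.ext (funext h)

/-- A coordinate domain `T` with a metric `G` of vanishing `div W⁺` and a smooth solution `F` of the
Miao–Tam equation. -/
structure IsMiaoTamChart (T : Set E4) (G : E4 → Matrix (Fin 4) (Fin 4) ℝ) (F : E4 → ℝ) :
    Prop where
  dom : IsCoordDomain T
  metric : IsMetricOn T G
  smooth : ContDiffOn ℝ ∞ F T
  eq : ∀ x ∈ T, ∀ i j, -(lap G F x) * G x i j + hess G F i j x - F x * ric G i j x = G x i j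
  div_weylPlus : ∀ x ∈ T, ∀ j k l, div4 G (weylPlus G) j k l x = 0

namespace IsMiaoTamChart

variable {T : Set E4} {G : E4 → Matrix (Fin 4) (Fin 4) ℝ} {F : E4 → ℝ} {x : E4}
  (h : IsMiaoTamChart T G F)

/-- The Levi-Civita connection over the ring of smooth functions. -/
abbrev conn (h : IsMiaoTamChart T G F) : LeviCivita (smoothRing T) := geom h.dom h.metric

/-- `F` as an element of the ring of smooth functions. -/
abbrev fn (h : IsMiaoTamChart T G F) : smoothRing T := toSmooth F h.smooth

lemma rep_fn (h : IsMiaoTamChart T G F) : Rep h.fn F := rep_toSmooth F h.smooth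

lemma miaoTamEq (h : IsMiaoTamChart T G F) : h.conn.MiaoTamEq h.fn := by
  intro i j
  refine ext_evalAt fun x => ?_
  simp only [map_sub, map_add, map_mul, map_neg, eval_G,
    rep_iff.1 (rep_lap h.dom h.metric h.rep_fn), rep_iff.1 (rep_hess h.dom h.metric h.rep_fn i j),
    rep_iff.1 (rep_ric h.dom h.metric i j), rep_iff.1 h.rep_fn]
  exact h.eq x x.2 i j

/-- The zero set of a solution has empty interior. -/
lemma not_zero_near (h : IsMiaoTamChart T G F) (hx : x ∈ T) :
    ¬ ∀ᶠ y in 𝓝[T] x, F y = 0 := by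
  intro h0
  obtain ⟨O, hO, hxO, hsub⟩ := mem_nhdsWithin.mp h0
  have hdom : IsCoordDomain (T ∩ O) := by
    refine ⟨fun y hy => h.dom.subset hy.1, fun y hy => ?_⟩
    exact Filter.inter_mem (h.dom.mem_nhdsWithin y hy.1)
      (mem_nhdsWithin_of_mem_nhds (hO.mem_nhds hy.2))
  have h1 : ∀ y ∈ T ∩ O, F y = 0 := fun y hy => hsub ⟨hy.2, hy.1⟩
  have h2 : ∀ i, ∀ y ∈ T ∩ O, pd i F y = 0 := fun i y hy => by
    rw [pd_congr hdom h1 i hy]; simp [pd]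
  have hx' : x ∈ T ∩ O := ⟨hx, hxO⟩
  have h3 : ∀ i j, hess G F i j x = 0 := fun i j => by
    rw [hess, pd_congr hdom (h2 j) i hx']
    simp only [h2 _ x hx', mul_zero, Finset.sum_const_zero, sub_zero]
    simp [pd]
  have h4 := h.eq x hx 0 0
  rw [h3, h1 x hx', lap] at h4
  simp only [h3] at h4
  have h5 := (h.metric.posDef x hx).diag_pos (i := 0)
  simp at h4
  exact h5.ne h4

lemma pd_scal (h : IsMiaoTamChart T G F) (hx : x ∈ T) (i : Fin 4) : pd i (scal G) x = 0 := by
  have hs := rep_d h.dom h.metric (rep_scal h.dom h.metric) i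
  have hmul : ∀ y ∈ T, F y * pd i (scal G) y = 0 := fun y hy => by
    have := congrArg (evalAt ⟨y, hy⟩) (LeviCivita.mul_d_scal h.miaoTamEq i)
    simpa only [map_mul, map_zero, rep_iff.1 hs, rep_iff.1 h.rep_fn] using this
  by_contra hne
  refine h.not_zero_near hx ?_
  have hc := hs.contDiffOn.continuousOn x hx
  filter_upwards [hc.eventually_ne hne, self_mem_nhdsWithin] with y hy hyT
  exact (mul_eq_zero.mp (hmul y hyT)).resolve_right hy

lemma d_scal (h : IsMiaoTamChart T G F) (i : Fin 4) : h.conn.d i h.conn.scal = 0 := by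
  ext x
  exact (rep_d h.dom h.metric (rep_scal h.dom h.metric) i x).trans (h.pd_scal x.2 i)

lemma hess_eq (h : IsMiaoTamChart T G F) (hx : x ∈ T) (i j : Fin 4) :
    hess G F i j x = F x * ric G i j x + (1 + lap G F x) * G x i j := by
  linear_combination h.eq x hx i j

lemma three_lap (h : IsMiaoTamChart T G F) (hx : x ∈ T) :
    3 * lap G F x = -(F x * scal G x + 4) := by
  have := congrArg (evalAt ⟨x, hx⟩) (LeviCivita.three_lap h.miaoTamEq)
  simpa only [map_mul, map_neg, map_add, map_ofNat, rep_iff.1 h.rep_fn,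
    rep_iff.1 (rep_lap h.dom h.metric h.rep_fn), rep_iff.1 (rep_scal h.dom h.metric)] using this

lemma ric_symm (hT : IsCoordDomain T) (hG : IsMetricOn T G) (hx : x ∈ T) (i j : Fin 4) :
    ric G i j x = ric G j i x := by
  have := congrArg (evalAt ⟨x, hx⟩) ((geom hT hG).ric_symm i j)
  simpa only [rep_iff.1 (rep_ric hT hG _ _)] using this

lemma div_weylPlusT (h : IsMiaoTamChart T G F) (j k l : Fin 4) :
    h.conn.div (h.conn.weylPlusT (sqrtDet h.metric)) j k l = 0 := by
  refine ext_evalAt fun x => ?_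
  rw [map_zero, rep_iff.1 (rep_div h.dom h.metric (rep_weylPlus h.dom h.metric) j k l) x,
    h.div_weylPlus x x.2 j k l]

/-- The gradient is an eigenvector of the Ricci tensor. -/
lemma exists_eigen (h : IsMiaoTamChart T G F) (hx : x ∈ T) (hreg : ∃ i, pd i F x ≠ 0) :
    ∃ μ : ℝ, ∀ X, ricAt G x (grad G F x) X = μ * gAt G x (grad G F x) X := by
  have hq := h.metric.pairIn_pos hx hreg
  set r := ∑ i, grad G F x i * ∑ k, grad G F x k * ric G i k x
  have h1 : ∀ j, pairIn G F F x * ∑ k, grad G F x k * ric G j k x = r * pd j F x := by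
    intro j
    have := congrArg (evalAt ⟨x, hx⟩) (LeviCivita.ricGrad_eigen h.miaoTamEq h.d_scal
      (sqrtDet_mul_self h.dom h.metric) h.div_weylPlusT j)
    simpa only [map_mul, map_sum, LeviCivita.ricGrad,
      rep_iff.1 (rep_pair h.dom h.metric h.rep_fn h.rep_fn),
      rep_iff.1 (rep_grad h.dom h.metric h.rep_fn _), rep_iff.1 (rep_ric h.dom h.metric _ _),
      rep_iff.1 (rep_d h.dom h.metric h.rep_fn _)] using this
  refine ⟨r / pairIn G F F x, fun X => ?_⟩
  rw [h.metric.gAt_grad hx, div_mul_eq_mul_div, eq_div_iff hq.ne', ricAt, Finset.sum_comm,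
    Finset.mul_sum, Finset.sum_mul]
  refine Finset.sum_congr rfl fun j _ => ?_
  rw [← mul_assoc, ← h1 j, Finset.sum_mul, Finset.mul_sum, Finset.sum_mul]
  exact Finset.sum_congr rfl fun k _ => by rw [ric_symm h.dom h.metric hx k j]; ring

lemma ricAt_normal (h : IsMiaoTamChart T G F) (hx : x ∈ T) (hreg : ∃ i, pd i F x ≠ 0)
    (X : Fin 4 → ℝ) : ricAt G x (normal G F x) X
      = ricAt G x (normal G F x) (normal G F x) * gAt G x (normal G F x) X := by
  obtain ⟨μ, hμ⟩ := h.exists_eigen hx hreg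
  have e : normal G F x = (gradNorm G F x)⁻¹ • grad G F x := by
    ext k; simp [normal, div_eq_inv_mul]
  have h1 : ∀ X, ricAt G x (normal G F x) X = μ * gAt G x (normal G F x) X := fun X => by
    have h2 : ricAt G x (normal G F x) X = (gradNorm G F x)⁻¹ * ricAt G x (grad G F x) X := by
      rw [e]; exact bil_smul_left _ _ _ _
    have h3 : gAt G x (normal G F x) X = (gradNorm G F x)⁻¹ * gAt G x (grad G F x) X := by
      rw [e]; exact bil_smul_left _ _ _ _
    rw [h2, h3, hμ]; ring
  rw [h1 (normal G F x), h.metric.gAt_normal_normal hx hreg, h1 X]; ring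

variable {e : Fin 4 → Fin 4 → ℝ}

lemma ricAt_last (h : IsMiaoTamChart T G F) (hx : x ∈ T) (hreg : ∃ i, pd i F x ≠ 0)
    (he : IsAdaptedFrame G F x e) (a : Fin 3) : ricAt G x (e 3) (e a.castSucc) = 0 := by
  rw [he.last_eq, h.ricAt_normal hx hreg,
    (h.metric.gAt_normal_eq_zero_iff hx hreg _).mpr (he.tangent h.metric hx hreg a), mul_zero]

lemma secondFF_eq (h : IsMiaoTamChart T G F) (hx : x ∈ T) (hreg : ∃ i, pd i F x ≠ 0)
    (X : Fin 4 → ℝ) {Y : Fin 4 → ℝ} (hY : IsTangentToLevel F x Y) : secondFF G F x X Y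
      = ((1 + lap G F x) * gAt G x X Y + F x * ricAt G x X Y) / gradNorm G F x := by
  rw [MiaoTam.secondFF_eq h.dom h.metric h.smooth hx hreg X hY]
  congr 1
  simp only [gAt, ricAt, bil, Finset.mul_sum, ← Finset.sum_add_distrib]
  exact Finset.sum_congr rfl fun i _ => Finset.sum_congr rfl fun j _ => by rw [h.hess_eq hx]; ring

lemma scal_eq (he : IsAdaptedFrame G F x e) :
    scal G x = ∑ a, ricAt G x (e a) (e a) := he.orthonormal4.trace _

lemma ricNormSq_eq (he : IsAdaptedFrame G F x e) :
    ricNormSq G x = ∑ a, ∑ b, ricAt G x (e a) (e b) ^ 2 := he.orthonormal4.normSq _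

lemma meanCurv_eq (h : IsMiaoTamChart T G F) (hx : x ∈ T) (hreg : ∃ i, pd i F x ≠ 0)
    (he : IsAdaptedFrame G F x e) : meanCurv G F x
      = (3 * (1 + lap G F x) + F x * (scal G x - ricAt G x (e 3) (e 3))) / gradNorm G F x := by
  rw [he.meanCurv_eq]
  have := fun a : Fin 3 => h.secondFF_eq hx hreg (e a.castSucc) (he.tangent h.metric hx hreg a)
  simp only [this, he.orthonormal, if_true, ← Finset.sum_div, scal_eq he,
    Fin.sum_univ_castSucc (n := 3), Finset.sum_add_distrib, ← Finset.mul_sum]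
  congr 1
  simp
  ring

/-- `3|Ric|² - 3R₄₄² - (R - R₄₄)²` is a sum of squares, which measures how far the Ricci tensor is
from a multiple of the metric on the level set. -/
lemma ricci_defect (h : IsMiaoTamChart T G F) (hx : x ∈ T) (hreg : ∃ i, pd i F x ≠ 0)
    (he : IsAdaptedFrame G F x e) :
    3 * ricNormSq G x - (3 * ricAt G x (e 3) (e 3) ^ 2 + (scal G x - ricAt G x (e 3) (e 3)) ^ 2)
      = (ricAt G x (e 0) (e 0) - ricAt G x (e 1) (e 1)) ^ 2
        + (ricAt G x (e 0) (e 0) - ricAt G x (e 2) (e 2)) ^ 2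
        + (ricAt G x (e 1) (e 1) - ricAt G x (e 2) (e 2)) ^ 2
        + 6 * (ricAt G x (e 0) (e 1) ^ 2 + ricAt G x (e 0) (e 2) ^ 2
          + ricAt G x (e 1) (e 2) ^ 2) := by
  have hs : ∀ X Y, ricAt G x X Y = ricAt G x Y X :=
    bil_symm fun i j => ric_symm h.dom h.metric hx i j
  have h0 := h.ricAt_last hx hreg he
  have h00 : ricAt G x (e 3) (e 0) = 0 := h0 0
  have h01 : ricAt G x (e 3) (e 1) = 0 := h0 1
  have h02 : ricAt G x (e 3) (e 2) = 0 := h0 2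
  rw [scal_eq he, ricNormSq_eq he]
  simp only [Fin.sum_univ_four]
  rw [hs (e 1) (e 0), hs (e 2) (e 0), hs (e 2) (e 1), hs (e 0) (e 3), hs (e 1) (e 3),
    hs (e 2) (e 3), h00, h01, h02]
  ring

lemma ricci_ineq (h : IsMiaoTamChart T G F) (hx : x ∈ T) (hreg : ∃ i, pd i F x ≠ 0)
    (he : IsAdaptedFrame G F x e) :
    3 * ricAt G x (e 3) (e 3) ^ 2 + (scal G x - ricAt G x (e 3) (e 3)) ^ 2
      ≤ 3 * ricNormSq G x := by
  have := h.ricci_defect hx hreg he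
  have h2 : (0 : ℝ) ≤ 3 * ricNormSq G x - (3 * ricAt G x (e 3) (e 3) ^ 2
    + (scal G x - ricAt G x (e 3) (e 3)) ^ 2) := by rw [this]; positivity
  linarith

/-- The Ricci equality, in coordinates. -/
def RicciEqualityIn (G : E4 → Matrix (Fin 4) (Fin 4) ℝ) (F : E4 → ℝ) (x : E4) : Prop :=
  3 * ricNormSq G x = 3 * ricAt G x (normal G F x) (normal G F x) ^ 2
    + (scal G x - ricAt G x (normal G F x) (normal G F x)) ^ 2

/-- Equality holds exactly if the Ricci tensor is a multiple of the metric on the level set. -/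
lemma ricciEquality_iff (h : IsMiaoTamChart T G F) (hx : x ∈ T) (hreg : ∃ i, pd i F x ≠ 0)
    (he : IsAdaptedFrame G F x e) : RicciEqualityIn G F x ↔
      ∃ ν : ℝ, ∀ a b : Fin 3, ricAt G x (e a.castSucc) (e b.castSucc) = if a = b then ν else 0 := by
  have hs : ∀ X Y, ricAt G x X Y = ricAt G x Y X :=
    bil_symm fun i j => ric_symm h.dom h.metric hx i j
  have hd := h.ricci_defect hx hreg he
  rw [RicciEqualityIn, ← he.last_eq, ← sub_eq_zero, hd]
  constructor
  · intro h0
    have key : ∀ a b c d f g : ℝ, a ^ 2 + b ^ 2 + c ^ 2 + 6 * (d ^ 2 + f ^ 2 + g ^ 2) = 0 →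
        a = 0 ∧ b = 0 ∧ d = 0 ∧ f = 0 ∧ g = 0 := by
      intro a b c d f g h
      have := sq_nonneg a
      have := sq_nonneg b
      have := sq_nonneg c
      have := sq_nonneg d
      have := sq_nonneg f
      have := sq_nonneg g
      refine ⟨?_, ?_, ?_, ?_, ?_⟩ <;> refine (pow_eq_zero_iff two_ne_zero).mp ?_ <;> linarith
    obtain ⟨h1, h2, h3, h4, h5⟩ := key _ _ _ _ _ _ h0
    refine ⟨ricAt G x (e 0) (e 0), fun a b => ?_⟩
    fin_cases a <;> fin_cases b
    · rfl
    · exact h3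
    · exact h4
    · exact (hs _ _).trans h3
    · exact (sub_eq_zero.mp h1).symm
    · exact h5
    · exact (hs _ _).trans h4
    · exact (hs _ _).trans h5
    · exact (sub_eq_zero.mp h2).symm
  · rintro ⟨ν, hν⟩
    have e00 : ricAt G x (e 0) (e 0) = ν := hν 0 0
    have e11 : ricAt G x (e 1) (e 1) = ν := hν 1 1
    have e22 : ricAt G x (e 2) (e 2) = ν := hν 2 2
    have e01 : ricAt G x (e 0) (e 1) = 0 := hν 0 1
    have e02 : ricAt G x (e 0) (e 2) = 0 := hν 0 2
    have e12 : ricAt G x (e 1) (e 2) = 0 := hν 1 2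
    rw [e00, e11, e22, e01, e02, e12]; ring

end IsMiaoTamChart

/-! ### Umbilical level sets -/

section
variable {T : Set E4} {G : E4 → Matrix (Fin 4) (Fin 4) ℝ} {F : E4 → ℝ} {x : E4}
  {e : Fin 4 → Fin 4 → ℝ}

lemma isUmbilicIn_iff (hG : IsMetricOn T G) (hx : x ∈ T) (hreg : ∃ i, pd i F x ≠ 0)
    (he : IsAdaptedFrame G F x e) : IsUmbilicIn G F x ↔ ∃ κ : ℝ, ∀ a b : Fin 3,
      secondFF G F x (e a.castSucc) (e b.castSucc) = if a = b then κ else 0 := by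
  constructor
  · rintro ⟨κ, hκ⟩
    refine ⟨κ, fun a b => ?_⟩
    rw [hκ _ _ (he.tangent hG hx hreg a) (he.tangent hG hx hreg b), he.orthonormal]
    simp
  · rintro ⟨κ, hκ⟩
    refine ⟨κ, fun X Y hX hY => ?_⟩
    have h1 := he.bil_tangent hG hx hreg (G x) hX hY
    rw [secondFF_eq_bil, he.bil_tangent hG hx hreg _ hX hY,
      show gAt G x X Y = _ from h1, Finset.mul_sum]
    refine Finset.sum_congr rfl fun a _ => ?_
    rw [Finset.mul_sum]
    refine Finset.sum_congr rfl fun b _ => ?_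
    rw [← secondFF_eq_bil, hκ, show bil (G x) (e a.castSucc) (e b.castSucc) = _ from
      he.orthonormal _ _]
    simp only [Fin.castSucc_inj]
    split_ifs <;> ring

/-- At an umbilical point the mean curvature is three times the principal curvature. -/
lemma meanCurv_eq_three_mul (hG : IsMetricOn T G) (hx : x ∈ T) (hreg : ∃ i, pd i F x ≠ 0)
    {κ : ℝ} (hκ : ∀ X Y : Fin 4 → ℝ, IsTangentToLevel F x X → IsTangentToLevel F x Y →
      secondFF G F x X Y = κ * gAt G x X Y) : meanCurv G F x = 3 * κ := by
  obtain ⟨e, he⟩ := hG.exists_adaptedFrame hx hreg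
  rw [he.meanCurv_eq]
  have := fun a : Fin 3 => hκ _ _ (he.tangent hG hx hreg a) (he.tangent hG hx hreg a)
  simp only [this, he.orthonormal, if_true, mul_one, Finset.sum_const, Finset.card_univ,
    Fintype.card_fin, nsmul_eq_mul, Nat.cast_ofNat]

end

namespace IsMiaoTamChart

variable {T : Set E4} {G : E4 → Matrix (Fin 4) (Fin 4) ℝ} {F : E4 → ℝ} {x : E4}

lemma isUmbilicIn_of_ricciEquality (h : IsMiaoTamChart T G F) (hx : x ∈ T)
    (hreg : ∃ i, pd i F x ≠ 0) (heq : RicciEqualityIn G F x) : IsUmbilicIn G F x := by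
  obtain ⟨e, he⟩ := h.metric.exists_adaptedFrame hx hreg
  obtain ⟨ν, hν⟩ := (h.ricciEquality_iff hx hreg he).mp heq
  refine (isUmbilicIn_iff h.metric hx hreg he).mpr
    ⟨((1 + lap G F x) + F x * ν) / gradNorm G F x, fun a b => ?_⟩
  rw [h.secondFF_eq hx hreg _ (he.tangent h.metric hx hreg b), hν, he.orthonormal]
  simp only [Fin.castSucc_inj]
  split_ifs <;> simp

lemma ricciEquality_of_isUmbilicIn (h : IsMiaoTamChart T G F) (hx : x ∈ T)
    (hreg : ∃ i, pd i F x ≠ 0) (h0 : F x ≠ 0) (hu : IsUmbilicIn G F x) :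
    RicciEqualityIn G F x := by
  obtain ⟨e, he⟩ := h.metric.exists_adaptedFrame hx hreg
  obtain ⟨κ, hκ⟩ := (isUmbilicIn_iff h.metric hx hreg he).mp hu
  have hn := (h.metric.gradNorm_pos hx hreg).ne'
  refine (h.ricciEquality_iff hx hreg he).mpr
    ⟨(κ * gradNorm G F x - (1 + lap G F x)) / F x, fun a b => ?_⟩
  have h1 := hκ a b
  rw [h.secondFF_eq hx hreg _ (he.tangent h.metric hx hreg b), he.orthonormal,
    div_eq_iff hn] at h1
  simp only [Fin.castSucc_inj] at h1
  split_ifs at h1 ⊢ with hab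
  · rw [eq_div_iff h0]; linarith
  · have : F x * ricAt G x (e a.castSucc) (e b.castSucc) = 0 := by linarith
    exact (mul_eq_zero.mp this).resolve_left h0

lemma ricAt_normal_normal (hG : IsMetricOn T G) (hx : x ∈ T) (hreg : ∃ i, pd i F x ≠ 0) :
    ricAt G x (normal G F x) (normal G F x)
      = ricAt G x (grad G F x) (grad G F x) / pairIn G F F x := by
  have e : normal G F x = (gradNorm G F x)⁻¹ • grad G F x := by
    ext k; simp [normal, div_eq_inv_mul]
  have hn := (hG.gradNorm_pos hx hreg).ne'
  have h2 : ricAt G x (normal G F x) (normal G F x)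
      = (gradNorm G F x)⁻¹ * ((gradNorm G F x)⁻¹ * ricAt G x (grad G F x) (grad G F x)) := by
    rw [e]; exact (bil_smul_left _ _ _ _).trans (congrArg _ (bil_smul_right _ _ _ _))
  rw [h2, ← hG.gradNorm_sq hx]
  field_simp

/-- If the level sets near `x` are umbilical, equality holds at `x`, even if `F x = 0`: it holds on
the dense set of points with `F ≠ 0`. -/
lemma ricciEquality_of_eventually (h : IsMiaoTamChart T G F) (hx : x ∈ T)
    (hreg : ∃ i, pd i F x ≠ 0)
    (hu : ∀ᶠ y in 𝓝[T] x, (∃ i, pd i F y ≠ 0) → IsUmbilicIn G F y) : RicciEqualityIn G F x := by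
  have hric : ∀ i j, ContinuousOn (ric G i j) T := fun i j =>
    (rep_ric h.dom h.metric i j).contDiffOn.continuousOn
  have hgi : ∀ i j, ContinuousOn (fun y => ginv G y i j) T := fun i j =>
    (h.metric.contDiffOn_ginv i j).continuousOn
  have hgr : ∀ k, ContinuousOn (fun y => grad G F y k) T := fun k =>
    (rep_grad h.dom h.metric h.rep_fn k).contDiffOn.continuousOn
  have hsc : ContinuousOn (scal G) T := (rep_scal h.dom h.metric).contDiffOn.continuousOn
  have hq : ContinuousOn (pairIn G F F) T :=
    (h.metric.contDiffOn_pairIn h.dom h.smooth h.smooth).continuousOn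
  have hr : ContinuousOn (fun y => ricAt G y (grad G F y) (grad G F y)) T :=
    continuousOn_finsetSum _ fun i _ => continuousOn_finsetSum _ fun j _ =>
      ((hric i j).mul (hgr i)).mul (hgr j)
  have hns : ContinuousOn (ricNormSq G) T :=
    continuousOn_finsetSum _ fun i _ => continuousOn_finsetSum _ fun j _ =>
      continuousOn_finsetSum _ fun k _ => continuousOn_finsetSum _ fun l _ =>
        (((hgi i k).mul (hgi j l)).mul (hric i j)).mul (hric k l)
  have hq0 := (h.metric.pairIn_pos hx hreg).ne'
  have hreg' : ∀ y ∈ T, pairIn G F F y ≠ 0 → ∃ i, pd i F y ≠ 0 := fun y _ hy => by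
    by_contra hc
    push Not at hc
    exact hy (by simp [pairIn, hc])
  set δ : E4 → ℝ := fun y => 3 * ricNormSq G y
    - (3 * (ricAt G y (grad G F y) (grad G F y) / pairIn G F F y) ^ 2
      + (scal G y - ricAt G y (grad G F y) (grad G F y) / pairIn G F F y) ^ 2) with hδ
  have hδc : ContinuousWithinAt δ T x := by
    have hd := (hr x hx).div (hq x hx) hq0
    exact (continuousWithinAt_const.mul (hns x hx)).sub
      ((continuousWithinAt_const.mul (hd.pow 2)).add (((hsc x hx).sub hd).pow 2))
  have hiff : ∀ y ∈ T, (∃ i, pd i F y ≠ 0) → (RicciEqualityIn G F y ↔ δ y = 0) := by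
    intro y hy hyr
    rw [RicciEqualityIn, ricAt_normal_normal h.metric hy hyr, hδ, ← sub_eq_zero]
  rw [hiff x hx hreg]
  by_contra hne
  refine h.not_zero_near hx ?_
  filter_upwards [hδc.eventually_ne hne, (hq x hx).eventually_ne hq0, hu, self_mem_nhdsWithin]
    with y h1 h2 h3 hy
  by_contra hF
  have hyr := hreg' y hy h2
  exact h1 ((hiff y hy hyr).mp (h.ricciEquality_of_isUmbilicIn hy hyr hF (h3 hyr)))

end IsMiaoTamChart

/-! ### Trilinear forms -/

lemma sum_comm_pairs {ι A : Type*} [Fintype ι] [AddCommMonoid A] (u : ι → ι → ι → ι → A) :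
    ∑ j, ∑ k, ∑ i, ∑ n, u j k i n = ∑ i, ∑ n, ∑ j, ∑ k, u j k i n := by
  have h := Finset.sum_comm (s := (Finset.univ : Finset (ι × ι)))
    (t := (Finset.univ : Finset (ι × ι))) (f := fun a b => u a.1 a.2 b.1 b.2)
  simpa only [Fintype.sum_prod_type] using h

/-- The trilinear form with the components `S`. -/
def tri (S : Fin 4 → Fin 4 → Fin 4 → ℝ) (X Y Z : Fin 4 → ℝ) : ℝ :=
  ∑ i, X i * bil (S i) Y Z

lemma bil_add (S U : Fin 4 → Fin 4 → ℝ) (X Y : Fin 4 → ℝ) :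
    bil (fun i j => S i j + U i j) X Y = bil S X Y + bil U X Y := by
  simp only [bil, ← Finset.sum_add_distrib, add_mul]

lemma bil_sub (S U : Fin 4 → Fin 4 → ℝ) (X Y : Fin 4 → ℝ) :
    bil (fun i j => S i j - U i j) X Y = bil S X Y - bil U X Y := by
  simp only [bil, ← Finset.sum_sub_distrib, sub_mul]

lemma bil_mul (r : ℝ) (S : Fin 4 → Fin 4 → ℝ) (X Y : Fin 4 → ℝ) :
    bil (fun i j => r * S i j) X Y = r * bil S X Y := by
  simp only [bil, Finset.mul_sum, mul_assoc]

lemma bil_prod (u v X Y : Fin 4 → ℝ) :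
    bil (fun i j => u i * v j) X Y = (∑ i, u i * X i) * ∑ j, v j * Y j := by
  rw [Finset.sum_mul_sum, bil]
  exact Finset.sum_congr rfl fun i _ => Finset.sum_congr rfl fun j _ => by ring

lemma tri_add (S U : Fin 4 → Fin 4 → Fin 4 → ℝ) (X Y Z : Fin 4 → ℝ) :
    tri (fun i j k => S i j k + U i j k) X Y Z = tri S X Y Z + tri U X Y Z := by
  simp only [tri, bil_add, mul_add, Finset.sum_add_distrib]

lemma tri_sub (S U : Fin 4 → Fin 4 → Fin 4 → ℝ) (X Y Z : Fin 4 → ℝ) :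
    tri (fun i j k => S i j k - U i j k) X Y Z = tri S X Y Z - tri U X Y Z := by
  simp only [tri, bil_sub, mul_sub, Finset.sum_sub_distrib]

lemma tri_mul (r : ℝ) (S : Fin 4 → Fin 4 → Fin 4 → ℝ) (X Y Z : Fin 4 → ℝ) :
    tri (fun i j k => r * S i j k) X Y Z = r * tri S X Y Z := by
  simp only [tri, bil_mul, Finset.mul_sum, mul_left_comm r]

lemma tri_fst (u : Fin 4 → ℝ) (S : Fin 4 → Fin 4 → ℝ) (X Y Z : Fin 4 → ℝ) :
    tri (fun i j k => u i * S j k) X Y Z = (∑ i, u i * X i) * bil S Y Z := by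
  simp only [tri, bil_mul, Finset.sum_mul]
  exact Finset.sum_congr rfl fun i _ => by ring

lemma tri_snd (u : Fin 4 → ℝ) (S : Fin 4 → Fin 4 → ℝ) (X Y Z : Fin 4 → ℝ) :
    tri (fun i j k => u j * S i k) X Y Z = (∑ j, u j * Y j) * bil S X Z := by
  simp only [tri, bil_prod u, mul_left_comm (X _), ← Finset.mul_sum]
  congr 1
  simp only [bil, Finset.mul_sum]
  exact Finset.sum_congr rfl fun i _ => Finset.sum_congr rfl fun j _ => by ring

lemma tri_trd (u : Fin 4 → ℝ) (S : Fin 4 → Fin 4 → ℝ) (X Y Z : Fin 4 → ℝ) :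
    tri (fun i j k => u k * S i j) X Y Z = (∑ k, u k * Z k) * bil S X Y := by
  simp only [tri, mul_comm (u _), bil_prod _ u, ← mul_assoc, ← Finset.sum_mul]
  rw [mul_comm]
  congr 1
  simp only [bil, Finset.mul_sum]
  exact Finset.sum_congr rfl fun i _ => Finset.sum_congr rfl fun j _ => by ring

lemma tri_swap12 (S : Fin 4 → Fin 4 → Fin 4 → ℝ) (X Y Z : Fin 4 → ℝ) :
    tri (fun i j k => S j i k) X Y Z = tri S Y X Z := by
  simp only [tri, bil, Finset.mul_sum]
  rw [Finset.sum_comm]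
  exact Finset.sum_congr rfl fun i _ => Finset.sum_congr rfl fun j _ =>
    Finset.sum_congr rfl fun k _ => by ring

lemma tri_swap23 (S : Fin 4 → Fin 4 → Fin 4 → ℝ) (X Y Z : Fin 4 → ℝ) :
    tri (fun i j k => S i k j) X Y Z = tri S X Z Y := by
  simp only [tri, bil]
  refine Finset.sum_congr rfl fun i _ => ?_
  rw [Finset.sum_comm]
  congr 1
  exact Finset.sum_congr rfl fun j _ => Finset.sum_congr rfl fun k _ => by ring

namespace LeviCivita

variable {A : Type*} [CommRing A] [Algebra ℝ A] (D : LeviCivita A)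

lemma cov2_sub (S U : Fin 4 → Fin 4 → A) (m i j : Fin 4) :
    D.cov2 (fun i j => S i j - U i j) m i j = D.cov2 S m i j - D.cov2 U m i j := by
  simp only [cov2, map_sub, mul_sub, Finset.sum_add_distrib, Finset.sum_sub_distrib]; ring

lemma cov2_mul (a : A) (S : Fin 4 → Fin 4 → A) (m i j : Fin 4) :
    D.cov2 (fun i j => a * S i j) m i j = D.d m a * S i j + a * D.cov2 S m i j := by
  simp only [cov2, Derivation.leibniz, smul_eq_mul, mul_sub, Finset.mul_sum,
    Finset.sum_add_distrib, mul_add, mul_left_comm a]; ring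

lemma cov2_d_mul_d (f : A) (m i j : Fin 4) : D.cov2 (fun i j => D.d i f * D.d j f) m i j
    = D.hessT f m i * D.d j f + D.d i f * D.hessT f m j := by
  simp only [cov2, hessT, Derivation.leibniz, smul_eq_mul, Finset.sum_add_distrib, sub_mul, mul_sub,
    Finset.sum_mul, Finset.mul_sum, mul_left_comm (D.d i f), ← mul_assoc]
  ring

/-- With `q = |∇f|²` and `r = Ric(∇f, ∇f)`, the trace-free part, up to the factor `3q²`, of the
Ricci tensor on the level sets of `f`, if `∇f` is an eigenvector of the Ricci tensor. -/
def levelDefect (f r : A) (i j : Fin 4) : A :=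
  3 * D.pair f f ^ 2 * D.ric i j - D.pair f f * (D.pair f f * D.scal - r) * D.G i j
    - (4 * r - D.pair f f * D.scal) * (D.d i f * D.d j f)

lemma cov2_levelDefect (f r : A) (hR : ∀ m, D.d m D.scal = 0) (m i j : Fin 4) :
    D.cov2 (D.levelDefect f r) m i j = 3 * D.pair f f ^ 2 * D.cov2 D.ric m i j
      + D.d m (D.pair f f) * (6 * D.pair f f * D.ric i j
        - (2 * D.pair f f * D.scal - r) * D.G i j + D.scal * (D.d i f * D.d j f))
      + D.d m r * (D.pair f f * D.G i j) - D.d m r * (4 * (D.d i f * D.d j f))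
      - (4 * r - D.pair f f * D.scal) * (D.d j f * D.hessT f m i)
      - (4 * r - D.pair f f * D.scal) * (D.d i f * D.hessT f m j) := by
  have h3 : D.d m (3 : A) = 0 := by simpa using (D.d m).map_natCast 3
  have h4 : D.d m (4 : A) = 0 := by simpa using (D.d m).map_natCast 4
  have e : D.levelDefect f r = fun i j => (3 * D.pair f f ^ 2 * D.ric i j
      - D.pair f f * (D.pair f f * D.scal - r) * D.G i j)
      - (4 * r - D.pair f f * D.scal) * (D.d i f * D.d j f) := rfl
  rw [e, cov2_sub, cov2_sub, cov2_mul, cov2_mul D (4 * r - D.pair f f * D.scal), cov2_d_mul_d,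
    show D.cov2 (fun i j => D.pair f f * (D.pair f f * D.scal - r) * D.G i j) m i j = _ from
      D.cov2_mul _ D.G m i j, cov2_G]
  generalize D.pair f f = q
  simp only [map_sub, Derivation.leibniz, Derivation.leibniz_pow, h3, h4, hR, smul_eq_mul,
    nsmul_eq_mul]
  push_cast
  ring

end LeviCivita

/-! ### The Codazzi equation and the mixed curvature of umbilical level sets -/

namespace IsMiaoTamChart

variable {T : Set E4} {G : E4 → Matrix (Fin 4) (Fin 4) ℝ} {F : E4 → ℝ} {x : E4}
  {e : Fin 4 → Fin 4 → ℝ}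

/-- The curvature component `R(X, Y, ∇F, Z)`. -/
def riemGrad (G : E4 → Matrix (Fin 4) (Fin 4) ℝ) (F : E4 → ℝ) (x : E4) (X Y Z : Fin 4 → ℝ) : ℝ :=
  tri (fun i j k => ∑ n, riem G i j n k x * grad G F x n) X Y Z

/-- `(∇_X Ric)(Y, Z)`. -/
def covRic (h : IsMiaoTamChart T G F) (hx : x ∈ T) (X Y Z : Fin 4 → ℝ) : ℝ :=
  tri (fun i j k => evalAt ⟨x, hx⟩ (h.conn.cov2 h.conn.ric i j k)) X Y Z

/-- The Codazzi equation of the level sets, for a solution of the Miao–Tam equation. -/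
lemma codazzi (h : IsMiaoTamChart T G F) (hx : x ∈ T) {X Y Z : Fin 4 → ℝ}
    (hX : IsTangentToLevel F x X) (hY : IsTangentToLevel F x Y) :
    F x * (h.covRic hx X Z Y - h.covRic hx Y Z X) = - riemGrad G F x X Y Z := by
  have h1 : ∀ i j k, F x * (evalAt ⟨x, hx⟩ (h.conn.cov2 h.conn.ric i k j)
      - evalAt ⟨x, hx⟩ (h.conn.cov2 h.conn.ric j k i))
      + pd i F x * (ric G j k x + -(scal G x / 3) * G x j k)
      - pd j F x * (ric G i k x + -(scal G x / 3) * G x i k)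
      = -1 * ∑ n, riem G i j n k x * grad G F x n := by
    intro i j k
    have h2 := congrArg (evalAt ⟨x, hx⟩) (LeviCivita.cotton_eq h.miaoTamEq i j k)
    have h3 := fun i => congrArg (evalAt ⟨x, hx⟩) (LeviCivita.three_d_lap h.miaoTamEq i)
    have h4 := fun i => rep_iff.1 (rep_d h.dom h.metric h.rep_fn i) ⟨x, hx⟩
    have h5 := rep_iff.1 (rep_scal h.dom h.metric) ⟨x, hx⟩
    simp only [map_mul, map_neg, map_add, map_sub, map_sum, map_ofNat, h.d_scal, mul_zero,
      zero_add, h4, h5, LeviCivita.cotton, eval_G, rep_iff.1 h.rep_fn,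
      rep_iff.1 (rep_ric h.dom h.metric _ _), rep_iff.1 (rep_riem h.dom h.metric _ _ _ _),
      rep_iff.1 (rep_grad h.dom h.metric h.rep_fn _)] at h2 h3
    linear_combination h2 - (1 / 3) * G x j k * h3 i + (1 / 3) * G x i k * h3 j
  have h6 := congrArg (fun S : Fin 4 → Fin 4 → Fin 4 → ℝ => tri S X Y Z)
    (funext fun i => funext fun j => funext fun k => h1 i j k)
  beta_reduce at h6
  have hX' : ∑ i, pd i F x * X i = 0 := hX
  have hY' : ∑ i, pd i F x * Y i = 0 := hY
  rw [tri_sub, tri_add, tri_mul, tri_mul, tri_sub,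
    tri_fst (fun i => pd i F x) (fun j k => ric G j k x + -(scal G x / 3) * G x j k),
    tri_snd (fun i => pd i F x) (fun j k => ric G j k x + -(scal G x / 3) * G x j k), hX', hY',
    zero_mul, zero_mul, add_zero, sub_zero,
    tri_swap23 (fun i j k => evalAt ⟨x, hx⟩ (h.conn.cov2 h.conn.ric i j k))] at h6
  have e2 : tri (fun i j k => evalAt ⟨x, hx⟩ (h.conn.cov2 h.conn.ric j k i)) X Y Z
      = h.covRic hx Y Z X := by
    rw [tri_swap12 (fun i j k => evalAt ⟨x, hx⟩ (h.conn.cov2 h.conn.ric i k j)),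
      tri_swap23 (fun i j k => evalAt ⟨x, hx⟩ (h.conn.cov2 h.conn.ric i j k))]
    rfl
  rw [e2] at h6
  rw [riemGrad, ← neg_one_mul, ← h6]
  rfl

lemma covRic_symm (h : IsMiaoTamChart T G F) (hx : x ∈ T) (X Y Z : Fin 4 → ℝ) :
    h.covRic hx X Y Z = h.covRic hx X Z Y := by
  rw [covRic, covRic, ← tri_swap23]
  congr 1
  ext i j k
  rw [h.conn.cov2_symm h.conn.ric_symm]

/-- The partial trace of `R(X, ·, ∇F, ·)` over the level set vanishes. -/
lemma sum_riemGrad (h : IsMiaoTamChart T G F) (hx : x ∈ T) (hreg : ∃ i, pd i F x ≠ 0)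
    (he : IsAdaptedFrame G F x e) {X : Fin 4 → ℝ} (hX : IsTangentToLevel F x X) :
    ∑ b : Fin 3, riemGrad G F x X (e b.castSucc) (e b.castSucc) = 0 := by
  have hn := (h.metric.gradNorm_pos hx hreg).ne'
  have hanti : ∀ i j n k, riem G i j n k x = - riem G i j k n x := fun i j n k => by
    have := congrArg (evalAt ⟨x, hx⟩) (h.conn.riem_swap34 i j n k)
    simpa only [map_neg, rep_iff.1 (rep_riem h.dom h.metric _ _ _ _)] using this
  set S : Fin 4 → Fin 4 → ℝ := fun j k => ∑ i, X i * ∑ n, riem G i j n k x * grad G F x n with hS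
  have hSb : ∀ Y Z, riemGrad G F x X Y Z = bil S Y Z := by
    intro Y Z
    simp only [riemGrad, tri, bil, hS, Finset.mul_sum, Finset.sum_mul]
    rw [Finset.sum_comm]
    refine Finset.sum_congr rfl fun j _ => ?_
    rw [Finset.sum_comm]
    refine Finset.sum_congr rfl fun k _ => Finset.sum_congr rfl fun i _ =>
      Finset.sum_congr rfl fun n _ => by ring
  have h3 : bil S (e 3) (e 3) = 0 := by
    have hzero : ∀ i j, ∑ k, grad G F x k * ∑ n, riem G i j n k x * grad G F x n = 0 := by
      intro i j
      rw [← LeviCivita.sum_antisymm (A := ℝ) (v := grad G F x) (fun k n => hanti i j n k)]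
      exact Finset.sum_congr rfl fun k _ => by
        rw [Finset.mul_sum]; exact Finset.sum_congr rfl fun n _ => by ring
    have : ∀ j, ∑ k, S j k * e 3 k = 0 := by
      intro j
      have e1 : ∑ k, S j k * e 3 k = ∑ i, X i * ((gradNorm G F x)⁻¹ *
          ∑ k, grad G F x k * ∑ n, riem G i j n k x * grad G F x n) := by
        simp only [hS, Finset.sum_mul, Finset.mul_sum]
        rw [Finset.sum_comm]
        refine Finset.sum_congr rfl fun i _ => Finset.sum_congr rfl fun k _ =>
          Finset.sum_congr rfl fun n _ => ?_
        rw [he.last_eq, normal]; ring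
      rw [e1]
      simp [hzero]
    rw [bil]
    refine Finset.sum_eq_zero fun j _ => ?_
    rw [← mul_zero (e 3 j), ← this j, Finset.mul_sum]
    exact Finset.sum_congr rfl fun k _ => by ring
  have h4 : ∑ b, bil S (e b) (e b) = ricAt G x (grad G F x) X := by
    rw [← he.orthonormal4.trace S]
    simp only [hS, Finset.mul_sum]
    rw [sum_comm_pairs, ricAt, Finset.sum_comm]
    refine Finset.sum_congr rfl fun n _ => Finset.sum_congr rfl fun i _ => ?_
    rw [ric_symm h.dom h.metric hx n i, ric, Finset.sum_mul, Finset.sum_mul]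
    refine Finset.sum_congr rfl fun j _ => ?_
    rw [Finset.sum_mul, Finset.sum_mul]
    exact Finset.sum_congr rfl fun k _ => by rw [ginv]; ring
  rw [Fin.sum_univ_castSucc (n := 3), show Fin.last 3 = 3 from rfl, h3, add_zero] at h4
  simp only [hSb, h4]
  obtain ⟨μ, hμ⟩ := h.exists_eigen hx hreg
  rw [hμ, h.metric.gAt_grad hx, show ∑ i, pd i F x * X i = 0 from hX, mul_zero]

/-- The function `Ric(∇F, ∇F)`. -/
def ricGradFn (h : IsMiaoTamChart T G F) : smoothRing T :=
  ∑ i, h.conn.gradT h.fn i * h.conn.ricGrad h.fn i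

lemma eval_ricGradFn (h : IsMiaoTamChart T G F) (y : T) :
    evalAt y h.ricGradFn = ricAt G y (grad G F y) (grad G F y) := by
  simp only [ricGradFn, LeviCivita.ricGrad, map_sum, map_mul,
    rep_iff.1 (rep_grad h.dom h.metric h.rep_fn _), rep_iff.1 (rep_ric h.dom h.metric _ _), ricAt,
    Finset.mul_sum]
  exact Finset.sum_congr rfl fun i _ => Finset.sum_congr rfl fun j _ => by ring

lemma eval_pair (h : IsMiaoTamChart T G F) (y : T) :
    evalAt y (h.conn.pair h.fn h.fn) = pairIn G F F y :=
  rep_iff.1 (rep_pair h.dom h.metric h.rep_fn h.rep_fn) y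

/-- Where equality holds, the Ricci tensor is determined by `R`, `∇F` and `Ric(∇F, ∇F)`. -/
lemma eval_levelDefect (h : IsMiaoTamChart T G F) (hx : x ∈ T) (hreg : ∃ i, pd i F x ≠ 0)
    (heq : RicciEqualityIn G F x) (i j : Fin 4) :
    evalAt ⟨x, hx⟩ (h.conn.levelDefect h.fn h.ricGradFn i j) = 0 := by
  obtain ⟨e, he⟩ := h.metric.exists_adaptedFrame hx hreg
  obtain ⟨ν, hν⟩ := (h.ricciEquality_iff hx hreg he).mp heq
  have hq := h.metric.pairIn_pos hx hreg
  set q := pairIn G F F x with hqd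
  set r := ricAt G x (grad G F x) (grad G F x) with hr
  set R := scal G x with hR
  have hE : ∀ i j, evalAt ⟨x, hx⟩ (h.conn.levelDefect h.fn h.ricGradFn i j)
      = 3 * q ^ 2 * ric G i j x - q * (q * R - r) * G x i j
        - (4 * r - q * R) * (pd i F x * pd j F x) := by
    intro i j
    simp only [LeviCivita.levelDefect, map_sub, map_mul, map_pow, map_ofNat, eval_pair,
      eval_ricGradFn, eval_G, rep_iff.1 (rep_ric h.dom h.metric _ _),
      rep_iff.1 (rep_scal h.dom h.metric), rep_iff.1 (rep_d h.dom h.metric h.rep_fn _), hqd, hr, hR]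
  set S : Fin 4 → Fin 4 → ℝ := fun i j => 3 * q ^ 2 * ric G i j x - q * (q * R - r) * G x i j
        - (4 * r - q * R) * (pd i F x * pd j F x) with hS
  have hb : ∀ X Y, bil S X Y = 3 * q ^ 2 * ricAt G x X Y - q * (q * R - r) * gAt G x X Y
      - (4 * r - q * R) * ((∑ i, pd i F x * X i) * ∑ i, pd i F x * Y i) := by
    intro X Y
    rw [hS, bil_sub, bil_sub, bil_mul, bil_mul _ (fun i j => G x i j), bil_mul, bil_prod]
    rfl
  have ht : ∀ a : Fin 3, ∑ i, pd i F x * e a.castSucc i = 0 := fun a =>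
    he.tangent h.metric hx hreg a
  have h33 : ∑ i, pd i F x * e 3 i = gradNorm G F x := by
    have h1 := h.metric.gAt_normal (F := F) hx (e 3)
    have h2 := h.metric.gAt_normal_normal hx hreg
    rw [he.last_eq] at h1 ⊢
    rw [h2, eq_div_iff (h.metric.gradNorm_pos hx hreg).ne'] at h1
    linarith
  have hrq : ricAt G x (e 3) (e 3) * q = r := by
    rw [he.last_eq, ricAt_normal_normal h.metric hx hreg, div_mul_cancel₀ _ hq.ne']
  have hRν : R = 3 * ν + ricAt G x (e 3) (e 3) := by
    rw [hR, scal_eq he, Fin.sum_univ_castSucc (n := 3), show Fin.last 3 = 3 from rfl]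
    simp [hν]
  have hn : gradNorm G F x * gradNorm G F x = q := by rw [← sq, h.metric.gradNorm_sq hx]
  have hsymS : ∀ X Y, bil S X Y = bil S Y X := bil_symm fun i j => by
    rw [hS]; beta_reduce; rw [ric_symm h.dom h.metric hx i j, h.metric.symm hx i j]; ring
  have hab : ∀ a b : Fin 3, bil S (e a.castSucc) (e b.castSucc) = 0 := by
    intro a b
    rw [hb, ht, hν, he.orthonormal, hRν, ← hrq]
    simp only [Fin.castSucc_inj]
    split_ifs <;> ring
  have ha3 : ∀ a : Fin 3, bil S (e 3) (e a.castSucc) = 0 := by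
    intro a
    have hne : (3 : Fin 4) ≠ a.castSucc := by fin_cases a <;> decide
    rw [hb, ht, h.ricAt_last hx hreg he, he.orthonormal, if_neg hne]
    ring
  have h3 : bil S (e 3) (e 3) = 0 := by
    rw [hb, h33, hn, he.orthonormal, if_pos rfl, ← hrq, hRν]
    ring
  have hall : ∀ a b : Fin 4, bil S (e a) (e b) = 0 := by
    intro a b
    induction a using Fin.lastCases with
    | last => induction b using Fin.lastCases with
      | last => exact h3
      | cast b => exact ha3 b
    | cast a => induction b using Fin.lastCases with
      | last => exact (hsymS _ _).trans (ha3 a)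
      | cast b => exact hab a b
  rw [hE]
  change S i j = 0
  rw [← bil_single S i j, he.orthonormal4.bil_expand S]
  simp [hall]

/-- `|∇F|²` is stationary along the level sets. -/
lemma pd_pairIn_tangent (h : IsMiaoTamChart T G F) (hx : x ∈ T) (hreg : ∃ i, pd i F x ≠ 0)
    {X : Fin 4 → ℝ} (hX : IsTangentToLevel F x X) : ∑ m, pd m (pairIn G F F) x * X m = 0 := by
  obtain ⟨μ, hμ⟩ := h.exists_eigen hx hreg
  have h1 : ∀ m, pd m (pairIn G F F) x = 2 * ∑ k, grad G F x k * hess G F k m x := by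
    intro m
    have := congrArg (evalAt ⟨x, hx⟩) (h.conn.d_pair h.fn h.fn m)
    rw [rep_iff.1 (rep_d h.dom h.metric (rep_pair h.dom h.metric h.rep_fn h.rep_fn) m)] at this
    rw [this]
    simp only [map_sum, map_add, map_mul, rep_iff.1 (rep_grad h.dom h.metric h.rep_fn _),
      rep_iff.1 (rep_hess h.dom h.metric h.rep_fn _ _)]
    rw [← two_mul]
    congr 1
    refine Finset.sum_congr rfl fun k _ => ?_
    rw [h.hess_eq hx, h.hess_eq hx, ric_symm h.dom h.metric hx k m, h.metric.symm hx k m]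
  have h2 : ∑ m, pd m (pairIn G F F) x * X m
      = 2 * (F x * ricAt G x (grad G F x) X + (1 + lap G F x) * gAt G x (grad G F x) X) := by
    simp only [h1, h.hess_eq hx, ricAt, gAt, Finset.mul_sum, Finset.sum_mul,
      ← Finset.sum_add_distrib]
    rw [Finset.sum_comm]
    exact Finset.sum_congr rfl fun k _ => Finset.sum_congr rfl fun m _ => by ring
  rw [h2, hμ, h.metric.gAt_grad hx, show ∑ i, pd i F x * X i = 0 from hX]
  ring

lemma riemGrad_eq_zero_of_eq_zero (h : IsMiaoTamChart T G F) (hx : x ∈ T) (hF : F x = 0)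
    {X Y : Fin 4 → ℝ} (Z : Fin 4 → ℝ) (hX : IsTangentToLevel F x X)
    (hY : IsTangentToLevel F x Y) : riemGrad G F x X Y Z = 0 := by
  have := h.codazzi hx hX hY (Z := Z)
  rw [hF, zero_mul] at this
  linarith

/-- Let `C` be a set of points at which equality holds, and `x ∈ C` a point with `F x ≠ 0` such that
every function vanishing on `C` is stationary at `x` along the level set. Then `Ric(∇F, ∇F)` is
stationary at `x` along the level set, and `R(X, Y, ∇F, Z) = 0` for tangent `X`, `Y`, `Z`. -/
lemma umbilic_derivative (h : IsMiaoTamChart T G F) {C : Set E4} (hCT : C ⊆ T)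
    (hCreg : ∀ y ∈ C, ∃ i, pd i F y ≠ 0) (hCeq : ∀ y ∈ C, RicciEqualityIn G F y) (hxC : x ∈ C)
    (hF : F x ≠ 0)
    (htan : ∀ X, IsTangentToLevel F x X → ∀ u : E4 → ℝ, ContDiffOn ℝ ∞ u T →
      (∀ y ∈ C, u y = 0) → ∑ m, pd m u x * X m = 0) :
    (∀ X, IsTangentToLevel F x X →
      ∑ m, pd m (fun y => ricAt G y (grad G F y) (grad G F y)) x * X m = 0) ∧
    ∀ X Y Z, IsTangentToLevel F x X → IsTangentToLevel F x Y → IsTangentToLevel F x Z →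
      riemGrad G F x X Y Z = 0 := by
  have hx := hCT hxC
  have hreg := hCreg x hxC
  have hq := h.metric.pairIn_pos hx hreg
  set q := pairIn G F F x with hqd
  have hrs : Rep h.ricGradFn (fun y => ricAt G y (grad G F y) (grad G F y)) :=
    rep_iff.2 h.eval_ricGradFn
  set dr : Fin 4 → ℝ := fun m => pd m (fun y => ricAt G y (grad G F y) (grad G F y)) x with hdr
  -- the covariant derivative of the vanishing tensor along the level set vanishes
  have h1 : ∀ X, IsTangentToLevel F x X → ∀ i j,
      ∑ m, X m * evalAt ⟨x, hx⟩ (h.conn.cov2 (h.conn.levelDefect h.fn h.ricGradFn) m i j) = 0 := by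
    intro X hX i j
    have h2 : ∀ m, evalAt ⟨x, hx⟩ (h.conn.cov2 (h.conn.levelDefect h.fn h.ricGradFn) m i j)
        = pd m (extendZero (h.conn.levelDefect h.fn h.ricGradFn i j).1) x := by
      intro m
      simp only [LeviCivita.cov2, map_sub, map_sum, map_add, map_mul,
        h.eval_levelDefect hx hreg (hCeq x hxC), mul_zero, add_zero, Finset.sum_const_zero,
        sub_zero]
      rfl
    simp only [h2, mul_comm (X _)]
    refine htan X hX _ (h.conn.levelDefect h.fn h.ricGradFn i j).2 fun y hy => ?_
    rw [extendZero_of_mem _ (hCT hy)]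
    exact h.eval_levelDefect (hCT hy) (hCreg y hy) (hCeq y hy) i j
  have h3 : ∀ X Y Z, IsTangentToLevel F x X → IsTangentToLevel F x Y → IsTangentToLevel F x Z →
      3 * q ^ 2 * h.covRic hx X Y Z + q * (∑ m, dr m * X m) * gAt G x Y Z = 0 := by
    intro X Y Z hX hY hZ
    have hX' : ∑ m, pd m (pairIn G F F) x * X m = 0 := h.pd_pairIn_tangent hx hreg hX
    have hY' : ∑ m, pd m F x * Y m = 0 := hY
    have hZ' : ∑ m, pd m F x * Z m = 0 := hZ
    have h4 : tri (fun m i j => evalAt ⟨x, hx⟩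
        (h.conn.cov2 (h.conn.levelDefect h.fn h.ricGradFn) m i j)) X Y Z = 0 := by
      simp only [tri, bil, Finset.mul_sum]
      rw [Finset.sum_comm]
      refine Finset.sum_eq_zero fun i _ => ?_
      rw [Finset.sum_comm]
      refine Finset.sum_eq_zero fun j _ => ?_
      rw [← zero_mul (Y i), ← zero_mul (Z j), ← h1 X hX i j, Finset.sum_mul, Finset.sum_mul]
      exact Finset.sum_congr rfl fun m _ => by ring
    set R := scal G x
    set r := ricAt G x (grad G F x) (grad G F x) with hr
    have h5 : ∀ m i j, evalAt ⟨x, hx⟩ (h.conn.cov2 (h.conn.levelDefect h.fn h.ricGradFn) m i j)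
        = 3 * q ^ 2 * evalAt ⟨x, hx⟩ (h.conn.cov2 h.conn.ric m i j)
          + pd m (pairIn G F F) x * (6 * q * ric G i j x - (2 * q * R - r) * G x i j
            + R * (pd i F x * pd j F x))
          + dr m * (q * G x i j) - dr m * (4 * (pd i F x * pd j F x))
          - (4 * r - q * R) * (pd j F x * hess G F m i x)
          - (4 * r - q * R) * (pd i F x * hess G F m j x) := by
      intro m i j
      rw [LeviCivita.cov2_levelDefect _ _ _ h.d_scal]
      simp only [map_sub, map_add, map_mul, map_pow, map_ofNat, eval_pair,
        eval_ricGradFn, eval_G, rep_iff.1 (rep_ric h.dom h.metric _ _),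
        rep_iff.1 (rep_scal h.dom h.metric), rep_iff.1 (rep_d h.dom h.metric h.rep_fn _),
        rep_iff.1 (rep_hess h.dom h.metric h.rep_fn _ _), rep_iff.1 (rep_d h.dom h.metric hrs _),
        rep_iff.1 (rep_d h.dom h.metric (rep_pair h.dom h.metric h.rep_fn h.rep_fn) m), ← hqd,
        ← hr]
      rfl
    rw [funext fun m => funext fun i => funext fun j => h5 m i j, tri_sub, tri_sub, tri_sub,
      tri_add, tri_add, tri_mul,
      tri_fst (fun m => pd m (pairIn G F F) x) (fun i j => 6 * q * ric G i j x
        - (2 * q * R - r) * G x i j + R * (pd i F x * pd j F x)),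
      tri_fst dr (fun i j => q * G x i j), tri_fst dr (fun i j => 4 * (pd i F x * pd j F x)),
      tri_mul, tri_mul, tri_snd (fun i => pd i F x) (fun m j => hess G F m j x),
      tri_trd (fun j => pd j F x) (fun m i => hess G F m i x), bil_mul _ (fun i j => G x i j),
      bil_mul _ (fun i j => pd i F x * pd j F x), bil_prod, hX', hY', hZ'] at h4
    have h6 : bil (fun i j => G x i j) Y Z = gAt G x Y Z := rfl
    rw [h6] at h4
    simp only [covRic]
    linear_combination h4
  -- the Codazzi equation
  have h7 : ∀ X Y Z, IsTangentToLevel F x X → IsTangentToLevel F x Y → IsTangentToLevel F x Z →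
      3 * q * riemGrad G F x X Y Z = F x * ((∑ m, dr m * X m) * gAt G x Y Z
        - (∑ m, dr m * Y m) * gAt G x X Z) := by
    intro X Y Z hX hY hZ
    have hc := h.codazzi hx hX hY (Z := Z)
    rw [h.covRic_symm hx X Z Y, h.covRic_symm hx Y Z X] at hc
    refine mul_left_cancel₀ hq.ne' ?_
    linear_combination (3 * q ^ 2) * hc - F x * h3 X Y Z hX hY hZ + F x * h3 Y X Z hY hX hZ
  obtain ⟨e, he⟩ := h.metric.exists_adaptedFrame hx hreg
  have het : ∀ a : Fin 3, IsTangentToLevel F x (e a.castSucc) := he.tangent h.metric hx hreg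
  have h8 : ∀ X, IsTangentToLevel F x X → ∑ m, dr m * X m = 0 := by
    intro X hX
    have hs := h.sum_riemGrad hx hreg he hX
    have h9 : ∑ b : Fin 3, gAt G x X (e b.castSucc) * (∑ m, dr m * e b.castSucc m)
        = ∑ m, dr m * X m := by
      have hsym : ∀ Y, gAt G x X Y = gAt G x Y X := bil_symm (fun i j => h.metric.symm hx i j) X
      have h11 : ∀ m, X m = ∑ b : Fin 3, gAt G x X (e b.castSucc) * e b.castSucc m := by
        intro m
        have h12 := congrFun (he.orthonormal4.expand X) m
        have h13 : bil (G x) (e 3) X = 0 := by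
          rw [he.last_eq]
          exact (h.metric.gAt_normal_eq_zero_iff hx hreg X).mpr hX
        rw [Finset.sum_apply, Fin.sum_univ_castSucc (n := 3), show Fin.last 3 = 3 from rfl, h13,
          zero_smul, Pi.zero_apply, add_zero] at h12
        rw [h12]
        exact Finset.sum_congr rfl fun b _ => by rw [hsym]; rfl
      conv_rhs => rw [Finset.sum_congr rfl fun m _ => congrArg (dr m * ·) (h11 m)]
      simp only [Finset.mul_sum]
      rw [Finset.sum_comm]
      exact Finset.sum_congr rfl fun m _ => Finset.sum_congr rfl fun b _ => by ring
    -- tracing the Codazzi equation over the tangent directions leaves `(3 - 1) dr X`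
    have h10 : ∑ b : Fin 3, 3 * q * riemGrad G F x X (e b.castSucc) (e b.castSucc)
        = F x * (3 * (∑ m, dr m * X m) - ∑ m, dr m * X m) := by
      simp only [h7 X _ _ hX (het _) (het _), he.orthonormal, if_true, ← Finset.mul_sum,
        Finset.sum_sub_distrib, mul_one]
      rw [← h9]
      simp [mul_comm]
    rw [← Finset.mul_sum, hs, mul_zero] at h10
    have := (mul_eq_zero.mp h10.symm).resolve_left hF
    linarith
  refine ⟨h8, fun X Y Z hX hY hZ => ?_⟩
  have := h7 X Y Z hX hY hZ
  rw [h8 X hX, h8 Y hY, zero_mul, zero_mul, sub_zero, mul_zero] at this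
  exact (mul_eq_zero.mp this).resolve_left (by positivity)

/-- The mixed components of the Weyl tensor vanish where those of the curvature tensor do, since
`∇F` is an eigenvector of the Ricci tensor. -/
lemma weylAt_eq_zero (h : IsMiaoTamChart T G F) (hx : x ∈ T) (hreg : ∃ i, pd i F x ≠ 0)
    (hR : ∀ X Y Z, IsTangentToLevel F x X → IsTangentToLevel F x Y → IsTangentToLevel F x Z →
      riemGrad G F x X Y Z = 0) (he : IsAdaptedFrame G F x e) (i j k : Fin 3) :
    weylAt G x (e 3) (e i.castSucc) (e j.castSucc) (e k.castSucc) = 0 := by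
  have het : ∀ a : Fin 3, IsTangentToLevel F x (e a.castSucc) := he.tangent h.metric hx hreg
  have hpair : ∀ i j k l, riem G i j k l x = riem G k l i j x := fun i j k l => by
    have := congrArg (evalAt ⟨x, hx⟩) (h.conn.riem_pair i j k l)
    simpa only [rep_iff.1 (rep_riem h.dom h.metric _ _ _ _)] using this
  have hg3 : ∀ a : Fin 3, gAt G x (e 3) (e a.castSucc) = 0 := fun a => by
    rw [he.orthonormal, if_neg]; fin_cases a <;> decide
  have hr3 := h.ricAt_last hx hreg he
  have h1 : ∀ N X Y Z : Fin 4 → ℝ, weylAt G x N X Y Z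
      = (∑ i, ∑ j, ∑ k, ∑ l, riem G i j k l x * N i * X j * Y k * Z l)
        - (1 / 2) * (ricAt G x N Y * gAt G x X Z + ricAt G x X Z * gAt G x N Y
          - ricAt G x N Z * gAt G x X Y - ricAt G x X Y * gAt G x N Z)
        + (scal G x / 6) * (gAt G x X Z * gAt G x N Y - gAt G x N Z * gAt G x X Y) := by
    intro N X Y Z
    have p1 : ∀ S U : Fin 4 → Fin 4 → ℝ, bil S N Y * bil U X Z
        = ∑ i, ∑ j, ∑ k, ∑ l, S i k * U j l * N i * X j * Y k * Z l := by
      intro S U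
      rw [bil, bil, Finset.sum_mul_sum]
      refine Finset.sum_congr rfl fun i _ => Finset.sum_congr rfl fun j _ => ?_
      rw [Finset.sum_mul_sum]
      exact Finset.sum_congr rfl fun k _ => Finset.sum_congr rfl fun l _ => by ring
    have p2 : ∀ S U : Fin 4 → Fin 4 → ℝ, bil S N Z * bil U X Y
        = ∑ i, ∑ j, ∑ k, ∑ l, S i l * U j k * N i * X j * Y k * Z l := by
      intro S U
      rw [bil, bil, Finset.sum_mul_sum]
      refine Finset.sum_congr rfl fun i _ => Finset.sum_congr rfl fun j _ => ?_
      rw [Finset.sum_mul_sum, Finset.sum_comm]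
      exact Finset.sum_congr rfl fun k _ => Finset.sum_congr rfl fun l _ => by ring
    have hg : ∀ U V, gAt G x U V = bil (fun i j => G x i j) U V := fun _ _ => rfl
    have hr : ∀ U V, ricAt G x U V = bil (fun i j => ric G i j x) U V := fun _ _ => rfl
    rw [mul_comm (ricAt G x X Z), mul_comm (ricAt G x X Y), mul_comm (gAt G x X Z)]
    simp only [hg, hr, p1, p2, Finset.mul_sum, ← Finset.sum_add_distrib,
      ← Finset.sum_sub_distrib, weylAt]
    exact Finset.sum_congr rfl fun i _ => Finset.sum_congr rfl fun j _ =>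
      Finset.sum_congr rfl fun k _ => Finset.sum_congr rfl fun l _ => by rw [weyl]; ring
  rw [h1, hg3, hg3, hr3, hr3]
  have h2 : (∑ a, ∑ b, ∑ c, ∑ d, riem G a b c d x * e 3 a * e i.castSucc b * e j.castSucc c
      * e k.castSucc d)
      = (gradNorm G F x)⁻¹ * riemGrad G F x (e j.castSucc) (e k.castSucc) (e i.castSucc) := by
    simp only [riemGrad, tri, bil, Finset.mul_sum, Finset.sum_mul]
    rw [sum_comm_pairs]
    refine Finset.sum_congr rfl fun c _ => Finset.sum_congr rfl fun d _ => ?_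
    rw [Finset.sum_comm]
    refine Finset.sum_congr rfl fun b _ => Finset.sum_congr rfl fun a _ => ?_
    rw [hpair a b c d, he.last_eq, normal]
    ring
  rw [h2, hR _ _ _ (het j) (het k) (het i)]
  ring

end IsMiaoTamChart

/-! ### The local structure of the level sets -/

/-- A `C¹` parametrization of the level sets of `F` near a regular point `x`: `σ` is the local
inverse of `y ↦ y + (F y - F x - ℓ (y - x)) v`, where `ℓ = dF` at `x` and `ℓ v = 1`, and it turns
the affine function `ℓ` into `F`. -/
lemma exists_level_param {E : Type*} [NormedAddCommGroup E] [NormedSpace ℝ E] [CompleteSpace E]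
    {F : E → ℝ} {x : E} (hF : ContDiffAt ℝ 1 F x) (hreg : fderiv ℝ F x ≠ 0) {V : Set E}
    (hV : V ∈ 𝓝 x) : ∃ ε > 0, ∃ σ Φ : E → E,
      (∀ z ∈ Metric.ball x ε, DifferentiableAt ℝ σ z ∧ σ z ∈ V ∧
        F (σ z) = F x + fderiv ℝ F x (z - x)) ∧
      HasFDerivAt σ (ContinuousLinearMap.id ℝ E) x ∧ σ x = x ∧
      ∀ᶠ y in 𝓝 x, Φ y ∈ Metric.ball x ε ∧ σ (Φ y) = y ∧ fderiv ℝ F x (Φ y - x) = F y - F x := by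
  set ℓ := fderiv ℝ F x with hℓ
  obtain ⟨v, hv⟩ : ∃ v, ℓ v = 1 := by
    obtain ⟨w, hw⟩ : ∃ w, ℓ w ≠ 0 := by
      by_contra hc
      push Not at hc
      exact hreg (ContinuousLinearMap.ext hc)
    exact ⟨(ℓ w)⁻¹ • w, by rw [map_smul, smul_eq_mul, inv_mul_cancel₀ hw]⟩
  set Φ : E → E := fun y => y + (F y - F x - ℓ (y - x)) • v with hΦ
  have hΦx : Φ x = x := by simp [hΦ]
  have hΦℓ : ∀ y, ℓ (Φ y - x) = F y - F x := by
    intro y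
    simp only [hΦ, map_sub, map_add, map_smul, hv, smul_eq_mul]
    ring
  have hsm : ContDiffAt ℝ 1 Φ x := by
    refine contDiffAt_id.add (ContDiffAt.smul ((hF.sub contDiffAt_const).sub ?_) contDiffAt_const)
    exact ℓ.contDiff.contDiffAt.comp x (contDiffAt_id.sub contDiffAt_const)
  have hd : HasFDerivAt Φ ((ContinuousLinearEquiv.refl ℝ E : E ≃L[ℝ] E) : E →L[ℝ] E) x := by
    have h1 : HasFDerivAt (fun y => F y - F x - ℓ (y - x)) (ℓ - ℓ.comp (.id ℝ E)) x :=
      ((hF.differentiableAt (by simp)).hasFDerivAt.sub_const (F x)).sub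
        (ℓ.hasFDerivAt.comp x ((hasFDerivAt_id x).sub_const x))
    refine ((hasFDerivAt_id x).add (h1.smul_const v)).congr_fderiv ?_
    ext w
    simp
  have hs : HasStrictFDerivAt Φ ((ContinuousLinearEquiv.refl ℝ E : E ≃L[ℝ] E) : E →L[ℝ] E) x :=
    hsm.hasStrictFDerivAt' hd (by simp)
  set σ : E → E := hs.localInverse Φ _ x with hσ
  have hσx : σ x = x := by
    have := hs.localInverse_apply_image
    rwa [hΦx] at this
  have hσsm : ContDiffAt ℝ 1 σ x := by
    have : ContDiffAt ℝ 1 (hsm.localInverse hd (by simp)) (Φ x) := hsm.to_localInverse hd (by simp)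
    rwa [hΦx] at this
  have hσd : HasFDerivAt σ (ContinuousLinearMap.id ℝ E) x := by
    have := hs.to_localInverse.hasFDerivAt
    rwa [hΦx] at this
  have h1 : ∀ᶠ z in 𝓝 x, DifferentiableAt ℝ σ z ∧ σ z ∈ V ∧ F (σ z) = F x + ℓ (z - x) := by
    have h2 : ∀ᶠ z in 𝓝 x, Φ (σ z) = z := by
      have := hs.eventually_right_inverse
      rwa [hΦx] at this
    have h3 : ∀ᶠ z in 𝓝 x, σ z ∈ V := hσsm.continuousAt.eventually_mem (by rwa [hσx])
    filter_upwards [h2, h3, hσsm.eventually (by simp)] with z hz2 hz3 hz4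
    refine ⟨hz4.differentiableAt (by simp), hz3, ?_⟩
    have := hΦℓ (σ z)
    rw [hz2] at this
    linarith
  obtain ⟨ε, hε, hball⟩ := Metric.eventually_nhds_iff_ball.mp h1
  refine ⟨ε, hε, σ, Φ, hball, hσd, hσx, ?_⟩
  have h4 : ∀ᶠ y in 𝓝 x, Φ y ∈ Metric.ball x ε :=
    hsm.continuousAt.eventually_mem (by rw [hΦx]; exact Metric.ball_mem_nhds x hε)
  filter_upwards [h4, hs.eventually_left_inverse] with y hy1 hy2
  exact ⟨hy1, hy2, hΦℓ y⟩

lemma fderivWithin_eq_sum (u : E4 → ℝ) (y w : E4) :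
    fderivWithin ℝ u (Set.range (𝓡∂ 4)) y w = ∑ i, pd i u y * w i := by
  conv_lhs => rw [← (EuclideanSpace.basisFun (Fin 4) ℝ).sum_repr w]
  simp [pd, mul_comm]

section
variable {T : Set E4} {F u : E4 → ℝ} {x : E4}

/-- The chain rule along a curve in the coordinate domain. -/
lemma IsCoordDomain.hasDerivWithinAt_comp (hT : IsCoordDomain T) (hu : ContDiffOn ℝ ∞ u T)
    {γ : ℝ → E4} {w : E4} {s : Set ℝ} {t : ℝ} (hγ : HasDerivWithinAt γ w s t)
    (hγT : Set.MapsTo γ s T) (ht : t ∈ s) :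
    HasDerivWithinAt (fun r => u (γ r)) (∑ i, pd i u (γ t) * w i) s t := by
  rw [← fderivWithin_eq_sum]
  exact (hT.differentiableWithinAt hu (hγT ht)).hasFDerivWithinAt.comp_hasDerivWithinAt t hγ
    (hγT.mono_right hT.subset)

/-- The regular part of the level set of `F` through `x`. -/
def regularLevel (T : Set E4) (F : E4 → ℝ) (x : E4) : Set E4 :=
  {y | y ∈ T ∧ F y = F x ∧ ∃ i, pd i F y ≠ 0}

/-- Let `C` contain every connected part through `x` of the regular level set of `F`. A function that
is stationary along the level set at the points of `C` is constant along every differentiable curve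
in the level set that starts at `x`. -/
lemma IsCoordDomain.eq_of_curve (hT : IsCoordDomain T) (hF : ContDiffOn ℝ ∞ F T)
    (hu : ContDiffOn ℝ ∞ u T) {C : Set E4}
    (hC : ∀ S, IsPreconnected S → x ∈ S → S ⊆ regularLevel T F x → S ⊆ C)
    (hcrit : ∀ y ∈ C, ∀ X, IsTangentToLevel F y X → ∑ i, pd i u y * X i = 0)
    {γ : ℝ → E4} (hγ : DifferentiableOn ℝ γ (Set.Icc 0 1)) (h0 : γ 0 = x)
    (hlev : ∀ t ∈ Set.Icc (0 : ℝ) 1, γ t ∈ regularLevel T F x) : u (γ 1) = u x := by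
  have hmaps : Set.MapsTo γ (Set.Icc 0 1) T := fun t ht => (hlev t ht).1
  have hsub : γ '' Set.Icc 0 1 ⊆ C := by
    refine hC _ (isPreconnected_Icc.image γ hγ.continuousOn) ⟨0, by simp, h0⟩ ?_
    rintro _ ⟨t, ht, rfl⟩
    exact hlev t ht
  have hd : ∀ t ∈ Set.Icc (0 : ℝ) 1, HasDerivWithinAt (fun r => u (γ r)) 0 (Set.Icc 0 1) t := by
    intro t ht
    have h1 := (hγ t ht).hasDerivWithinAt
    have h2 := hT.hasDerivWithinAt_comp hF h1 hmaps ht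
    have h3 : HasDerivWithinAt (fun r => F (γ r)) 0 (Set.Icc 0 1) t :=
      (hasDerivWithinAt_const t _ (F x)).congr (fun r hr => (hlev r hr).2.1) (hlev t ht).2.1
    have hun := uniqueDiffOn_Icc (zero_lt_one (α := ℝ)) t ht
    have h4 := hcrit (γ t) (hsub ⟨t, ht, rfl⟩) _ (hun.eq_deriv _ h2 h3)
    have h5 := hT.hasDerivWithinAt_comp hu h1 hmaps ht
    rwa [h4] at h5
  have := constant_of_derivWithin_zero (fun t ht => (hd t ht).differentiableWithinAt)
    (fun t ht => (hd t ⟨ht.1, ht.2.le⟩).derivWithin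
      (uniqueDiffOn_Icc zero_lt_one t ⟨ht.1, ht.2.le⟩)) 1 (by simp)
  simpa only [h0] using this

lemma IsCoordDomain.eventually_regular (hT : IsCoordDomain T) (hF : ContDiffOn ℝ ∞ F T)
    (hx : x ∈ T) (hreg : ∃ i, pd i F x ≠ 0) : ∀ᶠ y in 𝓝[T] x, ∃ i, pd i F y ≠ 0 := by
  obtain ⟨i, hi⟩ := hreg
  filter_upwards [((contDiffOn_pd hT hF i).continuousOn x hx).eventually_ne hi] with y hy
  exact ⟨i, hy⟩

lemma IsCoordDomain.mem_nhds (hT : IsCoordDomain T) (hx : x ∈ T) (h0 : 0 < x 0) : T ∈ 𝓝 x := by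
  have h1 : Set.range (𝓡∂ 4) ∈ 𝓝 x := by
    rw [mem_interior_iff_mem_nhds.symm, interior_range_modelWithCornersEuclideanHalfSpace]
    exact h0
  have := hT.mem_nhdsWithin x hx
  rwa [nhdsWithin_eq_nhds.mpr h1] at this

lemma IsCoordDomain.contDiffAt (hT : IsCoordDomain T) (hF : ContDiffOn ℝ ∞ F T) (hx : x ∈ T)
    (h0 : 0 < x 0) : ContDiffAt ℝ 1 F x :=
  (hF.contDiffAt (hT.mem_nhds hx h0)).of_le (by
    simp)

lemma fderiv_eq_sum (h0 : 0 < x 0) (w : E4) : fderiv ℝ F x w = ∑ i, pd i F x * w i := by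
  rw [← fderivWithin_eq_sum, fderivWithin_of_mem_nhds]
  rw [mem_interior_iff_mem_nhds.symm, interior_range_modelWithCornersEuclideanHalfSpace]
  exact h0

lemma fderiv_ne_zero (h0 : 0 < x 0) (hreg : ∃ i, pd i F x ≠ 0) : fderiv ℝ F x ≠ 0 := by
  obtain ⟨i, hi⟩ := hreg
  intro hz
  refine hi ?_
  have := fderiv_eq_sum (F := F) h0 (EuclideanSpace.single i 1)
  rw [hz] at this
  simpa using this.symm

/-- A function that vanishes on every connected part through `x` of the level set is stationary at
`x` along the level set: at an interior point every tangent vector is the velocity of a curve in the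
level set. -/
lemma IsCoordDomain.sum_pd_eq_zero_of_tangent (hT : IsCoordDomain T) (hF : ContDiffOn ℝ ∞ F T)
    (hu : ContDiffOn ℝ ∞ u T) (hx : x ∈ T) (hreg : ∃ i, pd i F x ≠ 0) (h0 : 0 < x 0) {C : Set E4}
    (hC : ∀ S, IsPreconnected S → x ∈ S → S ⊆ regularLevel T F x → S ⊆ C)
    (huC : ∀ y ∈ C, u y = 0) {X : Fin 4 → ℝ} (hX : IsTangentToLevel F x X) :
    ∑ i, pd i u x * X i = 0 := by
  have hTn := hT.mem_nhds hx h0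
  have hV : {y | y ∈ T ∧ ∃ i, pd i F y ≠ 0} ∈ 𝓝 x := by
    have := hT.eventually_regular hF hx hreg
    rw [nhdsWithin_eq_nhds.mpr hTn] at this
    exact Filter.inter_mem hTn this
  obtain ⟨ε, hε, σ, Φ, hσ, hσd, hσx, -⟩ := exists_level_param (hT.contDiffAt hF hx h0)
    (fderiv_ne_zero h0 hreg) hV
  set X' : E4 := WithLp.toLp 2 X with hX'
  set τ : ℝ → E4 := fun t => x + t • X' with hτ
  have hτc : Continuous τ := by fun_prop
  have hτ0 : τ 0 = x := by simp [hτ]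
  obtain ⟨δ, hδ, hball⟩ := Metric.mem_nhds_iff.mp
    (hτc.continuousAt.preimage_mem_nhds (by rw [hτ0]; exact Metric.ball_mem_nhds x hε))
  have hℓ : ∀ t, fderiv ℝ F x (τ t - x) = 0 := fun t => by
    have : ∑ i, pd i F x * X i = 0 := hX
    rw [hτ, add_sub_cancel_left, map_smul, fderiv_eq_sum h0, hX']
    simp [this]
  have hlev : ∀ t ∈ Metric.ball (0 : ℝ) δ, σ (τ t) ∈ regularLevel T F x := fun t ht => by
    obtain ⟨-, ⟨h2, h3⟩, h4⟩ := hσ (τ t) (hball ht)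
    exact ⟨h2, by rw [h4, hℓ, add_zero], h3⟩
  have hcont : ContinuousOn (fun t => σ (τ t)) (Metric.ball 0 δ) := fun t ht =>
    ((hσ (τ t) (hball ht)).1.continuousAt.comp hτc.continuousAt).continuousWithinAt
  have h00 : (0 : ℝ) ∈ Metric.ball (0 : ℝ) δ := Metric.mem_ball_self hδ
  have hsub : (fun t => σ (τ t)) '' Metric.ball 0 δ ⊆ C := by
    refine hC _ ((convex_ball _ _).isPreconnected.image _ hcont) ⟨0, h00, by simp [hτ0, hσx]⟩ ?_
    rintro _ ⟨t, ht, rfl⟩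
    exact hlev t ht
  have hd : HasDerivAt (fun t => σ (τ t)) X' 0 := by
    have h1 : HasDerivAt τ X' 0 := by
      simpa [hτ] using ((hasDerivAt_id (0 : ℝ)).smul_const X').const_add x
    rw [← hτ0] at hσd
    exact hσd.comp_hasDerivAt 0 h1
  have hd2 := hT.hasDerivWithinAt_comp hu hd.hasDerivWithinAt (fun t ht => (hlev t ht).1) h00
  have hd3 : HasDerivWithinAt (fun t => u (σ (τ t))) 0 (Metric.ball 0 δ) 0 :=
    (hasDerivWithinAt_const 0 _ 0).congr (fun t ht => huC _ (hsub ⟨t, ht, rfl⟩))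
      (huC _ (hsub ⟨0, h00, rfl⟩))
  have := (Metric.isOpen_ball.uniqueDiffWithinAt h00).eq_deriv _ hd2 hd3
  simpa only [hτ0, hσx] using this

/-- At an interior point the parametrization of the level sets turns line segments into curves in the
level set, which join `x` to all nearby points of the level set. -/
lemma IsCoordDomain.eventually_eq_of_interior (hT : IsCoordDomain T) (hF : ContDiffOn ℝ ∞ F T)
    (hu : ContDiffOn ℝ ∞ u T) (hx : x ∈ T) (hreg : ∃ i, pd i F x ≠ 0) (h0 : 0 < x 0) {C : Set E4}
    (hC : ∀ S, IsPreconnected S → x ∈ S → S ⊆ regularLevel T F x → S ⊆ C)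
    (hcrit : ∀ y ∈ C, ∀ X, IsTangentToLevel F y X → ∑ i, pd i u y * X i = 0) :
    ∀ᶠ y in 𝓝[T] x, F y = F x → u y = u x := by
  have hTn := hT.mem_nhds hx h0
  have hV : {y | y ∈ T ∧ ∃ i, pd i F y ≠ 0} ∈ 𝓝 x := by
    have := hT.eventually_regular hF hx hreg
    rw [nhdsWithin_eq_nhds.mpr hTn] at this
    exact Filter.inter_mem hTn this
  obtain ⟨ε, hε, σ, Φ, hσ, hσd, hσx, hΦ⟩ := exists_level_param (hT.contDiffAt hF hx h0)
    (fderiv_ne_zero h0 hreg) hV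
  refine Filter.Eventually.filter_mono nhdsWithin_le_nhds ?_
  filter_upwards [hΦ] with y hy hFy
  obtain ⟨hy1, hy2, hy3⟩ := hy
  rw [hFy, sub_self] at hy3
  set τ : ℝ → E4 := fun t => x + t • (Φ y - x) with hτ
  have hτ1 : τ 1 = Φ y := by simp [hτ]
  have hball : ∀ t ∈ Set.Icc (0 : ℝ) 1, τ t ∈ Metric.ball x ε := fun t ht =>
    (convex_ball x ε).add_smul_sub_mem (Metric.mem_ball_self hε) hy1 ht
  have := hT.eq_of_curve hF hu hC hcrit (γ := fun t => σ (τ t)) (fun t ht => ?_)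
    (by simp [hτ, hσx]) (fun t ht => ?_)
  · simpa only [hτ1, hy2] using this
  · have h1 : DifferentiableAt ℝ τ t := by fun_prop
    exact ((hσ _ (hball t ht)).1.comp t h1).differentiableWithinAt
  · obtain ⟨-, ⟨h2, h3⟩, h4⟩ := hσ _ (hball t ht)
    refine ⟨h2, ?_, h3⟩
    rw [h4, hτ, add_sub_cancel_left, map_smul, hy3, smul_zero, add_zero]

/-- If `F` vanishes on the boundary, its level set near a regular boundary point is the boundary,
which is convex in coordinates. -/
lemma IsCoordDomain.eventually_eq_of_boundary (hT : IsCoordDomain T) (hF : ContDiffOn ℝ ∞ F T)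
    (hu : ContDiffOn ℝ ∞ u T) (hx : x ∈ T) (hreg : ∃ i, pd i F x ≠ 0) (h0 : x 0 = 0)
    (hbd : ∀ y ∈ T, y 0 = 0 → F y = 0) {C : Set E4}
    (hC : ∀ S, IsPreconnected S → x ∈ S → S ⊆ regularLevel T F x → S ⊆ C)
    (hcrit : ∀ y ∈ C, ∀ X, IsTangentToLevel F y X → ∑ i, pd i u y * X i = 0) :
    ∀ᶠ y in 𝓝[T] x, F y = F x → u y = u x := by
  have hrange : ∀ y : E4, y ∈ Set.range (𝓡∂ 4) ↔ 0 ≤ y 0 := fun y => by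
    rw [range_modelWithCornersEuclideanHalfSpace]; rfl
  -- the derivative of `F` in the boundary directions vanishes
  have h1 : pd 0 F x ≠ 0 := by
    obtain ⟨i, hi⟩ := hreg
    by_cases hi0 : i = 0
    · rwa [hi0] at hi
    refine absurd ?_ hi
    have hT1 : ∀ᶠ t : ℝ in 𝓝 0, x + t • EuclideanSpace.single i (1 : ℝ) ∈ T ∧
        (x + t • EuclideanSpace.single i (1 : ℝ)) 0 = 0 := by
      have hz : ∀ t : ℝ, (x + t • EuclideanSpace.single i (1 : ℝ)) 0 = 0 := fun t => by
        simp [h0, Ne.symm hi0]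
      have hc : Filter.Tendsto (fun t : ℝ => x + t • EuclideanSpace.single i (1 : ℝ)) (𝓝 0)
          (𝓝[Set.range (𝓡∂ 4)] x) := by
        refine tendsto_nhdsWithin_iff.mpr ⟨?_, Filter.Eventually.of_forall fun t =>
          (hrange _).mpr (hz t).ge⟩
        have : Continuous fun t : ℝ => x + t • EuclideanSpace.single i (1 : ℝ) := by fun_prop
        simpa using this.tendsto 0
      filter_upwards [hc (hT.mem_nhdsWithin x hx)] with t ht
      exact ⟨ht, hz t⟩
    obtain ⟨δ, hδ, hball⟩ := Metric.eventually_nhds_iff_ball.mp hT1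
    have hd : HasDerivWithinAt (fun t : ℝ => x + t • EuclideanSpace.single i (1 : ℝ))
        (EuclideanSpace.single i 1) (Metric.ball 0 δ) 0 := by
      have := ((hasDerivAt_id (0 : ℝ)).smul_const (EuclideanSpace.single i (1 : ℝ))).const_add x
      simpa using this.hasDerivWithinAt
    have h00 : (0 : ℝ) ∈ Metric.ball (0 : ℝ) δ := Metric.mem_ball_self hδ
    have hd2 := hT.hasDerivWithinAt_comp hF hd (fun t ht => (hball t ht).1) h00
    have hd3 : HasDerivWithinAt (fun t : ℝ => F (x + t • EuclideanSpace.single i (1 : ℝ))) 0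
        (Metric.ball 0 δ) 0 :=
      (hasDerivWithinAt_const 0 _ 0).congr (fun t ht => hbd _ (hball t ht).1 (hball t ht).2)
        (hbd _ (hball 0 h00).1 (hball 0 h00).2)
    have := (Metric.isOpen_ball.uniqueDiffWithinAt h00).eq_deriv _ hd2 hd3
    simpa using this
  -- a convex neighbourhood on which `∂₀ F ≠ 0`
  have h2 : ∀ᶠ y in 𝓝[Set.range (𝓡∂ 4)] x, y ∈ T ∧ pd 0 F y ≠ 0 := by
    have h3 := ((contDiffOn_pd hT hF 0).continuousOn x hx).eventually_ne h1
    exact Filter.inter_mem (hT.mem_nhdsWithin x hx)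
      (nhdsWithin_le_iff.mpr (hT.mem_nhdsWithin x hx) h3)
  obtain ⟨ε, hε, hball⟩ := Metric.mem_nhdsWithin_iff.mp h2
  have hFx : F x = 0 := hbd x hx h0
  filter_upwards [mem_nhdsWithin_of_mem_nhds (Metric.ball_mem_nhds x hε), self_mem_nhdsWithin]
    with y hy hyT hFy
  have hy0 : y 0 = 0 := by
    by_contra hne
    have hpos : 0 < y 0 := lt_of_le_of_ne ((hrange y).mp (hT.subset hyT)) (Ne.symm hne)
    set b : E4 := y - y 0 • EuclideanSpace.single 0 (1 : ℝ) with hb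
    have hb0 : b 0 = 0 := by simp [hb]
    have hbx : b ∈ Metric.ball x ε := by
      rw [Metric.mem_ball, EuclideanSpace.dist_eq] at hy ⊢
      refine lt_of_le_of_lt (Real.sqrt_le_sqrt ?_) hy
      refine Finset.sum_le_sum fun i _ => ?_
      by_cases hi : i = 0
      · subst hi; rw [hb0, h0]; simp; positivity
      · have : b i = y i := by simp [hb, hi]
        rw [this]
    set τ : ℝ → E4 := fun t => b + t • (y - b) with hτ
    have hτb : ∀ t ∈ Set.Icc (0 : ℝ) 1, τ t ∈ T ∧ pd 0 F (τ t) ≠ 0 := fun t ht => by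
      refine hball ⟨(convex_ball x ε).add_smul_sub_mem hbx hy ht, ?_⟩
      rw [hrange]
      have : τ t 0 = t * y 0 := by simp [hτ, hb]
      rw [this]
      exact mul_nonneg ht.1 hpos.le
    have hd : ∀ t ∈ Set.Icc (0 : ℝ) 1,
        HasDerivWithinAt (fun r => F (τ r)) (pd 0 F (τ t) * y 0) (Set.Icc 0 1) t := by
      intro t ht
      have h3 : HasDerivWithinAt τ (y - b) (Set.Icc 0 1) t := by
        simpa [hτ] using (((hasDerivAt_id t).smul_const (y - b)).const_add b).hasDerivWithinAt
      have h4 := hT.hasDerivWithinAt_comp hF h3 (fun r hr => (hτb r hr).1) ht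
      have h5 : ∑ i, pd i F (τ t) * (y - b) i = pd 0 F (τ t) * y 0 := by
        simp [hb]
      rwa [h5] at h4
    obtain ⟨t, ht, hslope⟩ := exists_hasDerivAt_eq_slope (fun r => F (τ r))
      (fun t => pd 0 F (τ t) * y 0) zero_lt_one (fun t ht => (hd t ht).continuousWithinAt)
      (fun t ht => (hd t ⟨ht.1.le, ht.2.le⟩).hasDerivAt (Icc_mem_nhds ht.1 ht.2))
    have hF1 : F (τ 1) = 0 := by
      rw [show τ 1 = y by simp [hτ], hFy, hFx]
    have hF0 : F (τ 0) = 0 := by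
      have h6 := (hτb 0 (by simp)).1
      rw [show τ 0 = b by simp [hτ]] at h6 ⊢
      exact hbd b h6 hb0
    rw [hF1, hF0] at hslope
    have := (hτb t ⟨ht.1.le, ht.2.le⟩).2
    simp [this, hne] at hslope
  set τ : ℝ → E4 := fun t => x + t • (y - x) with hτ
  have hτ1 : τ 1 = y := by simp [hτ]
  have hτ0 : ∀ t, τ t 0 = 0 := fun t => by simp [hτ, hy0, h0]
  have hτb : ∀ t ∈ Set.Icc (0 : ℝ) 1, τ t ∈ T ∧ pd 0 F (τ t) ≠ 0 := fun t ht =>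
    hball ⟨(convex_ball x ε).add_smul_sub_mem (Metric.mem_ball_self hε) hy ht,
      (hrange _).mpr (hτ0 t).ge⟩
  have := hT.eq_of_curve hF hu hC hcrit (γ := τ) (by fun_prop) (by simp [hτ]) fun t ht =>
    ⟨(hτb t ht).1, by rw [hbd _ (hτb t ht).1 (hτ0 t), hFx], 0, (hτb t ht).2⟩
  rwa [hτ1] at this

lemma IsCoordDomain.eventually_eq (hT : IsCoordDomain T) (hF : ContDiffOn ℝ ∞ F T)
    (hu : ContDiffOn ℝ ∞ u T) (hx : x ∈ T) (hreg : ∃ i, pd i F x ≠ 0)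
    (hbd : ∀ y ∈ T, y 0 = 0 → F y = 0) {C : Set E4}
    (hC : ∀ S, IsPreconnected S → x ∈ S → S ⊆ regularLevel T F x → S ⊆ C)
    (hcrit : ∀ y ∈ C, ∀ X, IsTangentToLevel F y X → ∑ i, pd i u y * X i = 0) :
    ∀ᶠ y in 𝓝[T] x, F y = F x → u y = u x := by
  have h1 : 0 ≤ x 0 := by
    have := hT.subset hx
    rwa [range_modelWithCornersEuclideanHalfSpace] at this
  rcases h1.eq_or_lt with h0 | h0
  · exact hT.eventually_eq_of_boundary hF hu hx hreg h0.symm hbd hC hcrit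
  · exact hT.eventually_eq_of_interior hF hu hx hreg h0 hC hcrit

end

/-! ### From the manifold to its charts -/

section Manifold

variable {M : Type*} [TopologicalSpace M] {c : OpenPartialHomeomorph M (EuclideanHalfSpace 4)}
  {x : E4} {u w : M → ℝ}

lemma isCoordDomain_target (c : OpenPartialHomeomorph M (EuclideanHalfSpace 4)) :
    IsCoordDomain (c.extend (𝓡∂ 4)).target where
  subset := c.extend_target_subset_range
  mem_nhdsWithin x hx := by
    have h1 := (c.extend (𝓡∂ 4)).map_target hx
    rw [c.extend_source] at h1
    have := c.extend_target_mem_nhdsWithin (I := 𝓡∂ 4) h1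
    rwa [(c.extend (𝓡∂ 4)).right_inv hx] at this

lemma symm_mem_source (hx : x ∈ (c.extend (𝓡∂ 4)).target) :
    (c.extend (𝓡∂ 4)).symm x ∈ c.source := by
  have := (c.extend (𝓡∂ 4)).map_target hx
  rwa [c.extend_source] at this

lemma chart_mem_target {q : M} (hq : q ∈ c.source) : c.extend (𝓡∂ 4) q ∈ (c.extend (𝓡∂ 4)).target :=
  (c.extend (𝓡∂ 4)).map_source (by rwa [c.extend_source])

lemma inChart_chart (f : M → ℝ) {q : M} (hq : q ∈ c.source) : inChart f c (c.extend (𝓡∂ 4) q) = f q :=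
  congrArg f (c.extend_left_inv hq)

variable [ChartedSpace (EuclideanHalfSpace 4) M]

/-- The differential of a function on `M`. -/
def dM (u : M → ℝ) (p : M) : TangentSpace (𝓡∂ 4) p →L[ℝ] ℝ := mfderiv (𝓡∂ 4) 𝓘(ℝ, ℝ) u p

/-- The coordinate vector fields of a chart as a linear map. -/
def coordMap (c : OpenPartialHomeomorph M (EuclideanHalfSpace 4)) (x : E4) :
    E4 →L[ℝ] TangentSpace (𝓡∂ 4) ((c.extend (𝓡∂ 4)).symm x) :=
  mfderivWithin 𝓘(ℝ, E4) (𝓡∂ 4) (c.extend (𝓡∂ 4)).symm (Set.range (𝓡∂ 4)) x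

lemma coordMap_eq_sum (v : E4) : coordMap c x v = ∑ i, v i • coordVec c i x := by
  conv_lhs => rw [← (EuclideanSpace.basisFun (Fin 4) ℝ).sum_repr v, map_sum]
  simp only [map_smul, EuclideanSpace.basisFun_apply, EuclideanSpace.basisFun_repr]
  rfl

variable [IsManifold (𝓡∂ 4) ∞ M]

lemma contMDiffOn_chart_symm (hc : c ∈ atlas (EuclideanHalfSpace 4) M) :
    ContMDiffOn 𝓘(ℝ, E4) (𝓡∂ 4) ∞ (c.extend (𝓡∂ 4)).symm (c.extend (𝓡∂ 4)).target := by
  rw [c.extend_target']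
  exact contMDiffOn_extend_symm (IsManifold.subset_maximalAtlas hc)

lemma mdifferentiableWithinAt_chart_symm (hc : c ∈ atlas (EuclideanHalfSpace 4) M)
    (hx : x ∈ (c.extend (𝓡∂ 4)).target) : MDifferentiableWithinAt 𝓘(ℝ, E4) (𝓡∂ 4)
      (c.extend (𝓡∂ 4)).symm (Set.range (𝓡∂ 4)) x :=
  ((contMDiffOn_chart_symm hc x hx).mono_of_mem_nhdsWithin
    ((isCoordDomain_target c).mem_nhdsWithin x hx)).mdifferentiableWithinAt (by simp)

lemma contMDiffAt_chart (hc : c ∈ atlas (EuclideanHalfSpace 4) M) {p : M} (hp : p ∈ c.source) :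
    ContMDiffAt (𝓡∂ 4) 𝓘(ℝ, E4) ∞ (c.extend (𝓡∂ 4)) p :=
  c.contMDiffAt_extend (IsManifold.subset_maximalAtlas hc) hp

lemma pd_inChart (hc : c ∈ atlas (EuclideanHalfSpace 4) M) (hx : x ∈ (c.extend (𝓡∂ 4)).target)
    (hu : MDifferentiableAt (𝓡∂ 4) 𝓘(ℝ, ℝ) u ((c.extend (𝓡∂ 4)).symm x)) (i : Fin 4) :
    pd i (inChart u c) x = dM u _ (coordVec c i x) := by
  have h1 := mfderiv_comp_mfderivWithin x hu (mdifferentiableWithinAt_chart_symm hc hx)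
    (((𝓡∂ 4).uniqueDiffOn x ((isCoordDomain_target c).subset hx)).uniqueMDiffWithinAt)
  have h2 : pd i (inChart u c) x = mfderivWithin 𝓘(ℝ, E4) 𝓘(ℝ, ℝ)
      (u ∘ (c.extend (𝓡∂ 4)).symm) (Set.range (𝓡∂ 4)) x (EuclideanSpace.single i (1 : ℝ) : E4) := by
    rw [mfderivWithin_eq_fderivWithin]; rfl
  rw [h2, h1]
  rfl

lemma coordMap_injective (hc : c ∈ atlas (EuclideanHalfSpace 4) M)
    (hx : x ∈ (c.extend (𝓡∂ 4)).target) : Function.Injective (coordMap c x) := by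
  have hun := ((𝓡∂ 4).uniqueDiffOn x ((isCoordDomain_target c).subset hx)).uniqueMDiffWithinAt
  have hφ := (contMDiffAt_chart hc (symm_mem_source hx)).mdifferentiableAt (by simp)
  have h1 := mfderiv_comp_mfderivWithin x hφ (mdifferentiableWithinAt_chart_symm hc hx) hun
  have h2 : mfderivWithin 𝓘(ℝ, E4) 𝓘(ℝ, E4) (c.extend (𝓡∂ 4) ∘ (c.extend (𝓡∂ 4)).symm)
      (Set.range (𝓡∂ 4)) x = ContinuousLinearMap.id ℝ E4 := by
    rw [mfderivWithin_eq_fderivWithin]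
    refine (Filter.EventuallyEq.fderivWithin_eq (f := id) ?_ ?_).trans
      (fderivWithin_id hun.uniqueDiffWithinAt)
    · filter_upwards [(isCoordDomain_target c).mem_nhdsWithin x hx] with y hy
      exact (c.extend (𝓡∂ 4)).right_inv hy
    · exact (c.extend (𝓡∂ 4)).right_inv hx
  intro v v' h
  have h3 : ∀ v : E4, mfderiv (𝓡∂ 4) 𝓘(ℝ, E4) (c.extend (𝓡∂ 4)) ((c.extend (𝓡∂ 4)).symm x)
      (coordMap c x v) = v := fun v => by
    have := congrArg (fun L : E4 →L[ℝ] E4 => L v) (h1.symm.trans h2)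
    exact this
  rw [← h3 v, ← h3 v', h]

lemma coordMap_surjective (hc : c ∈ atlas (EuclideanHalfSpace 4) M)
    (hx : x ∈ (c.extend (𝓡∂ 4)).target) : Function.Surjective (coordMap c x) := by
  let A : E4 →L[ℝ] E4 := coordMap c x
  exact (LinearMap.injective_iff_surjective (f := A.toLinearMap)).mp (coordMap_injective hc hx)

lemma isRegularPoint_iff (hc : c ∈ atlas (EuclideanHalfSpace 4) M)
    (hx : x ∈ (c.extend (𝓡∂ 4)).target)
    (hu : MDifferentiableAt (𝓡∂ 4) 𝓘(ℝ, ℝ) u ((c.extend (𝓡∂ 4)).symm x)) :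
    IsRegularPoint u ((c.extend (𝓡∂ 4)).symm x) ↔ ∃ i, pd i (inChart u c) x ≠ 0 := by
  rw [IsRegularPoint, ← not_iff_not, not_not, not_exists]
  simp only [not_not, pd_inChart hc hx hu]
  constructor
  · intro h i
    have : dM u ((c.extend (𝓡∂ 4)).symm x) = 0 := h
    rw [this]; rfl
  · intro h
    refine ContinuousLinearMap.ext fun W => ?_
    obtain ⟨v, rfl⟩ := coordMap_surjective hc hx W
    change dM u _ (coordMap c x v) = 0
    rw [coordMap_eq_sum, map_sum]
    exact Finset.sum_eq_zero fun i _ => by rw [map_smul, h, smul_zero]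

lemma contDiffOn_inChart (hc : c ∈ atlas (EuclideanHalfSpace 4) M)
    (hu : ContMDiffOn (𝓡∂ 4) 𝓘(ℝ, ℝ) ∞ u c.source) :
    ContDiffOn ℝ ∞ (inChart u c) (c.extend (𝓡∂ 4)).target := by
  rw [← contMDiffOn_iff_contDiffOn]
  exact hu.comp (contMDiffOn_chart_symm hc) fun y hy => symm_mem_source hy

/-! ### The metric in a chart -/

variable (g : Bundle.ContMDiffRiemannianMetric (𝓡∂ 4) ∞ E4 (fun p : M => TangentSpace (𝓡∂ 4) p))

lemma bilinear_sum_sum {V : Type*} [AddCommGroup V] [Module ℝ V] [TopologicalSpace V]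
    (B : V →L[ℝ] V →L[ℝ] ℝ) (a b : Fin 4 → ℝ) (U W : Fin 4 → V) :
    B (∑ i, a i • U i) (∑ j, b j • W j) = ∑ i, ∑ j, B (U i) (W j) * a i * b j := by
  rw [map_sum B, _root_.sum_apply]
  refine Finset.sum_congr rfl fun i _ => ?_
  rw [map_smul B, _root_.smul_apply, map_sum, Finset.smul_sum]
  exact Finset.sum_congr rfl fun j _ => by rw [map_smul, smul_eq_mul, smul_eq_mul]; ring

lemma inner_coordMap (v w : E4) :
    g.inner ((c.extend (𝓡∂ 4)).symm x) (coordMap c x v) (coordMap c x w)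
      = gAt (metricInChart g c) x v w := by
  rw [coordMap_eq_sum, coordMap_eq_sum]
  exact bilinear_sum_sum (g.inner ((c.extend (𝓡∂ 4)).symm x)) v w (fun i => coordVec c i x)
    fun j => coordVec c j x

lemma contMDiffOn_coordVec (hc : c ∈ atlas (EuclideanHalfSpace 4) M) (i : Fin 4) :
    ContMDiffOn 𝓘(ℝ, E4) (𝓡∂ 4).tangent ∞
      (fun y => (⟨(c.extend (𝓡∂ 4)).symm y, coordVec c i y⟩ : TangentBundle (𝓡∂ 4) M))
      (c.extend (𝓡∂ 4)).target := by
  have hT := isCoordDomain_target c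
  have : IsManifold (𝓡∂ 4) 1 M := IsManifold.of_le (n := ∞) (by simp)
  have h1 := (contMDiffOn_chart_symm hc).contMDiffOn_tangentMapWithin (m := ∞) (by simp)
    hT.uniqueDiffOn.uniqueMDiffOn
  have h2 : ContMDiff 𝓘(ℝ, E4) 𝓘(ℝ, E4).tangent ∞ (fun y => (⟨y, EuclideanSpace.single i (1 : ℝ)⟩ :
      TangentBundle 𝓘(ℝ, E4) E4)) :=
    contMDiff_vectorSpace_iff_contDiff.mpr contDiff_const
  refine (h1.comp h2.contMDiffOn fun y hy => hy).congr fun y hy => ?_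
  have h3 : mfderivWithin 𝓘(ℝ, E4) (𝓡∂ 4) (c.extend (𝓡∂ 4)).symm (c.extend (𝓡∂ 4)).target y
      = mfderivWithin 𝓘(ℝ, E4) (𝓡∂ 4) (c.extend (𝓡∂ 4)).symm (Set.range (𝓡∂ 4)) y := by
    refine mfderivWithin_congr_set ?_
    have := c.extend_target_eventuallyEq (I := 𝓡∂ 4) (symm_mem_source hy)
    rwa [(c.extend (𝓡∂ 4)).right_inv hy] at this
  simp only [Function.comp, tangentMapWithin, h3]
  rfl

lemma isMetricOn_metricInChart (hc : c ∈ atlas (EuclideanHalfSpace 4) M) :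
    IsMetricOn (c.extend (𝓡∂ 4)).target (metricInChart g c) where
  contDiffOn i j := by
    rw [← contMDiffOn_iff_contDiffOn]
    intro y hy
    have h1 := contMDiffOn_coordVec hc i y hy
    have h2 := contMDiffOn_coordVec hc j y hy
    have hb := contMDiffOn_chart_symm hc y hy
    have : ContMDiffWithinAt 𝓘(ℝ, E4) ((𝓡∂ 4).prod 𝓘(ℝ)) ∞
        (fun m => Bundle.TotalSpace.mk' ℝ (E := Bundle.Trivial M ℝ) ((c.extend (𝓡∂ 4)).symm m)
          (g.inner ((c.extend (𝓡∂ 4)).symm m) (coordVec c i m) (coordVec c j m)))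
        (c.extend (𝓡∂ 4)).target y := by
      apply ContMDiffWithinAt.clm_bundle_apply₂ (F₁ := E4) (F₂ := E4)
      · exact ContMDiffAt.comp_contMDiffWithinAt y g.contMDiff.contMDiffAt hb
      · exact h1
      · exact h2
    rw [Bundle.contMDiffWithinAt_totalSpace] at this
    exact this.2
  posDef y hy := by
    refine Matrix.PosDef.of_dotProduct_mulVec_pos ?_ fun v hv => ?_
    · ext i j
      exact g.symm _ _ _
    have h1 : coordMap c y (WithLp.toLp 2 v) ≠ 0 := by
      intro h0
      have := coordMap_injective hc hy (h0.trans (map_zero _).symm)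
      exact hv (by simpa using this)
    have h2 := (g.pos _ _ h1).trans_eq (inner_coordMap g _ _)
    exact h2.trans_eq (bil_eq _ v v)

end Manifold

/-! ### Chart-independent quantities -/

section
variable {T : Set E4} {G : E4 → Matrix (Fin 4) (Fin 4) ℝ} {F U U' W W' : E4 → ℝ} {x : E4}

lemma pairIn_congr (hT : IsCoordDomain T) (hU : ∀ y ∈ T, U y = U' y) (hW : ∀ y ∈ T, W y = W' y)
    (hx : x ∈ T) : pairIn G U W x = pairIn G U' W' x := by
  simp only [pairIn, fun i => pd_congr hT hU i hx, fun i => pd_congr hT hW i hx]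

lemma pairIn_eq_sum_grad : pairIn G U W x = ∑ k, pd k U x * grad G W x k := by
  simp only [pairIn, grad, Finset.mul_sum]
  exact Finset.sum_congr rfl fun k _ => Finset.sum_congr rfl fun l _ => by ring

/-- At an umbilical point the principal curvature is determined by the pairings of `∇F` with a
function `U` whose gradient is tangent to the level set. -/
lemma umbilic_pair (hT : IsCoordDomain T) (hG : IsMetricOn T G) (hF : ContDiffOn ℝ ∞ F T)
    (hU : ContDiffOn ℝ ∞ U T) (hx : x ∈ T) (hreg : ∃ i, pd i F x ≠ 0) {κ : ℝ}
    (hκ : ∀ X Y : Fin 4 → ℝ, IsTangentToLevel F x X → IsTangentToLevel F x Y →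
      secondFF G F x X Y = κ * gAt G x X Y) (hFU : pairIn G F U x = 0) :
    2 * (κ * Real.sqrt (pairIn G F F x) * pairIn G U U x)
      = 2 * pairIn G U (pairIn G F U) x - pairIn G F (pairIn G U U) x := by
  have htan : IsTangentToLevel F x (grad G U x) := pairIn_eq_sum_grad.symm.trans hFU
  have h1 := hκ _ _ htan htan
  have hn := (hG.gradNorm_pos hx hreg).ne'
  rw [secondFF_eq hT hG hF hx hreg _ htan, hG.gAt_grad_grad hx, div_eq_iff hn] at h1
  have hrF := rep_toSmooth F hF
  have hrU := rep_toSmooth U hU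
  have h2 := congrArg (evalAt ⟨x, hx⟩) ((geom hT hG).hess_polar (toSmooth F hF) (toSmooth U hU))
  simp only [map_mul, map_sum, map_sub, map_ofNat, rep_iff.1 (rep_hess hT hG hrF _ _),
    rep_iff.1 (rep_grad hT hG hrU _),
    rep_iff.1 (rep_pair hT hG hrU (rep_pair hT hG hrF hrU)),
    rep_iff.1 (rep_pair hT hG hrF (rep_pair hT hG hrU hrU))] at h2
  rw [← h2, ← hG.gAt_grad_grad (F := F) hx, ← gradNorm]
  rw [show κ * gradNorm G F x * pairIn G U U x = κ * pairIn G U U x * gradNorm G F x by ring, ← h1,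
    bil]

lemma exists_orthogonal (a : Fin 4 → ℝ) : ∃ β : Fin 4 → ℝ, (∃ i, β i ≠ 0) ∧ ∑ l, a l * β l = 0 := by
  by_cases h : a 0 = 0
  · exact ⟨Pi.single 0 1, ⟨0, by simp⟩, by simp [Pi.single_apply, h]⟩
  · refine ⟨![a 1, -a 0, 0, 0], ⟨1, by simpa using h⟩, ?_⟩
    simp [Fin.sum_univ_four]
    ring

end

section Manifold

variable {M : Type*} [TopologicalSpace M] [ChartedSpace (EuclideanHalfSpace 4) M]
  [IsManifold (𝓡∂ 4) ∞ M]
  {c c' : OpenPartialHomeomorph M (EuclideanHalfSpace 4)} {x x' : E4} {u w : M → ℝ}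
  (g : Bundle.ContMDiffRiemannianMetric (𝓡∂ 4) ∞ E4 (fun p : M => TangentSpace (𝓡∂ 4) p))

lemma dM_coordMap (hc : c ∈ atlas (EuclideanHalfSpace 4) M) (hx : x ∈ (c.extend (𝓡∂ 4)).target)
    (hu : MDifferentiableAt (𝓡∂ 4) 𝓘(ℝ, ℝ) u ((c.extend (𝓡∂ 4)).symm x)) (v : E4) :
    dM u _ (coordMap c x v) = ∑ i, pd i (inChart u c) x * v i := by
  rw [coordMap_eq_sum, map_sum]
  exact Finset.sum_congr rfl fun i _ => by rw [map_smul, pd_inChart hc hx hu, smul_eq_mul, mul_comm]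

/-- The pairing of gradients, in terms of the vector dual to the differential of `w`. -/
lemma exists_dual (hc : c ∈ atlas (EuclideanHalfSpace 4) M) (hx : x ∈ (c.extend (𝓡∂ 4)).target)
    {p : M} (hp : (c.extend (𝓡∂ 4)).symm x = p)
    (hu : MDifferentiableAt (𝓡∂ 4) 𝓘(ℝ, ℝ) u p) (hw : MDifferentiableAt (𝓡∂ 4) 𝓘(ℝ, ℝ) w p) :
    ∃ V : TangentSpace (𝓡∂ 4) p, (∀ Z, g.inner p V Z = dM w p Z) ∧
      pairIn (metricInChart g c) (inChart u c) (inChart w c) x = dM u p V := by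
  subst hp
  refine ⟨coordMap c x (WithLp.toLp 2 (grad (metricInChart g c) (inChart w c) x)), fun Z => ?_, ?_⟩
  · obtain ⟨v, rfl⟩ := coordMap_surjective hc hx Z
    rw [inner_coordMap, dM_coordMap hc hx hw]
    exact (isMetricOn_metricInChart g hc).gAt_grad hx v
  · rw [dM_coordMap hc hx hu]
    exact pairIn_eq_sum_grad

/-- The pairing `⟨∇u, ∇w⟩` does not depend on the chart. -/
lemma pairIn_eq_pairIn (hc : c ∈ atlas (EuclideanHalfSpace 4) M)
    (hc' : c' ∈ atlas (EuclideanHalfSpace 4) M) (hx : x ∈ (c.extend (𝓡∂ 4)).target)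
    (hx' : x' ∈ (c'.extend (𝓡∂ 4)).target)
    (hxx : (c.extend (𝓡∂ 4)).symm x = (c'.extend (𝓡∂ 4)).symm x')
    (hu : MDifferentiableAt (𝓡∂ 4) 𝓘(ℝ, ℝ) u ((c.extend (𝓡∂ 4)).symm x))
    (hw : MDifferentiableAt (𝓡∂ 4) 𝓘(ℝ, ℝ) w ((c.extend (𝓡∂ 4)).symm x)) :
    pairIn (metricInChart g c) (inChart u c) (inChart w c) x
      = pairIn (metricInChart g c') (inChart u c') (inChart w c') x' := by
  obtain ⟨V, hV, h1⟩ := exists_dual g hc hx rfl hu hw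
  obtain ⟨V', hV', h2⟩ := exists_dual g hc' hx' hxx.symm hu hw
  have : V = V' := by
    by_contra hne
    have h3 := g.pos _ _ (sub_ne_zero.mpr hne)
    rw [map_sub (g.inner _), _root_.sub_apply, hV, hV', sub_self] at h3
    exact lt_irrefl _ h3
  rw [h1, h2, this]

lemma contMDiffOn_comp_chart (hc : c ∈ atlas (EuclideanHalfSpace 4) M) {U : E4 → ℝ}
    (hU : ContDiffOn ℝ ∞ U (c.extend (𝓡∂ 4)).target) :
    ContMDiffOn (𝓡∂ 4) 𝓘(ℝ, ℝ) ∞ (fun p => U (c.extend (𝓡∂ 4) p)) c.source := by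
  refine hU.contMDiffOn.comp (c.contMDiffOn_extend (IsManifold.subset_maximalAtlas hc)) ?_
  intro p hp
  exact (c.extend (𝓡∂ 4)).map_source (by rwa [c.extend_source])

lemma mdifferentiableAt_comp_chart (hc : c ∈ atlas (EuclideanHalfSpace 4) M) {U : E4 → ℝ}
    (hU : ContDiffOn ℝ ∞ U (c.extend (𝓡∂ 4)).target) {p : M} (hp : p ∈ c.source) :
    MDifferentiableAt (𝓡∂ 4) 𝓘(ℝ, ℝ) (fun p => U (c.extend (𝓡∂ 4) p)) p :=
  ((contMDiffOn_comp_chart hc hU).contMDiffAt (c.open_source.mem_nhds hp)).mdifferentiableAt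
    (by simp)

lemma contDiffOn_const_pd (β : Fin 4 → ℝ) (S : Set E4) :
    ContDiffOn ℝ ∞ (fun y : E4 => ∑ l, β l * y l) S := by
  fun_prop

lemma pd_linear {y : E4} {T : Set E4} (hT : IsCoordDomain T) (hy : y ∈ T) (β : Fin 4 → ℝ)
    (i : Fin 4) : pd i (fun y : E4 => ∑ l, β l * y l) y = β i := by
  have h1 : HasFDerivAt (fun y : E4 => ∑ l, β l * y l)
      (∑ l, β l • (EuclideanSpace.proj l : E4 →L[ℝ] ℝ)) y := by
    refine HasFDerivAt.fun_sum fun l _ => ?_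
    exact (EuclideanSpace.proj l : E4 →L[ℝ] ℝ).hasFDerivAt.const_mul (β l)
  rw [pd, h1.hasFDerivWithinAt.fderivWithin ((𝓡∂ 4).uniqueDiffOn y (hT.subset hy))]
  simp [_root_.sum_apply]

/-- At umbilical points the mean curvature does not depend on the chart. -/
lemma meanCurv_eq_meanCurv {f : M → ℝ} (hf : ContMDiff (𝓡∂ 4) 𝓘(ℝ, ℝ) ∞ f)
    (hc : c ∈ atlas (EuclideanHalfSpace 4) M)
    (hc' : c' ∈ atlas (EuclideanHalfSpace 4) M) (hx : x ∈ (c.extend (𝓡∂ 4)).target)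
    (hx' : x' ∈ (c'.extend (𝓡∂ 4)).target)
    (hxx : (c.extend (𝓡∂ 4)).symm x = (c'.extend (𝓡∂ 4)).symm x')
    (hreg : IsRegularPoint f ((c.extend (𝓡∂ 4)).symm x))
    (hu : IsUmbilicIn (metricInChart g c) (inChart f c) x)
    (hu' : IsUmbilicIn (metricInChart g c') (inChart f c') x') :
    meanCurv (metricInChart g c) (inChart f c) x
      = meanCurv (metricInChart g c') (inChart f c') x' := by
  have hT := isCoordDomain_target c
  have hT' := isCoordDomain_target c'
  have hG := isMetricOn_metricInChart g hc
  have hG' := isMetricOn_metricInChart g hc'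
  have hF := contDiffOn_inChart hc hf.contMDiffOn
  have hF' := contDiffOn_inChart hc' hf.contMDiffOn
  have hfd : ∀ p, MDifferentiableAt (𝓡∂ 4) 𝓘(ℝ, ℝ) f p := fun p =>
    (hf p).mdifferentiableAt (by simp)
  have hr := (isRegularPoint_iff hc hx (hfd _)).mp hreg
  have hr' := (isRegularPoint_iff hc' hx' (hfd _)).mp (hxx ▸ hreg)
  obtain ⟨κ, hκ⟩ := hu
  obtain ⟨κ', hκ'⟩ := hu'
  rw [meanCurv_eq_three_mul hG hx hr hκ, meanCurv_eq_three_mul hG' hx' hr' hκ']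
  set G := metricInChart g c with hGdef
  set G' := metricInChart g c' with hGdef'
  set F := inChart f c with hFdef
  set F' := inChart f c' with hFdef'
  set T := (c.extend (𝓡∂ 4)).target with hTdef
  -- a function whose gradient is tangent to the level set and nonzero, linear in the chart `c`
  obtain ⟨β, ⟨i, hβ⟩, hβF⟩ := exists_orthogonal fun l => ∑ k, ginv G x k l * pd k F x
  set U : E4 → ℝ := fun y => ∑ l, β l * y l with hUdef
  have hU : ContDiffOn ℝ ∞ U T := contDiffOn_const_pd β _
  have hUpd : ∀ l, pd l U x = β l := pd_linear hT hx β
  have hFU : pairIn G F U x = 0 := by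
    rw [pairIn, Finset.sum_comm, ← hβF]
    refine Finset.sum_congr rfl fun l _ => ?_
    rw [Finset.sum_mul]
    exact Finset.sum_congr rfl fun k _ => by rw [hUpd]; ring
  have hUU : 0 < pairIn G U U x := hG.pairIn_pos hx ⟨i, by rwa [hUpd]⟩
  -- the common domain, in the chart `c'`
  set T' : Set E4 := (c'.extend (𝓡∂ 4)).target ∩ (c'.extend (𝓡∂ 4)).symm ⁻¹' c.source with hTdef'
  have hT1 : IsCoordDomain T' := by
    refine ⟨fun y hy => hT'.subset hy.1, fun y hy => ?_⟩
    have h1 := hT'.mem_nhdsWithin y hy.1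
    have h2 := (c'.continuousOn_extend_symm y hy.1).preimage_mem_nhdsWithin
      (c.open_source.mem_nhds hy.2)
    exact Filter.inter_mem h1 (nhdsWithin_le_iff.mpr h1 h2)
  have hT1s : T' ⊆ (c'.extend (𝓡∂ 4)).target := Set.inter_subset_left
  have hx1 : x' ∈ T' := ⟨hx', by
    have := symm_mem_source hx
    rwa [hxx] at this⟩
  have hφψ : ∀ y ∈ T, c.extend (𝓡∂ 4) ((c.extend (𝓡∂ 4)).symm y) = y := fun y hy =>
    (c.extend (𝓡∂ 4)).right_inv hy
  have hψφ : ∀ p ∈ c.source, (c.extend (𝓡∂ 4)).symm (c.extend (𝓡∂ 4) p) = p := fun p hp =>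
    c.extend_left_inv hp
  have hφT : ∀ p ∈ c.source, c.extend (𝓡∂ 4) p ∈ T := fun p hp =>
    (c.extend (𝓡∂ 4)).map_source (by rwa [c.extend_source])
  -- transport of functions between the two charts
  have hpull : ∀ {V : E4 → ℝ}, ContDiffOn ℝ ∞ V T → ∀ y ∈ T,
      MDifferentiableAt (𝓡∂ 4) 𝓘(ℝ, ℝ) (fun p => V (c.extend (𝓡∂ 4) p))
        ((c.extend (𝓡∂ 4)).symm y) := fun hV y hy =>
    mdifferentiableAt_comp_chart hc hV (symm_mem_source hy)
  have htrans : ∀ {v w : M → ℝ} {V W : E4 → ℝ}, (∀ y ∈ T, inChart v c y = V y) →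
      (∀ y ∈ T, inChart w c y = W y) →
      (∀ y ∈ T, MDifferentiableAt (𝓡∂ 4) 𝓘(ℝ, ℝ) v ((c.extend (𝓡∂ 4)).symm y)) →
      (∀ y ∈ T, MDifferentiableAt (𝓡∂ 4) 𝓘(ℝ, ℝ) w ((c.extend (𝓡∂ 4)).symm y)) → ∀ y ∈ T',
      pairIn G V W (c.extend (𝓡∂ 4) ((c'.extend (𝓡∂ 4)).symm y))
        = pairIn G' (inChart v c') (inChart w c') y := by
    intro v w V W hV hW hv hw y hy
    have h1 := hφT _ hy.2
    rw [← pairIn_congr hT hV hW h1]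
    exact pairIn_eq_pairIn g hc hc' h1 hy.1 (hψφ _ hy.2) (hv _ h1) (hw _ h1)
  have hφx : c.extend (𝓡∂ 4) ((c'.extend (𝓡∂ 4)).symm x') = x := by rw [← hxx, hφψ x hx]
  have hlift : ∀ V : E4 → ℝ, ContDiffOn ℝ ∞ V T → ∃ v : M → ℝ, (∀ y ∈ T, inChart v c y = V y) ∧
      (∀ y ∈ T, MDifferentiableAt (𝓡∂ 4) 𝓘(ℝ, ℝ) v ((c.extend (𝓡∂ 4)).symm y)) ∧
      ContMDiffOn (𝓡∂ 4) 𝓘(ℝ, ℝ) ∞ v c.source ∧ ∀ p, v p = V (c.extend (𝓡∂ 4) p) := fun V hV =>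
    ⟨fun p => V (c.extend (𝓡∂ 4) p), fun y hy => congrArg V (hφψ y hy), hpull hV,
      contMDiffOn_comp_chart hc hV, fun _ => rfl⟩
  have hFUs := hG.contDiffOn_pairIn hT hF hU
  have hUUs := hG.contDiffOn_pairIn hT hU hU
  obtain ⟨um, humc, humd, hums, -⟩ := hlift U hU
  obtain ⟨a, hac, had, -, haa⟩ := hlift _ hFUs
  obtain ⟨b, hbc, hbd, -, hbb⟩ := hlift _ hUUs
  have hU' : ContDiffOn ℝ ∞ (inChart um c') T' := by
    rw [← contMDiffOn_iff_contDiffOn]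
    exact hums.comp ((contMDiffOn_chart_symm hc').mono hT1s) fun y hy => hy.2
  have hFc : ∀ y ∈ T, inChart f c y = F y := fun _ _ => rfl
  have hFm : ∀ y ∈ T, MDifferentiableAt (𝓡∂ 4) 𝓘(ℝ, ℝ) f ((c.extend (𝓡∂ 4)).symm y) :=
    fun y _ => hfd _
  have ha' : ∀ y ∈ T', inChart a c' y = pairIn G' F' (inChart um c') y := fun y hy =>
    (haa _).trans (htrans hFc humc hFm humd y hy)
  have hb' : ∀ y ∈ T', inChart b c' y = pairIn G' (inChart um c') (inChart um c') y :=
    fun y hy => (hbb _).trans (htrans humc humc humd humd y hy)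
  have e1 := htrans hFc hFc hFm hFm x' hx1
  have e2 := htrans hFc humc hFm humd x' hx1
  have e3 := htrans humc humc humd humd x' hx1
  have e4 := htrans humc hac humd had x' hx1
  have e5 := htrans hFc hbc hFm hbd x' hx1
  rw [hφx] at e1 e2 e3 e4 e5
  rw [pairIn_congr hT1 (fun _ _ => rfl) ha' hx1] at e4
  rw [pairIn_congr hT1 (fun _ _ => rfl) hb' hx1] at e5
  have k1 := umbilic_pair hT hG hF hU hx hr hκ hFU
  have k2 := umbilic_pair hT1 (hG'.mono hT1s) (hF'.mono hT1s) hU' hx1 hr' hκ' (e2 ▸ hFU)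
  rw [e4, e5, ← k2, e1, e3] at k1
  have h1 : 0 < Real.sqrt (pairIn G' F' F' x') := Real.sqrt_pos.mpr (hG'.pairIn_pos hx' hr')
  have h2 : 0 < pairIn G' (inChart um c') (inChart um c') x' := e3 ▸ hUU
  have : κ = κ' := by
    have := mul_left_cancel₀ two_ne_zero k1
    exact mul_right_cancel₀ h1.ne' (mul_right_cancel₀ h2.ne' this)
  rw [this]

end Manifold

/-! ### Components of the level surfaces -/

section LevelComponents

variable {M : Type*} [TopologicalSpace M] [ChartedSpace (EuclideanHalfSpace 4) M]
  {c : OpenPartialHomeomorph M (EuclideanHalfSpace 4)} {x : E4} {p q : M} {f : M → ℝ}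

lemma mem_levelComponent_self (hp : IsRegularPoint f p) : p ∈ levelComponent f p :=
  mem_connectedComponentIn ⟨rfl, hp⟩

lemma eq_of_mem_levelComponent (hq : q ∈ levelComponent f p) : f q = f p :=
  (connectedComponentIn_subset _ _ hq).1

lemma isRegularPoint_of_mem_levelComponent (hq : q ∈ levelComponent f p) : IsRegularPoint f q :=
  (connectedComponentIn_subset _ _ hq).2

/-- A function that is locally constant on a component of a level surface is constant on it. -/
lemma eq_on_levelComponent (hp : IsRegularPoint f p) {k : M → ℝ}
    (hk : ∀ q ∈ levelComponent f p, ∃ c : OpenPartialHomeomorph M (EuclideanHalfSpace 4),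
      q ∈ c.source ∧ ∀ᶠ y in 𝓝[(c.extend (𝓡∂ 4)).target] (c.extend (𝓡∂ 4) q),
        inChart f c y = inChart f c (c.extend (𝓡∂ 4) q) →
        (c.extend (𝓡∂ 4)).symm y ∈ levelComponent f p → k ((c.extend (𝓡∂ 4)).symm y) = k q)
    (hq : q ∈ levelComponent f p) : k p = k q := by
  refine isPreconnected_connectedComponentIn.induction₂ (fun a b => k a = k b) ?_
    (fun _ _ _ _ _ _ h h' => h.trans h') (fun _ _ _ _ h => h.symm) (mem_levelComponent_self hp) hq
  intro a ha
  obtain ⟨c, hac, hev⟩ := hk a ha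
  have ht : Filter.Tendsto (c.extend (𝓡∂ 4)) (𝓝 a)
      (𝓝[(c.extend (𝓡∂ 4)).target] (c.extend (𝓡∂ 4) a)) := by
    rw [c.nhdsWithin_extend_target_eq hac, ← c.map_extend_nhds hac]
    exact Filter.tendsto_map
  filter_upwards [nhdsWithin_le_nhds (ht.eventually hev), self_mem_nhdsWithin,
    nhdsWithin_le_nhds (c.open_source.mem_nhds hac)] with b hb hbC hbc
  rw [c.extend_left_inv hbc, inChart_chart f hbc, inChart_chart f hac,
    eq_of_mem_levelComponent ha, eq_of_mem_levelComponent hbC] at hb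
  exact (hb rfl hbC).symm

variable [IsManifold (𝓡∂ 4) ∞ M]

lemma isRegularPoint_iff_chart (hf : ContMDiff (𝓡∂ 4) 𝓘(ℝ, ℝ) ∞ f)
    (hc : c ∈ atlas (EuclideanHalfSpace 4) M) (hq : q ∈ c.source) :
    IsRegularPoint f q ↔ ∃ i, pd i (inChart f c) (c.extend (𝓡∂ 4) q) ≠ 0 := by
  rw [← isRegularPoint_iff hc (chart_mem_target hq) ((hf _).mdifferentiableAt (by simp)),
    c.extend_left_inv hq]

/-- A connected part of the level set in a chart that meets a component of a level surface lies in
this component. -/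
lemma subset_levelComponent (hf : ContMDiff (𝓡∂ 4) 𝓘(ℝ, ℝ) ∞ f)
    (hc : c ∈ atlas (EuclideanHalfSpace 4) M)
    (hxp : (c.extend (𝓡∂ 4)).symm x ∈ levelComponent f p) {S : Set E4} (hS : IsPreconnected S)
    (hxS : x ∈ S) (hSl : S ⊆ regularLevel (c.extend (𝓡∂ 4)).target (inChart f c) x) :
    S ⊆ {y | y ∈ (c.extend (𝓡∂ 4)).target ∧ (c.extend (𝓡∂ 4)).symm y ∈ levelComponent f p} := by
  intro y hy
  refine ⟨(hSl hy).1, ?_⟩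
  have h1 : (c.extend (𝓡∂ 4)).symm '' S ⊆ {q | f q = f p ∧ IsRegularPoint f q} := by
    rintro _ ⟨z, hz, rfl⟩
    obtain ⟨h2, h3, h4⟩ := hSl hz
    exact ⟨h3.trans (eq_of_mem_levelComponent hxp),
      (isRegularPoint_iff hc h2 ((hf _).mdifferentiableAt (by simp))).mpr h4⟩
  have h2 := (hS.image _ ((c.continuousOn_extend_symm (I := 𝓡∂ 4)).mono
    fun z hz => (hSl hz).1)).subset_connectedComponentIn ⟨x, hxS, rfl⟩ h1
  have h3 : connectedComponentIn {q | f q = f p ∧ IsRegularPoint f q} ((c.extend (𝓡∂ 4)).symm x)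
      = levelComponent f p := (connectedComponentIn_eq hxp).symm
  rw [h3] at h2
  exact h2 ⟨y, hy, rfl⟩

lemma inChart_eq_zero_of_boundary (hbd : ∀ p ∈ (𝓡∂ 4).boundary M, f p = 0)
    (hc : c ∈ atlas (EuclideanHalfSpace 4) M) (hx : x ∈ (c.extend (𝓡∂ 4)).target)
    (h0 : x 0 = 0) : inChart f c x = 0 := by
  refine hbd _ ?_
  have h1 := ModelWithCorners.isBoundaryPoint_iff_of_mem_atlas (I := 𝓡∂ 4) (n := ∞) (by simp) hc
    (symm_mem_source hx)
  refine h1.mpr ?_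
  rw [(c.extend (𝓡∂ 4)).right_inv hx]
  refine ⟨subset_closure hx, fun h2 => ?_⟩
  have h3 := interior_mono (isCoordDomain_target c).subset h2
  rw [interior_range_modelWithCornersEuclideanHalfSpace] at h3
  exact (ne_of_gt h3) h0

lemma pos_of_inChart_ne_zero (hbd : ∀ p ∈ (𝓡∂ 4).boundary M, f p = 0)
    (hc : c ∈ atlas (EuclideanHalfSpace 4) M) (hx : x ∈ (c.extend (𝓡∂ 4)).target)
    (h : inChart f c x ≠ 0) : 0 < x 0 := by
  have h1 : 0 ≤ x 0 := by
    have := (isCoordDomain_target c).subset hx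
    rwa [range_modelWithCornersEuclideanHalfSpace] at this
  exact lt_of_le_of_ne h1 fun h0 => h (inChart_eq_zero_of_boundary hbd hc hx h0.symm)

end LevelComponents

/-! ### Solutions of the Miao–Tam equation on a manifold -/

namespace IsMiaoTamChart

variable {T : Set E4} {G : E4 → Matrix (Fin 4) (Fin 4) ℝ} {F : E4 → ℝ} {x : E4}

/-- The mean curvature in terms of `F`, `|∇F|²` and `Ric(∇F, ∇F)` alone. -/
lemma meanCurv_eq_grad (h : IsMiaoTamChart T G F) (hx : x ∈ T) (hreg : ∃ i, pd i F x ≠ 0) :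
    meanCurv G F x = (-1 - F x * (ricAt G x (grad G F x) (grad G F x) / pairIn G F F x))
      / Real.sqrt (pairIn G F F x) := by
  obtain ⟨e, he⟩ := h.metric.exists_adaptedFrame hx hreg
  rw [h.meanCurv_eq hx hreg he, he.last_eq, ricAt_normal_normal h.metric hx hreg, gradNorm,
    h.metric.gAt_grad_grad hx]
  congr 1
  linear_combination h.three_lap hx

end IsMiaoTamChart

section Solutions

variable {M : Type*} [TopologicalSpace M] [ChartedSpace (EuclideanHalfSpace 4) M]
  [IsManifold (𝓡∂ 4) ∞ M]
  {c c' : OpenPartialHomeomorph M (EuclideanHalfSpace 4)} {p q : M} {f : M → ℝ}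
  {g : Bundle.ContMDiffRiemannianMetric (𝓡∂ 4) ∞ E4 (fun p : M => TangentSpace (𝓡∂ 4) p)}

lemma isMiaoTamChart_inChart (hf : ContMDiff (𝓡∂ 4) 𝓘(ℝ, ℝ) ∞ f) (hMT : SatisfiesMiaoTamEq g f)
    (hW : HasHarmonicWeylPlus g) (hc : c ∈ atlas (EuclideanHalfSpace 4) M) :
    IsMiaoTamChart (c.extend (𝓡∂ 4)).target (metricInChart g c) (inChart f c) where
  dom := isCoordDomain_target c
  metric := isMetricOn_metricInChart g hc
  smooth := contDiffOn_inChart hc hf.contMDiffOn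
  eq := hMT c hc
  div_weylPlus := hW c hc

lemma pairIn_eq_pairIn_chart (hf : ContMDiff (𝓡∂ 4) 𝓘(ℝ, ℝ) ∞ f)
    (hc : c ∈ atlas (EuclideanHalfSpace 4) M) (hc' : c' ∈ atlas (EuclideanHalfSpace 4) M)
    (hq : q ∈ c.source) (hq' : q ∈ c'.source) :
    pairIn (metricInChart g c) (inChart f c) (inChart f c) (c.extend (𝓡∂ 4) q)
      = pairIn (metricInChart g c') (inChart f c') (inChart f c') (c'.extend (𝓡∂ 4) q) :=
  pairIn_eq_pairIn g hc hc' (chart_mem_target hq) (chart_mem_target hq')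
    (by rw [c.extend_left_inv hq, c'.extend_left_inv hq'])
    ((hf _).mdifferentiableAt (by simp)) ((hf _).mdifferentiableAt (by simp))

lemma meanCurv_eq_meanCurv_chart (hf : ContMDiff (𝓡∂ 4) 𝓘(ℝ, ℝ) ∞ f)
    (hc : c ∈ atlas (EuclideanHalfSpace 4) M) (hc' : c' ∈ atlas (EuclideanHalfSpace 4) M)
    (hq : q ∈ c.source) (hq' : q ∈ c'.source) (hreg : IsRegularPoint f q)
    (hu : IsUmbilicAt g f q) :
    meanCurv (metricInChart g c) (inChart f c) (c.extend (𝓡∂ 4) q)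
      = meanCurv (metricInChart g c') (inChart f c') (c'.extend (𝓡∂ 4) q) :=
  meanCurv_eq_meanCurv g hf hc hc' (chart_mem_target hq) (chart_mem_target hq')
    (by rw [c.extend_left_inv hq, c'.extend_left_inv hq'])
    (by rwa [c.extend_left_inv hq]) (hu c hc hq) (hu c' hc' hq')

/-- `|∇f|²` is constant near a regular point along the level set. -/
lemma eventually_pairIn_eq (hf : ContMDiff (𝓡∂ 4) 𝓘(ℝ, ℝ) ∞ f)
    (hbd : ∀ p ∈ (𝓡∂ 4).boundary M, f p = 0) (hMT : SatisfiesMiaoTamEq g f)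
    (hW : HasHarmonicWeylPlus g) (hc : c ∈ atlas (EuclideanHalfSpace 4) M) (hq : q ∈ c.source)
    (hreg : IsRegularPoint f q) :
    ∀ᶠ y in 𝓝[(c.extend (𝓡∂ 4)).target] (c.extend (𝓡∂ 4) q),
      inChart f c y = inChart f c (c.extend (𝓡∂ 4) q) →
      pairIn (metricInChart g c) (inChart f c) (inChart f c) y
        = pairIn (metricInChart g c) (inChart f c) (inChart f c) (c.extend (𝓡∂ 4) q) := by
  have h := isMiaoTamChart_inChart hf hMT hW hc
  exact h.dom.eventually_eq h.smooth (h.metric.contDiffOn_pairIn h.dom h.smooth h.smooth)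
    (chart_mem_target hq) ((isRegularPoint_iff_chart hf hc hq).mp hreg)
    (fun y hy => inChart_eq_zero_of_boundary hbd hc hy) (fun S _ _ hS => hS)
    fun y hy X hX => h.pd_pairIn_tangent hy.1 hy.2.2 hX

/-- `|∇f|²` is constant on the components of the level surfaces. -/
lemma pairIn_eq_on_levelComponent (hf : ContMDiff (𝓡∂ 4) 𝓘(ℝ, ℝ) ∞ f)
    (hbd : ∀ p ∈ (𝓡∂ 4).boundary M, f p = 0) (hMT : SatisfiesMiaoTamEq g f)
    (hW : HasHarmonicWeylPlus g) (hp : IsRegularPoint f p) (hq : q ∈ levelComponent f p)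
    (hc : c ∈ atlas (EuclideanHalfSpace 4) M) (hc' : c' ∈ atlas (EuclideanHalfSpace 4) M)
    (hpc : p ∈ c.source) (hqc : q ∈ c'.source) :
    pairIn (metricInChart g c) (inChart f c) (inChart f c) (c.extend (𝓡∂ 4) p)
      = pairIn (metricInChart g c') (inChart f c') (inChart f c') (c'.extend (𝓡∂ 4) q) := by
  have hch : ∀ a : M, chartAt (EuclideanHalfSpace 4) a ∈ atlas (EuclideanHalfSpace 4) M :=
    fun a => chart_mem_atlas _ a
  have hsrc : ∀ a : M, a ∈ (chartAt (EuclideanHalfSpace 4) a).source := fun a => mem_chart_source _ a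
  rw [pairIn_eq_pairIn_chart hf hc (hch p) hpc (hsrc p),
    pairIn_eq_pairIn_chart hf hc' (hch q) hqc (hsrc q)]
  refine eq_on_levelComponent (k := fun a => pairIn (metricInChart g (chartAt _ a))
    (inChart f (chartAt _ a)) (inChart f (chartAt _ a))
    ((chartAt (EuclideanHalfSpace 4) a).extend (𝓡∂ 4) a)) hp (fun a ha => ?_) hq
  refine ⟨chartAt _ a, hsrc a, ?_⟩
  filter_upwards [eventually_pairIn_eq hf hbd hMT hW (hch a) (hsrc a)
    (isRegularPoint_of_mem_levelComponent ha), self_mem_nhdsWithin] with y hy hyT hfy _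
  rw [← hy hfy]
  refine (pairIn_eq_pairIn_chart hf (hch _) (hch a) (hsrc _) (symm_mem_source hyT)).trans ?_
  rw [((chartAt (EuclideanHalfSpace 4) a).extend (𝓡∂ 4)).right_inv hyT]

/-- Equality holds on the open set of regular points around which the level sets are umbilical. -/
lemma ricciEqualityIn_of_isOpen (hf : ContMDiff (𝓡∂ 4) 𝓘(ℝ, ℝ) ∞ f) (hMT : SatisfiesMiaoTamEq g f)
    (hW : HasHarmonicWeylPlus g) (hc : c ∈ atlas (EuclideanHalfSpace 4) M) {U : Set M}
    (hU : IsOpen U) (hu : ∀ q ∈ U, IsUmbilicAt g f q) (hpU : p ∈ U) (hpc : p ∈ c.source)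
    (hreg : IsRegularPoint f p) :
    IsMiaoTamChart.RicciEqualityIn (metricInChart g c) (inChart f c) (c.extend (𝓡∂ 4) p) := by
  refine (isMiaoTamChart_inChart hf hMT hW hc).ricciEquality_of_eventually (chart_mem_target hpc)
    ((isRegularPoint_iff_chart hf hc hpc).mp hreg) ?_
  have h1 : ∀ᶠ y in 𝓝[(c.extend (𝓡∂ 4)).target] (c.extend (𝓡∂ 4) p),
      (c.extend (𝓡∂ 4)).symm y ∈ U := by
    refine nhdsWithin_le_nhds ((c.continuousAt_extend_symm hpc).eventually_mem ?_)
    rw [c.extend_left_inv hpc]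
    exact hU.mem_nhds hpU
  filter_upwards [h1, self_mem_nhdsWithin] with y hy hyT _
  have := hu _ hy c hc (symm_mem_source hyT)
  rwa [(c.extend (𝓡∂ 4)).right_inv hyT] at this

/-- On a component of umbilical points with `f ≠ 0`, `Ric(∇f, ∇f)` is stationary and the mixed
curvature components vanish. -/
lemma umbilic_component (hf : ContMDiff (𝓡∂ 4) 𝓘(ℝ, ℝ) ∞ f)
    (hbd : ∀ p ∈ (𝓡∂ 4).boundary M, f p = 0) (hMT : SatisfiesMiaoTamEq g f)
    (hW : HasHarmonicWeylPlus g) (hu : ∀ q ∈ levelComponent f p, IsUmbilicAt g f q)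
    (h0 : f p ≠ 0) (hc : c ∈ atlas (EuclideanHalfSpace 4) M) {x : E4}
    (hx : x ∈ (c.extend (𝓡∂ 4)).target)
    (hxp : (c.extend (𝓡∂ 4)).symm x ∈ levelComponent f p) :
    (∀ X, IsTangentToLevel (inChart f c) x X → ∑ m, pd m (fun y => ricAt (metricInChart g c) y
      (grad (metricInChart g c) (inChart f c) y) (grad (metricInChart g c) (inChart f c) y)) x * X m
        = 0) ∧
    ∀ X Y Z, IsTangentToLevel (inChart f c) x X → IsTangentToLevel (inChart f c) x Y →
      IsTangentToLevel (inChart f c) x Z →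
      IsMiaoTamChart.riemGrad (metricInChart g c) (inChart f c) x X Y Z = 0 := by
  have h := isMiaoTamChart_inChart hf hMT hW hc
  have hreg : ∀ y ∈ (c.extend (𝓡∂ 4)).target, (c.extend (𝓡∂ 4)).symm y ∈ levelComponent f p →
      ∃ i, pd i (inChart f c) y ≠ 0 := fun y hy hyp =>
    (isRegularPoint_iff hc hy ((hf _).mdifferentiableAt (by simp))).mp
      (isRegularPoint_of_mem_levelComponent hyp)
  have hne : ∀ y, (c.extend (𝓡∂ 4)).symm y ∈ levelComponent f p → inChart f c y ≠ 0 := fun y hyp => by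
    rwa [inChart, eq_of_mem_levelComponent hyp]
  refine h.umbilic_derivative
    (C := {y | y ∈ (c.extend (𝓡∂ 4)).target ∧ (c.extend (𝓡∂ 4)).symm y ∈ levelComponent f p})
    (fun y hy => hy.1) (fun y hy => hreg y hy.1 hy.2) (fun y hy => ?_) ⟨hx, hxp⟩ (hne x hxp) ?_
  · have := hu _ hy.2 c hc (symm_mem_source hy.1)
    rw [(c.extend (𝓡∂ 4)).right_inv hy.1] at this
    exact h.ricciEquality_of_isUmbilicIn hy.1 (hreg y hy.1 hy.2) (hne y hy.2) this
  · intro X hX u hus huC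
    exact h.dom.sum_pd_eq_zero_of_tangent h.smooth hus hx (hreg x hx hxp)
      (pos_of_inChart_ne_zero hbd hc hx (hne x hxp))
      (fun S hS hxS hSl => subset_levelComponent hf hc hxp hS hxS hSl) huC hX

/-- The mean curvature is locally constant on a component of umbilical points. -/
lemma eventually_meanCurv_eq (hf : ContMDiff (𝓡∂ 4) 𝓘(ℝ, ℝ) ∞ f)
    (hbd : ∀ p ∈ (𝓡∂ 4).boundary M, f p = 0) (hMT : SatisfiesMiaoTamEq g f)
    (hW : HasHarmonicWeylPlus g) (hu : ∀ q ∈ levelComponent f p, IsUmbilicAt g f q)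
    (hc : c ∈ atlas (EuclideanHalfSpace 4) M) (hqc : q ∈ c.source)
    (hq : q ∈ levelComponent f p) :
    ∀ᶠ y in 𝓝[(c.extend (𝓡∂ 4)).target] (c.extend (𝓡∂ 4) q),
      inChart f c y = inChart f c (c.extend (𝓡∂ 4) q) →
      (c.extend (𝓡∂ 4)).symm y ∈ levelComponent f p →
      meanCurv (metricInChart g c) (inChart f c) y
        = meanCurv (metricInChart g c) (inChart f c) (c.extend (𝓡∂ 4) q) := by
  have h := isMiaoTamChart_inChart hf hMT hW hc
  have hregq := isRegularPoint_of_mem_levelComponent hq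
  have hx := chart_mem_target hqc
  have hxr := (isRegularPoint_iff_chart hf hc hqc).mp hregq
  have hr : ∀ᶠ y in 𝓝[(c.extend (𝓡∂ 4)).target] (c.extend (𝓡∂ 4) q),
      inChart f c y = inChart f c (c.extend (𝓡∂ 4) q) → inChart f c y = 0 ∨
      ricAt (metricInChart g c) y (grad (metricInChart g c) (inChart f c) y)
        (grad (metricInChart g c) (inChart f c) y)
      = ricAt (metricInChart g c) (c.extend (𝓡∂ 4) q)
        (grad (metricInChart g c) (inChart f c) (c.extend (𝓡∂ 4) q))
        (grad (metricInChart g c) (inChart f c) (c.extend (𝓡∂ 4) q)) := by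
    by_cases h0 : f p = 0
    · refine Filter.Eventually.of_forall fun y hy => Or.inl ?_
      rw [hy, inChart_chart f hqc, eq_of_mem_levelComponent hq, h0]
    have hus : ContDiffOn ℝ ∞ (fun y => ricAt (metricInChart g c) y
        (grad (metricInChart g c) (inChart f c) y) (grad (metricInChart g c) (inChart f c) y))
        (c.extend (𝓡∂ 4)).target :=
      (show Rep h.ricGradFn _ from rep_iff.2 h.eval_ricGradFn).contDiffOn
    filter_upwards [h.dom.eventually_eq h.smooth hus hx hxr
      (fun y hy => inChart_eq_zero_of_boundary hbd hc hy)
      (fun S hS hxS hSl => subset_levelComponent hf hc (by rwa [c.extend_left_inv hqc]) hS hxS hSl)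
      fun y hy X hX => (umbilic_component hf hbd hMT hW hu h0 hc hy.1 hy.2).1 X hX] with y hy hFy
    exact Or.inr (hy hFy)
  filter_upwards [hr, eventually_pairIn_eq hf hbd hMT hW hc hqc hregq, self_mem_nhdsWithin]
    with y hy1 hy2 hyT hFy hyC
  rw [h.meanCurv_eq_grad hx hxr, h.meanCurv_eq_grad hyT
    ((isRegularPoint_iff hc hyT ((hf _).mdifferentiableAt (by simp))).mp
      (isRegularPoint_of_mem_levelComponent hyC)), hy2 hFy]
  rcases hy1 hFy with h0 | h0
  · rw [← hFy, h0, zero_mul, zero_mul]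
  · rw [h0, hFy]

/-- The mean curvature is constant on a component of umbilical points. -/
lemma meanCurv_eq_on_levelComponent (hf : ContMDiff (𝓡∂ 4) 𝓘(ℝ, ℝ) ∞ f)
    (hbd : ∀ p ∈ (𝓡∂ 4).boundary M, f p = 0) (hMT : SatisfiesMiaoTamEq g f)
    (hW : HasHarmonicWeylPlus g) (hp : IsRegularPoint f p)
    (hu : ∀ q ∈ levelComponent f p, IsUmbilicAt g f q) (hq : q ∈ levelComponent f p)
    (hc : c ∈ atlas (EuclideanHalfSpace 4) M) (hc' : c' ∈ atlas (EuclideanHalfSpace 4) M)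
    (hpc : p ∈ c.source) (hqc : q ∈ c'.source) :
    meanCurv (metricInChart g c) (inChart f c) (c.extend (𝓡∂ 4) p)
      = meanCurv (metricInChart g c') (inChart f c') (c'.extend (𝓡∂ 4) q) := by
  have hch : ∀ a : M, chartAt (EuclideanHalfSpace 4) a ∈ atlas (EuclideanHalfSpace 4) M :=
    fun a => chart_mem_atlas _ a
  have hsrc : ∀ a : M, a ∈ (chartAt (EuclideanHalfSpace 4) a).source := fun a => mem_chart_source _ a
  rw [meanCurv_eq_meanCurv_chart hf hc (hch p) hpc (hsrc p) hp (hu p (mem_levelComponent_self hp)),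
    meanCurv_eq_meanCurv_chart hf hc' (hch q) hqc (hsrc q)
      (isRegularPoint_of_mem_levelComponent hq) (hu q hq)]
  refine eq_on_levelComponent (k := fun a => meanCurv (metricInChart g (chartAt _ a))
    (inChart f (chartAt _ a)) ((chartAt (EuclideanHalfSpace 4) a).extend (𝓡∂ 4) a)) hp
    (fun a ha => ?_) hq
  refine ⟨chartAt _ a, hsrc a, ?_⟩
  filter_upwards [eventually_meanCurv_eq hf hbd hMT hW hu (hch a) (hsrc a) ha, self_mem_nhdsWithin]
    with y hy hyT hfy hyC
  rw [← hy hfy hyC]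
  refine (meanCurv_eq_meanCurv_chart hf (hch _) (hch a) (hsrc _) (symm_mem_source hyT)
    (isRegularPoint_of_mem_levelComponent hyC) (hu _ hyC)).trans ?_
  rw [((chartAt (EuclideanHalfSpace 4) a).extend (𝓡∂ 4)).right_inv hyT]

end Solutions

end MiaoTam

end

open MiaoTam in
theorem lemma3 {M : Type*} [TopologicalSpace M] [ChartedSpace (EuclideanHalfSpace 4) M]
    [IsManifold (𝓡∂ 4) ∞ M]
    (horient : IsOrientedAtlas M)
    (g : Bundle.ContMDiffRiemannianMetric (𝓡∂ 4) ∞ E4 (fun p : M => TangentSpace (𝓡∂ 4) p))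
    (f : M → ℝ) (hf : ContMDiff (𝓡∂ 4) 𝓘(ℝ, ℝ) ∞ f)
    (hbd : ∀ p ∈ (𝓡∂ 4).boundary M, f p = 0)
    (hMT : SatisfiesMiaoTamEq g f)
    (hW : HasHarmonicWeylPlus g) :
    -- pointwise assertions, in any chart around a regular point
    (∀ p : M, IsRegularPoint f p →
      ∀ c ∈ atlas (EuclideanHalfSpace 4) M, p ∈ c.source →
        let G := metricInChart g c
        let F := inChart f c
        let x := c.extend (𝓡∂ 4) p
        -- the gradient is an eigenvector of the Ricci tensor
        (∃ μ : ℝ, ∀ X : Fin 4 → ℝ, ricAt G x (grad G F x) X = μ * gAt G x (grad G F x) X) ∧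
        ∀ e : Fin 4 → Fin 4 → ℝ, IsAdaptedFrame G F x e →
          -- R_{4i} = 0 for i = 1, 2, 3, and e₄ is an eigenvector of the Ricci operator
          (∀ i : Fin 3, ricAt G x (e 3) (e i.castSucc) = 0) ∧
          (∀ X : Fin 4 → ℝ, ricAt G x (e 3) X = ricAt G x (e 3) (e 3) * gAt G x (e 3) X) ∧
          -- the second fundamental form and the mean curvature of the level set
          (∀ i j : Fin 3, secondFF G F x (e i.castSucc) (e j.castSucc) =
            ((1 + lap G F x) * gAt G x (e i.castSucc) (e j.castSucc)
              + f p * ricAt G x (e i.castSucc) (e j.castSucc)) / gradNorm G F x) ∧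
          meanCurv G F x =
            (3 * (1 + lap G F x) + f p * (scal G x - ricAt G x (e 3) (e 3))) / gradNorm G F x ∧
          -- the inequality
          3 * ricNormSq G x ≥
            3 * ricAt G x (e 3) (e 3) ^ 2 + (scal G x - ricAt G x (e 3) (e 3)) ^ 2) ∧
    -- |∇f|² is constant on the components of the level surfaces
    (∀ p : M, IsRegularPoint f p → ∀ q ∈ levelComponent f p,
      ∀ c ∈ atlas (EuclideanHalfSpace 4) M, p ∈ c.source →
      ∀ c' ∈ atlas (EuclideanHalfSpace 4) M, q ∈ c'.source →
        gradNorm (metricInChart g c) (inChart f c) (c.extend (𝓡∂ 4) p) ^ 2 =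
          gradNorm (metricInChart g c') (inChart f c') (c'.extend (𝓡∂ 4) q) ^ 2) ∧
    -- equality holds if and only if the level sets are umbilical
    (∀ p : M, IsRegularPoint f p → RicciEqualityAt g f p → IsUmbilicAt g f p) ∧
    (∀ p : M, IsRegularPoint f p → f p ≠ 0 → IsUmbilicAt g f p → RicciEqualityAt g f p) ∧
    (∀ U : Set M, IsOpen U → (∀ p ∈ U, IsRegularPoint f p) →
      ((∀ p ∈ U, RicciEqualityAt g f p) ↔ ∀ p ∈ U, IsUmbilicAt g f p)) ∧
    -- the mean curvature and the Weyl tensor in the umbilical case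
    (∀ p : M, IsRegularPoint f p → (∀ q ∈ levelComponent f p, IsUmbilicAt g f q) →
      (∀ q ∈ levelComponent f p,
        ∀ c ∈ atlas (EuclideanHalfSpace 4) M, p ∈ c.source →
        ∀ c' ∈ atlas (EuclideanHalfSpace 4) M, q ∈ c'.source →
          meanCurv (metricInChart g c) (inChart f c) (c.extend (𝓡∂ 4) p) =
            meanCurv (metricInChart g c') (inChart f c') (c'.extend (𝓡∂ 4) q)) ∧
      (∀ q ∈ levelComponent f p, ∀ c ∈ atlas (EuclideanHalfSpace 4) M, q ∈ c.source →
        ∀ e : Fin 4 → Fin 4 → ℝ,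
          IsAdaptedFrame (metricInChart g c) (inChart f c) (c.extend (𝓡∂ 4) q) e →
          ∀ i j k : Fin 3,
            weylAt (metricInChart g c) (c.extend (𝓡∂ 4) q)
              (e 3) (e i.castSucc) (e j.castSucc) (e k.castSucc) = 0)) := by
  have hchart := fun c hc => isMiaoTamChart_inChart (c := c) hf hMT hW hc
  have hregc : ∀ {p : M} {c : OpenPartialHomeomorph M (EuclideanHalfSpace 4)},
      c ∈ atlas (EuclideanHalfSpace 4) M → p ∈ c.source → IsRegularPoint f p →
      ∃ i, pd i (inChart f c) (c.extend (𝓡∂ 4) p) ≠ 0 := fun hc hp h =>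
    (isRegularPoint_iff_chart hf hc hp).mp h
  have hequmb : ∀ p : M, IsRegularPoint f p → RicciEqualityAt g f p → IsUmbilicAt g f p :=
    fun p hp heq c hc hpc => (hchart c hc).isUmbilicIn_of_ricciEquality (chart_mem_target hpc)
      (hregc hc hpc hp) (heq c hc hpc)
  refine ⟨?_, ?_, hequmb, ?_, ?_, ?_⟩
  · intro p hp c hc hpc G F x
    have h := hchart c hc
    have hx : x ∈ (c.extend (𝓡∂ 4)).target := chart_mem_target hpc
    have hr := hregc hc hpc hp
    have hFx : f p = F x := (inChart_chart f hpc).symm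
    refine ⟨h.exists_eigen hx hr, fun e he => ⟨h.ricAt_last hx hr he, ?_, ?_, ?_, ?_⟩⟩
    · rw [he.last_eq]
      exact h.ricAt_normal hx hr
    · intro i j
      rw [hFx]
      exact h.secondFF_eq hx hr _ (he.tangent h.metric hx hr j)
    · rw [hFx]
      exact h.meanCurv_eq hx hr he
    · exact h.ricci_ineq hx hr he
  · intro p hp q hq c hc hpc c' hc' hqc
    rw [(hchart c hc).metric.gradNorm_sq (chart_mem_target hpc),
      (hchart c' hc').metric.gradNorm_sq (chart_mem_target hqc)]
    exact pairIn_eq_on_levelComponent hf hbd hMT hW hp hq hc hc' hpc hqc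
  · intro p hp h0 hu c hc hpc
    exact (hchart c hc).ricciEquality_of_isUmbilicIn (chart_mem_target hpc) (hregc hc hpc hp)
      (by rwa [inChart_chart f hpc]) (hu c hc hpc)
  · intro U hU hUr
    refine ⟨fun h p hp => hequmb p (hUr p hp) (h p hp), fun h p hp c hc hpc => ?_⟩
    exact ricciEqualityIn_of_isOpen hf hMT hW hc hU h hp hpc (hUr p hp)
  · intro p hp hu
    refine ⟨fun q hq c hc hpc c' hc' hqc => ?_, fun q hq c hc hqc e he i j k => ?_⟩
    · exact meanCurv_eq_on_levelComponent hf hbd hMT hW hp hu hq hc hc' hpc hqc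
    · have h := hchart c hc
      have hx := chart_mem_target hqc
      have hr := hregc hc hqc (isRegularPoint_of_mem_levelComponent hq)
      refine h.weylAt_eq_zero hx hr ?_ he i j k
      by_cases h0 : f p = 0
      · exact fun X Y Z hX hY _ => h.riemGrad_eq_zero_of_eq_zero hx
          (by rw [inChart_chart f hqc, eq_of_mem_levelComponent hq, h0]) Z hX hY
      · exact (umbilic_component hf hbd hMT hW hu h0 hc hx (by rwa [c.extend_left_inv hqc])).2
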